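/- Let $X$ be a compact metric space with a continuous flow $\phi:\mathbb R\curvearrowright X$ that is free ($\phi_t(x)=x$ only for $t=0$) and minimal (every forward orbit is dense). A *flowbox* of length $l>0$ is a compact set $B\subset X$ such that for every $x\in B$ there are $a_-(x)\le 0\le a_+(x)$ and $\epsilon>0$ with $a_+(x)-a_-(x)=l$, $\phi_t(x)\in B$ for $t\in[a_-(x),a_+(x)]$ and $\phi_t(x)\notin B$ for $t\in(a_-(x)-\epsilon,a_-(x))\cup(a_+(x),a_+(x)+\epsilon)$; its *central slice* is $\{x\in B: a_-(x)+a_+(x)=0\}$. Let $\bar x\in X$ and let $(B_n)_{n\ge 0}$ be a Cantor flowbox structure around $\bar x$, that is, a sequence of flowboxes with non-empty interior, lengths $l_n$ and central slices $S_n$ such that - $S_{n+1}\subset S_n\cap B_n^\circ$ for all $n$, $l_n\to\infty$, and $S_n$ lies in the open ball of radius $1/n$ around $\bar x$ for $n\ge1$; - $\phi(S_n\times[-l/2,l/2])$ has non-empty interior for $0<l\le l_n$; - for all $n$ and $0<\eta<l_n/2$ there is $k>n$ such that $\phi(S_k\times[L_1,L_2])\subset(\phi(S_n\times[L_1-\eta,L_2+\eta]))^\circ$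 whenever $L_1\le L_2$, $-l_n/2<L_1-\eta$ and $L_2+\eta<l_n/2$; - there is a flowbox $B$ with non-empty interior whose central slice $S$ is a Cantor space, such that every $S_n$ is a clopen subset of $S$ contained in $S\cap B^\circ$. Write $\tau_n(y)=\min\{t>0:\phi_t(y)\in S_n\}$ and $\Phi_n(y)=\phi_{\tau_n(y)}(y)$ for the first return time and the first return map of $S_n$, and assume $\Phi_n^{-1}(S_{n+1})\cap S_{n+1}=\emptyset$ for all $n$. For $y\in S_{n+1}$ let $j(y)+1$ be the least $m\ge1$ with $\Phi_n^m(y)\in S_{n+1}$ (so $y$ lies in the base of a Rokhlin tower with floors $0,\dots,j(y)$), let $\tau_{n+1,n}^{(k)}(y)=\sum_{i<k}\tau_n(\Phi_n^i(y))$ be the time at which the orbit of $y$ reaches the $k$-th floor, and let $U^{(k)}_{n,n+1}(y)$, $0\le k\le j(y)$, be the isometry of $L^2([0,1])$ given by $$(U^{(k)}_{n,n+1}(y)\xi)(t)=\sqrt{\frac{\tau_{n+1}(y)}{\tau_n(\Phi_n^k(y))}}\;\xi\!\left(\frac{\tau_{n+1}(y)t-\tau_{n+1,n}^{(k)}(y)}{\tau_n(\Phi_n^k(y))}\right)\quad\text{for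 }\frac{\tau_{n+1,n}^{(k)}(y)}{\tau_{n+1}(y)}\le t\le\frac{\tau_n(\Phi_n^k(y))+\tau_{n+1,n}^{(k)}(y)}{\tau_{n+1}(y)}$$ and $0$ for all other $t\in[0,1]$. Let $\mathbb K$ be the algebra of compact operators on $L^2([0,1])$, and let $(C(X)\rtimes\mathbb R)^{\rtimes}_{\bar x}$ be the closure in the crossed product $C(X)\rtimes\mathbb R$ of the $*$-algebra of all $a\in C_c(\mathbb R,C(X))$ with $a(s)(\phi_t(\bar x))=0$ whenever $0\le t\le s$ or $s\le t\le 0$. **Theorem.** For every $n$ the formula $$\iota_{n,n+1}(f)(y)=\sum_{k=0}^{j(y)}U^{(k)}_{n,n+1}(y)\,f(\Phi_n^k(y))\,U^{(k)}_{n,n+1}(y)^*,\qquad f\in C(S_n,\mathbb K),\ y\in S_{n+1},$$ defines a $*$-homomorphism $\iota_{n,n+1}:C(S_n,\mathbb K)\to C(S_{n+1},\mathbb K)$, and there is a $*$-isomorphism from $(C(X)\rtimes\mathbb R)^{\rtimes}_{\bar x}$ onto the C*-algebra inductive limit $\varinjlim_n\,(C(S_n,\mathbb K),\iota_{n,n+1})$.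 -/

import Mathlib

open MeasureTheory Set Filter Topology Function
open scoped CompactlySupported ENNReal InnerProductSpace

noncomputable section

/-! ## Completion of a `*`-algebra in a C*-seminorm -/

section Completion

/-- A C*-seminorm on a complex `*`-algebra. -/
structure CStarSeminorm (E : Type*) [NonUnitalRing E] [Module ℂ E] [StarRing E]
    extends Seminorm ℂ E where
  mul_le' : ∀ a b : E, toFun (a * b) ≤ toFun a * toFun b
  star' : ∀ a : E, toFun (star a) = toFun a
  star_mul_self' : ∀ a : E, toFun a * toFun a ≤ toFun (star a * a)

variable {E : Type*} [NonUnitalRing E] [Module ℂ E] [StarRing E]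

/-- The algebra `E`, seminormed by `p`. -/
def CStarSeminorm.Space (_ : CStarSeminorm E) : Type _ := E

namespace CStarSeminorm

variable (p : CStarSeminorm E)

instance : NonUnitalSeminormedRing p.Space where
  __ := (inferInstance : NonUnitalRing E)
  __ := p.toSeminorm.toAddGroupSeminorm.toSeminormedAddCommGroup
  norm_mul_le := p.mul_le'

instance : NormedSpace ℂ p.Space where
  __ := (inferInstance : Module ℂ E)
  norm_smul_le c a := (p.toSeminorm.smul' c a).le

instance : StarRing p.Space where
  star := (star : E → E)
  star_involutive := star_involutive (R := E)
  star_mul := star_mul (R := E)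
  star_add := star_add (R := E)

instance : NormedStarGroup p.Space where
  norm_star_le a := (p.star' a).le

instance [IsScalarTower ℂ E E] : IsScalarTower ℂ p.Space p.Space :=
  ⟨smul_assoc (M := ℂ) (N := E) (α := E)⟩
instance [SMulCommClass ℂ E E] : SMulCommClass ℂ p.Space p.Space :=
  ⟨smul_comm (M := ℂ) (N := E) (α := E)⟩
instance [StarModule ℂ E] : StarModule ℂ p.Space :=
  ⟨star_smul (R := ℂ) (A := E)⟩

/-- The Hausdorff completion of a `*`-algebra with respect to a C*-seminorm. -/
def Completion : Type _ := UniformSpace.Completion p.Space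

namespace Completion

instance : NormedAddCommGroup p.Completion :=
  inferInstanceAs (NormedAddCommGroup (UniformSpace.Completion p.Space))
instance : NormedSpace ℂ p.Completion :=
  inferInstanceAs (NormedSpace ℂ (UniformSpace.Completion p.Space))
instance : CompleteSpace p.Completion :=
  inferInstanceAs (CompleteSpace (UniformSpace.Completion p.Space))

/-- The canonical linear map from the algebra to its completion. -/
def of : p.Space →ₗ[ℂ] p.Completion :=
  (UniformSpace.Completion.toComplₗᵢ : p.Space →ₗᵢ[ℂ] UniformSpace.Completion p.Space).toLinearMap

variable {p}

lemma isDenseInducing_of : IsDenseInducing (of p) :=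
  UniformSpace.Completion.isDenseInducing_coe

lemma continuous_of : Continuous (of p) := isDenseInducing_of.continuous

lemma norm_of (a : p.Space) : ‖of p a‖ = ‖a‖ := UniformSpace.Completion.norm_coe a

@[elab_as_elim]
lemma induction_on {P : p.Completion → Prop} (a : p.Completion) (hp : IsClosed {a | P a})
    (ih : ∀ a : p.Space, P (of p a)) : P a :=
  UniformSpace.Completion.induction_on (α := p.Space) a hp ih

instance : Mul p.Completion :=
  ⟨curry <| (isDenseInducing_of.prodMap isDenseInducing_of).extend
    (of p ∘ uncurry (fun a b : p.Space => a * b))⟩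

lemma of_mul (a b : p.Space) : of p (a * b) = of p a * of p b :=
  ((isDenseInducing_of.prodMap isDenseInducing_of).extend_eq
      (continuous_of.comp (continuous_mul (M := p.Space))) (a, b)).symm

instance : ContinuousMul p.Completion where
  continuous_mul := by
    let m : p.Space →+ p.Space →+ p.Completion :=
      (AddMonoidHom.mul : p.Space →+ p.Space →+ p.Space).compr₂
        (of p).toAddMonoidHom
    have : Continuous fun q : p.Space × p.Space => m q.1 q.2 :=
      continuous_of.comp (continuous_mul (M := p.Space))
    have di : IsDenseInducing ((of p).toAddMonoidHom : p.Space → p.Completion) :=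
      isDenseInducing_of
    exact (di.extend_Z_bilin di this :)

lemma isometry_star : Isometry (fun a : p.Space => star a) :=
  AddMonoidHomClass.isometry_of_norm (starAddEquiv : p.Space ≃+ p.Space) norm_star

instance : Star p.Completion :=
  ⟨UniformSpace.Completion.map (fun a : p.Space => star a)⟩

lemma of_star (a : p.Space) : of p (star a) = star (of p a) :=
  (UniformSpace.Completion.map_coe
    isometry_star.uniformContinuous a).symm

lemma continuous_star' : Continuous (fun a : p.Completion => star a) :=
  UniformSpace.Completion.continuous_map

lemma norm_mul_le' (a b : p.Completion) : ‖a * b‖ ≤ ‖a‖ * ‖b‖ := by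
  induction a using induction_on with
  | hp =>
    exact isClosed_le (continuous_norm.comp (continuous_mul_const b))
      (continuous_norm.mul continuous_const)
  | ih a =>
  induction b using induction_on with
  | hp =>
    exact isClosed_le (continuous_norm.comp (continuous_const_mul _))
      (continuous_const.mul continuous_norm)
  | ih b =>
    rw [← of_mul, norm_of, norm_of, norm_of]
    exact norm_mul_le a b

lemma left_distrib' (a b c : p.Completion) : a * (b + c) = a * b + a * c := by
  induction a using induction_on with
  | hp => exact isClosed_eq (continuous_id.mul ((continuous_const).add (continuous_const))) ((continuous_id.mul (continuous_const)).add (continuous_id.mul (continuous_const)))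
  | ih a =>
  induction b using induction_on with
  | hp => exact isClosed_eq (continuous_const.mul ((continuous_id).add (continuous_const))) ((continuous_const.mul (continuous_id)).add (continuous_const.mul (continuous_const)))
  | ih b =>
  induction c using induction_on with
  | hp => exact isClosed_eq (continuous_const.mul ((continuous_const).add (continuous_id))) ((continuous_const.mul (continuous_const)).add (continuous_const.mul (continuous_id)))
  | ih c => rw [← map_add, ← of_mul, mul_add, map_add, of_mul, of_mul]

lemma right_distrib' (a b c : p.Completion) : (a + b) * c = a * c + b * c := by
  induction a using induction_on with
  | hp => exact isClosed_eq (((continuous_id).add (continuous_const)).mul (continuous_const)) ((continuous_id.mul (continuous_const)).add (continuous_const.mul (continuous_const)))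
  | ih a =>
  induction b using induction_on with
  | hp => exact isClosed_eq (((continuous_const).add (continuous_id)).mul (continuous_const)) ((continuous_const.mul (continuous_const)).add (continuous_id.mul (continuous_const)))
  | ih b =>
  induction c using induction_on with
  | hp => exact isClosed_eq (((continuous_const).add (continuous_const)).mul (continuous_id)) ((continuous_const.mul (continuous_id)).add (continuous_const.mul (continuous_id)))
  | ih c => rw [← map_add, ← of_mul, add_mul, map_add, of_mul, of_mul]

lemma zero_mul' (a : p.Completion) : 0 * a = 0 := by
  induction a using induction_on with
  | hp => exact isClosed_eq (continuous_const.mul (continuous_id)) (continuous_const)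
  | ih a => rw [← map_zero (of p), ← of_mul, zero_mul]

lemma mul_zero' (a : p.Completion) : a * 0 = 0 := by
  induction a using induction_on with
  | hp => exact isClosed_eq (continuous_id.mul (continuous_const)) (continuous_const)
  | ih a => rw [← map_zero (of p), ← of_mul, mul_zero]

lemma mul_assoc' (a b c : p.Completion) : a * b * c = a * (b * c) := by
  induction a using induction_on with
  | hp => exact isClosed_eq ((continuous_id.mul (continuous_const)).mul (continuous_const)) (continuous_id.mul (continuous_const.mul (continuous_const)))
  | ih a =>
  induction b using induction_on with
  | hp => exact isClosed_eq ((continuous_const.mul (continuous_id)).mul (continuous_const)) (continuous_const.mul (continuous_id.mul (continuous_const)))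
  | ih b =>
  induction c using induction_on with
  | hp => exact isClosed_eq ((continuous_const.mul (continuous_const)).mul (continuous_id)) (continuous_const.mul (continuous_const.mul (continuous_id)))
  | ih c => rw [← of_mul, ← of_mul, ← of_mul, ← of_mul, mul_assoc]

lemma smul_mul' [IsScalarTower ℂ E E] (z : ℂ) (a b : p.Completion) : (z • a) * b = z • (a * b) := by
  induction a using induction_on with
  | hp => exact isClosed_eq ((continuous_id.const_smul z).mul continuous_const) ((continuous_id.mul continuous_const).const_smul z)
  | ih a =>
  induction b using induction_on with
  | hp => exact isClosed_eq (continuous_const.mul continuous_id) ((continuous_const.mul continuous_id).const_smul z)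
  | ih b => rw [← of_mul, ← map_smul, ← map_smul, ← of_mul, smul_mul_assoc]

lemma mul_smul' [SMulCommClass ℂ E E] (z : ℂ) (a b : p.Completion) : a * (z • b) = z • (a * b) := by
  induction a using induction_on with
  | hp => exact isClosed_eq (continuous_id.mul continuous_const) ((continuous_id.mul continuous_const).const_smul z)
  | ih a =>
  induction b using induction_on with
  | hp => exact isClosed_eq (continuous_const.mul (continuous_id.const_smul z)) ((continuous_const.mul continuous_id).const_smul z)
  | ih b => rw [← of_mul, ← map_smul, ← map_smul, ← of_mul, mul_smul_comm]

instance : NonUnitalNormedRing p.Completion where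
  __ := (inferInstance : NormedAddCommGroup p.Completion)
  __ := (inferInstance : Mul p.Completion)
  left_distrib := left_distrib'
  right_distrib := right_distrib'
  zero_mul := zero_mul'
  mul_zero := mul_zero'
  mul_assoc := mul_assoc'
  dist_eq := dist_eq_norm_neg_add
  norm_mul_le := norm_mul_le'

instance : StarRing p.Completion where
  star_involutive a := by
    induction a using induction_on with
    | hp => exact isClosed_eq (continuous_star'.comp continuous_star') continuous_id
    | ih a => rw [← of_star, ← of_star, star_star]
  star_mul a b := by
    induction a using induction_on with
    | hp =>
      exact isClosed_eq (continuous_star'.comp (continuous_id.mul continuous_const))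
        (continuous_const.mul continuous_star')
    | ih a =>
    induction b using induction_on with
    | hp =>
      exact isClosed_eq (continuous_star'.comp (continuous_const.mul continuous_id))
        (continuous_star'.mul continuous_const)
    | ih b => rw [← of_mul, ← of_star, star_mul, of_mul, of_star, of_star]
  star_add a b := by
    induction a using induction_on with
    | hp =>
      exact isClosed_eq (continuous_star'.comp (continuous_id.add continuous_const))
        (continuous_star'.add continuous_const)
    | ih a =>
    induction b using induction_on with
    | hp =>
      exact isClosed_eq (continuous_star'.comp (continuous_const.add continuous_id))
        (continuous_const.add continuous_star')
    | ih b => rw [← map_add, ← of_star, star_add, map_add, of_star, of_star]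

lemma norm_mul_self_le' (a : p.Completion) : ‖a‖ * ‖a‖ ≤ ‖star a * a‖ := by
  induction a using induction_on with
  | hp =>
    exact isClosed_le (continuous_norm.mul continuous_norm)
      (continuous_norm.comp (continuous_star'.mul continuous_id))
  | ih a =>
    rw [← of_star, ← of_mul, norm_of, norm_of]
    exact p.star_mul_self' a

instance [IsScalarTower ℂ E E] [SMulCommClass ℂ E E] [StarModule ℂ E] :
    NonUnitalCStarAlgebra p.Completion where
  norm_mul_self_le a := norm_mul_self_le' a
  smul_assoc := smul_mul'
  smul_comm z a b := (mul_smul' z a b).symm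
  star_smul c a := by
    induction a using induction_on with
    | hp =>
      exact isClosed_eq (continuous_star'.comp (continuous_id.const_smul c))
        ((continuous_const_smul (star c)).comp continuous_star')
    | ih a => rw [← map_smul, ← of_star, ← of_star, star_smul, map_smul]

/-- The canonical `*`-homomorphism from the algebra to its completion. -/
def ofHom (p : CStarSeminorm E) : E →⋆ₙₐ[ℂ] p.Completion where
  toFun a := of p a
  map_smul' c a := map_smul (of p) c a
  map_zero' := map_zero (of p)
  map_add' a b := map_add (of p) a b
  map_mul' a b := of_mul a b
  map_star' a := of_star a

end Completion

end CStarSeminorm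

end Completion

set_option linter.unusedSectionVars false

/-! ## The crossed product of `C(X)` by a flow -/

section CrossedProduct

variable {X : Type*} [TopologicalSpace X] [CompactSpace X] [T2Space X]

/-- The automorphism `a ↦ a ∘ φ₋ₜ` of `C(X)` at time `t`. -/
def Flow.act (φ : Flow ℝ X) (t : ℝ) (a : C(X, ℂ)) : C(X, ℂ) :=
  a.comp ⟨φ (-t), φ.continuous_toFun (-t)⟩

lemma Flow.continuous_act (φ : Flow ℝ X) {Y : Type*} [TopologicalSpace Y] {t : Y → ℝ}
    {a : Y → C(X, ℂ)} (ht : Continuous t) (ha : Continuous a) :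
    Continuous fun y => φ.act (t y) (a y) := by
  refine ha.compCM (ContinuousMap.continuous_of_continuous_uncurry _ ?_)
  exact φ.cont'.comp ((ht.comp continuous_fst).neg.prodMk continuous_snd)

/-- The space `C_c(ℝ, C(X))`, which carries below the product and involution of the transformation
group `(X, ℝ, φ)`. -/
def ConvAlg (_ : Flow ℝ X) : Type _ := C_c(ℝ, C(X, ℂ))

namespace ConvAlg

variable {φ : Flow ℝ X}

instance : AddCommGroup (ConvAlg φ) := inferInstanceAs (AddCommGroup C_c(ℝ, C(X, ℂ)))
instance : Module ℂ (ConvAlg φ) := inferInstanceAs (Module ℂ C_c(ℝ, C(X, ℂ)))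
instance : FunLike (ConvAlg φ) ℝ C(X, ℂ) := inferInstanceAs (FunLike C_c(ℝ, C(X, ℂ)) ℝ C(X, ℂ))

@[ext] lemma ext {f g : ConvAlg φ} (h : ∀ s x, f s x = g s x) : f = g :=
  DFunLike.ext _ _ fun s => ContinuousMap.ext (h s)

lemma continuous (f : ConvAlg φ) : Continuous f :=
  map_continuous (F := C_c(ℝ, C(X, ℂ))) f

lemma hasCompactSupport (f : ConvAlg φ) : HasCompactSupport f :=
  CompactlySupportedContinuousMap.hasCompactSupport f

lemma continuous_uncurry (f : ConvAlg φ) : Continuous fun p : ℝ × X => f p.1 p.2 :=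
  ContinuousMap.continuous_uncurry_of_continuous ⟨f, f.continuous⟩

@[simp] lemma add_apply (f g : ConvAlg φ) (s : ℝ) : (f + g) s = f s + g s := rfl
@[simp] lemma zero_apply (s : ℝ) : (0 : ConvAlg φ) s = 0 := rfl
@[simp] lemma smul_apply (c : ℂ) (f : ConvAlg φ) (s : ℝ) : (c • f) s = c • f s := rfl

lemma continuous_integrand (f g : ConvAlg φ) :
    Continuous fun p : ℝ × ℝ => f p.2 * φ.act p.2 (g (p.1 - p.2)) :=
  (f.continuous.comp continuous_snd).mul
    (φ.continuous_act continuous_snd (g.continuous.comp (continuous_fst.sub continuous_snd)))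

lemma integrable_integrand (f g : ConvAlg φ) (s : ℝ) :
    Integrable fun r => f r * φ.act r (g (s - r)) := by
  refine Continuous.integrable_of_hasCompactSupport
    ((continuous_integrand f g).comp (continuous_const.prodMk continuous_id)) ?_
  exact f.hasCompactSupport.mul_right

/-- The convolution product `(f * g)(s) = ∫ f(r) αᵣ(g(s - r)) dr`. -/
instance : Mul (ConvAlg φ) where
  mul f g :=
    { toFun := fun s => ∫ r, f r * φ.act r (g (s - r))
      continuous_toFun := by
        have h : ∀ s, ∫ r, f r * φ.act r (g (s - r)) =
            ∫ r in tsupport f, f r * φ.act r (g (s - r)) := fun s => by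
          refine (setIntegral_eq_integral_of_forall_compl_eq_zero fun r hr => ?_).symm
          rw [image_eq_zero_of_notMem_tsupport hr, zero_mul]
        simp only [h]
        exact continuous_parametric_integral_of_continuous
          (f := fun s r => f r * φ.act r (g (s - r))) (continuous_integrand f g)
          f.hasCompactSupport
      hasCompactSupport' := by
        refine HasCompactSupport.intro (f.hasCompactSupport.isCompact.add
          g.hasCompactSupport.isCompact) fun s hs => ?_
        refine integral_eq_zero_of_ae (Eventually.of_forall fun r => ?_)
        by_cases hr : r ∈ tsupport f
        · have : s - r ∉ tsupport g := fun h => hs ⟨r, hr, s - r, h, by simp⟩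
          have h0 : g (s - r) = 0 := image_eq_zero_of_notMem_tsupport this
          ext x
          simp [Flow.act, h0]
        · have h0 : f r = 0 := image_eq_zero_of_notMem_tsupport hr
          simp [h0] }

/-- The involution `f*(s) = αₛ(f(-s)*)`. -/
instance : Star (ConvAlg φ) where
  star f :=
    { toFun := fun s => φ.act s (star (f (-s)))
      continuous_toFun :=
        φ.continuous_act continuous_id (continuous_star.comp (f.continuous.comp continuous_neg))
      hasCompactSupport' := by
        refine HasCompactSupport.intro f.hasCompactSupport.isCompact.neg fun s hs => ?_
        have h0 : f (-s) = 0 := image_eq_zero_of_notMem_tsupport fun h => hs (by simpa using h)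
        ext x
        simp [Flow.act, h0] }

lemma mul_apply (f g : ConvAlg φ) (s : ℝ) (x : X) :
    (f * g) s x = ∫ r, f r x * g (s - r) (φ (-r) x) :=
  (ContinuousLinearMap.integral_comp_comm (ContinuousMap.evalCLM ℂ x)
    (integrable_integrand f g s)).symm

lemma star_apply (f : ConvAlg φ) (s : ℝ) (x : X) :
    (star f) s x = star (f (-s) (φ (-s) x)) := rfl

lemma integrable_apply (f g : ConvAlg φ) (s : ℝ) (x : X) :
    Integrable fun r => f r x * g (s - r) (φ (-r) x) :=
  (ContinuousMap.evalCLM ℂ x).integrable_comp (integrable_integrand f g s)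

lemma mul_assoc' (f g h : ConvAlg φ) : f * g * h = f * (g * h) := by
  ext s x
  have hφ : ∀ q r, φ (-(r - q)) (φ (-q) x) = φ (-r) x := fun q r => by
    rw [← φ.map_add]; congr 1; ring
  have h1 : (f * g * h) s x = ∫ r, ∫ q, f q x * g (r - q) (φ (-q) x) * h (s - r) (φ (-r) x) := by
    rw [mul_apply]
    refine integral_congr_ae (Eventually.of_forall fun r => ?_)
    simp only [mul_apply, integral_mul_const]
  have h2 : (f * (g * h)) s x =
      ∫ q, ∫ r, f q x * g (r - q) (φ (-q) x) * h (s - r) (φ (-r) x) := by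
    rw [mul_apply]
    refine integral_congr_ae (Eventually.of_forall fun q => ?_)
    simp only [mul_apply]
    rw [← integral_const_mul, ← integral_sub_right_eq_self _ q]
    refine integral_congr_ae (Eventually.of_forall fun r => ?_)
    simp only [hφ, sub_sub_sub_cancel_right, mul_assoc]
  rw [h1, h2]
  refine integral_integral_swap_of_hasCompactSupport
    (f := fun r q => f q x * g (r - q) (φ (-q) x) * h (s - r) (φ (-r) x)) ?_ ?_
  · refine (Continuous.mul ?_ ?_).mul ?_
    · exact f.continuous_uncurry.comp (continuous_snd.prodMk continuous_const)
    · exact g.continuous_uncurry.comp ((continuous_fst.sub continuous_snd).prodMk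
        (φ.cont'.comp (continuous_snd.neg.prodMk continuous_const)))
    · exact h.continuous_uncurry.comp ((continuous_const.sub continuous_fst).prodMk
        (φ.cont'.comp (continuous_fst.neg.prodMk continuous_const)))
  · refine HasCompactSupport.intro ((f.hasCompactSupport.isCompact.add
      g.hasCompactSupport.isCompact).prod f.hasCompactSupport.isCompact) fun p hp => ?_
    obtain ⟨r, q⟩ := p
    simp only [uncurry_apply_pair]
    by_cases hq : q ∈ tsupport f
    · have : r - q ∉ tsupport g := fun h => hp ⟨⟨q, hq, r - q, h, by simp⟩, hq⟩
      have h0 : g (r - q) = 0 := image_eq_zero_of_notMem_tsupport this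
      simp [h0]
    · have h0 : f q = 0 := image_eq_zero_of_notMem_tsupport hq
      simp [h0]

instance : NonUnitalRing (ConvAlg φ) where
  left_distrib f g h := by
    ext s x
    rw [add_apply, ContinuousMap.add_apply, mul_apply, mul_apply, mul_apply,
      ← integral_add (integrable_apply f g s x) (integrable_apply f h s x)]
    simp [mul_add]
  right_distrib f g h := by
    ext s x
    rw [add_apply, ContinuousMap.add_apply, mul_apply, mul_apply, mul_apply,
      ← integral_add (integrable_apply f h s x) (integrable_apply g h s x)]
    simp [add_mul]
  zero_mul f := by ext s x; simp [mul_apply]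
  mul_zero f := by ext s x; simp [mul_apply]
  mul_assoc := mul_assoc'

instance : IsScalarTower ℂ (ConvAlg φ) (ConvAlg φ) where
  smul_assoc c f g := by
    ext s x
    simp [mul_apply, mul_assoc, integral_const_mul]

instance : SMulCommClass ℂ (ConvAlg φ) (ConvAlg φ) where
  smul_comm c f g := by
    ext s x
    simp [mul_apply, mul_left_comm, integral_const_mul]

instance : StarRing (ConvAlg φ) where
  star_involutive f := by
    ext s x
    simp only [star_apply, neg_neg, star_star]
    rw [← φ.map_add]
    simp
  star_mul f g := by
    ext s x
    simp only [star_apply, mul_apply, RCLike.star_def, ← integral_conj, map_mul]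
    rw [← integral_sub_right_eq_self _ s]
    refine integral_congr_ae (Eventually.of_forall fun r => ?_)
    have h1 : φ (r - s) (φ (-r) x) = φ (-s) x := by
      rw [← φ.map_add]; congr 1; ring
    have h2 : φ (s - r) (φ (-s) x) = φ (-r) x := by
      rw [← φ.map_add]; congr 1; ring
    have h3 : -s - (r - s) = -r := by ring
    simp only [h1, h2, h3, neg_sub]
    rw [mul_comm]
  star_add f g := by
    ext s x
    simp [star_apply]

instance : StarModule ℂ (ConvAlg φ) where
  star_smul c f := by
    ext s x
    simp [star_apply]

/-- The norm of `L¹(ℝ, C(X))`. -/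
def l1Norm (f : ConvAlg φ) : ℝ := ∫ s, ‖f s‖

lemma integrable_norm (f : ConvAlg φ) : Integrable fun s => ‖f s‖ :=
  f.continuous.norm.integrable_of_hasCompactSupport f.hasCompactSupport.norm

lemma l1Norm_nonneg (f : ConvAlg φ) : 0 ≤ l1Norm f := integral_nonneg fun _ => norm_nonneg _

/-- The set of values `‖ρ f‖`, where `ρ` ranges over the `*`-representations of `C_c(ℝ, C(X))` by
bounded operators on Hilbert spaces that are contractive for the norm of `L¹(ℝ, C(X))`. For `X`
metrizable `C_c(ℝ, C(X))` is separable, so that the Hilbert spaces in the lowest universe (which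
include all separable ones up to isomorphism) give the supremum over all Hilbert spaces. -/
def repNorms (f : ConvAlg φ) : Set ℝ :=
  {c | ∃ (H : Type) (_ : NormedAddCommGroup H) (_ : InnerProductSpace ℂ H) (_ : CompleteSpace H)
    (ρ : ConvAlg φ →⋆ₙₐ[ℂ] (H →L[ℂ] H)), (∀ g, ‖ρ g‖ ≤ l1Norm g) ∧ c = ‖ρ f‖}

lemma repNorms_nonempty (f : ConvAlg φ) : (repNorms f).Nonempty :=
  ⟨_, ℂ, inferInstance, inferInstance, inferInstance, 0, fun g => by
    simpa using l1Norm_nonneg g, rfl⟩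

lemma repNorms_bddAbove (f : ConvAlg φ) : BddAbove (repNorms f) :=
  ⟨l1Norm f, by rintro _ ⟨H, _, _, _, ρ, hρ, rfl⟩; exact hρ f⟩

/-- The norm of the enveloping C*-algebra of `L¹(ℝ, C(X))`, as a C*-seminorm on `C_c(ℝ, C(X))`. -/
def universalNorm (φ : Flow ℝ X) : CStarSeminorm (ConvAlg φ) where
  toFun f := sSup (repNorms f)
  map_zero' := by
    refine le_antisymm (csSup_le (repNorms_nonempty _) ?_) (le_csSup (repNorms_bddAbove _) ?_)
    · rintro _ ⟨H, _, _, _, ρ, hρ, rfl⟩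
      simp
    · exact ⟨ℂ, inferInstance, inferInstance, inferInstance, 0, fun g => by
        simpa using l1Norm_nonneg g, by simp⟩
  add_le' f g := by
    refine csSup_le (repNorms_nonempty _) ?_
    rintro _ ⟨H, _, _, _, ρ, hρ, rfl⟩
    rw [map_add]
    exact (norm_add_le _ _).trans (add_le_add
      (le_csSup (repNorms_bddAbove f) ⟨H, _, _, _, ρ, hρ, rfl⟩)
      (le_csSup (repNorms_bddAbove g) ⟨H, _, _, _, ρ, hρ, rfl⟩))
  neg' f := by
    congr 1
    ext c
    simp [repNorms]
  smul' z f := by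
    refine le_antisymm (csSup_le (repNorms_nonempty _) ?_) ?_
    · rintro _ ⟨H, _, _, _, ρ, hρ, rfl⟩
      rw [map_smul, norm_smul]
      exact mul_le_mul_of_nonneg_left
        (le_csSup (repNorms_bddAbove f) ⟨H, _, _, _, ρ, hρ, rfl⟩) (norm_nonneg _)
    · rw [← smul_eq_mul, ← Real.sSup_smul_of_nonneg (norm_nonneg z)]
      refine csSup_le ((repNorms_nonempty f).smul_set) ?_
      rintro _ ⟨_, ⟨H, _, _, _, ρ, hρ, rfl⟩, rfl⟩
      exact le_csSup (repNorms_bddAbove _) ⟨H, _, _, _, ρ, hρ, by simp [norm_smul]⟩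
  mul_le' f g := by
    refine csSup_le (repNorms_nonempty _) ?_
    rintro _ ⟨H, _, _, _, ρ, hρ, rfl⟩
    rw [map_mul]
    have hf := le_csSup (repNorms_bddAbove f) ⟨H, _, _, _, ρ, hρ, rfl⟩
    exact (norm_mul_le _ _).trans (mul_le_mul hf
      (le_csSup (repNorms_bddAbove g) ⟨H, _, _, _, ρ, hρ, rfl⟩) (norm_nonneg _)
      ((norm_nonneg _).trans hf))
  star' f := by
    congr 1
    ext c
    simp [repNorms, map_star]
  star_mul_self' f := by
    have h0 : 0 ≤ sSup (repNorms (star f * f)) := by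
      refine Real.sSup_nonneg ?_
      rintro _ ⟨H, _, _, _, ρ, hρ, rfl⟩
      exact norm_nonneg _
    have h : sSup (repNorms f) ≤ √(sSup (repNorms (star f * f))) := by
      refine csSup_le (repNorms_nonempty _) ?_
      rintro _ ⟨H, _, _, _, ρ, hρ, rfl⟩
      refine Real.le_sqrt_of_sq_le ?_
      refine le_csSup (repNorms_bddAbove _) ⟨H, _, _, _, ρ, hρ, ?_⟩
      rw [map_mul, map_star, CStarRing.norm_star_mul_self, sq]
    have hs : 0 ≤ sSup (repNorms f) := by
      refine Real.sSup_nonneg ?_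
      rintro _ ⟨H, _, _, _, ρ, hρ, rfl⟩
      exact norm_nonneg _
    calc _ ≤ √(sSup (repNorms (star f * f))) * √(sSup (repNorms (star f * f))) :=
          mul_le_mul h h hs (Real.sqrt_nonneg _)
      _ = _ := Real.mul_self_sqrt h0

end ConvAlg

/-- The crossed product C*-algebra `C(X) ⋊ ℝ`. -/
abbrev CrossedProduct (φ : Flow ℝ X) : Type _ := (ConvAlg.universalNorm φ).Completion

/-- The canonical `*`-homomorphism `C_c(ℝ, C(X)) → C(X) ⋊ ℝ`. -/
def CrossedProduct.of (φ : Flow ℝ X) : ConvAlg φ →⋆ₙₐ[ℂ] CrossedProduct φ :=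
  CStarSeminorm.Completion.ofHom (ConvAlg.universalNorm φ)

/-- The `*`-algebra of all `a ∈ C_c(ℝ, C(X))` with `a(s)(φₜ(x)) = 0` whenever `0 ≤ t ≤ s` or
`s ≤ t ≤ 0`. -/
def pointAlgebra (φ : Flow ℝ X) (x : X) : NonUnitalStarSubalgebra ℂ (ConvAlg φ) where
  carrier := {a | ∀ s t : ℝ, (0 ≤ t ∧ t ≤ s) ∨ (s ≤ t ∧ t ≤ 0) → a s (φ t x) = 0}
  zero_mem' := fun _ _ _ => rfl
  add_mem' := fun {a b} ha hb s t h => by simp [ha s t h, hb s t h]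
  smul_mem' := fun c a ha s t h => by simp [ha s t h]
  mul_mem' := fun {a b} ha hb s t h => by
    rw [ConvAlg.mul_apply]
    refine integral_eq_zero_of_ae (Eventually.of_forall fun r => ?_)
    have hφ : φ (-r) (φ t x) = φ (t - r) x := by rw [← φ.map_add]; congr 1; ring
    simp only [hφ, Pi.zero_apply, mul_eq_zero]
    rcases h with ⟨h1, h2⟩ | ⟨h1, h2⟩
    · rcases le_total t r with h3 | h3
      · exact Or.inl (ha r t (Or.inl ⟨h1, h3⟩))
      · exact Or.inr (hb (s - r) (t - r) (Or.inl ⟨by linarith, by linarith⟩))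
    · rcases le_total r t with h3 | h3
      · exact Or.inl (ha r t (Or.inr ⟨h3, h2⟩))
      · exact Or.inr (hb (s - r) (t - r) (Or.inr ⟨by linarith, by linarith⟩))
  star_mem' := fun {a} ha s t h => by
    have hφ : φ (-s) (φ t x) = φ (t - s) x := by rw [← φ.map_add]; congr 1; ring
    rw [ConvAlg.star_apply, hφ, ha, star_zero]
    rcases h with ⟨h1, h2⟩ | ⟨h1, h2⟩
    · exact Or.inr ⟨by linarith, by linarith⟩
    · exact Or.inl ⟨by linarith, by linarith⟩

/-- The orbit-breaking subalgebra `(C(X) ⋊ ℝ)^⋊_x`: the closure of `pointAlgebra φ x` in the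
crossed product. -/
def orbitBreakingAlgebra (φ : Flow ℝ X) (x : X) :
    NonUnitalStarSubalgebra ℂ (CrossedProduct φ) :=
  ((pointAlgebra φ x).map (CrossedProduct.of φ)).topologicalClosure

end CrossedProduct
/-! ## Compact operators and inductive limits -/

section Compact

variable (H : Type*) [NormedAddCommGroup H] [InnerProductSpace ℂ H] [CompleteSpace H]

variable {H} in
lemma isCompactOperator_adjoint {T : H →L[ℂ] H} (hT : IsCompactOperator T) :
    IsCompactOperator (star T : H →L[ℂ] H) := by
  refine (isCompactOperator_iff_isCompact_closure_image_ball (𝕜₁ := ℂ)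
    (star T : H →L[ℂ] H).toLinearMap one_pos).2 ?_
  refine TotallyBounded.isCompact_of_isClosed (TotallyBounded.closure ?_) isClosed_closure
  have hc : IsCompactOperator (T * star T : H →L[ℂ] H) := hT.comp_clm (star T)
  have htb : TotallyBounded ((T * star T : H →L[ℂ] H) '' Metric.ball 0 1) :=
    (hc.isCompact_closure_image_ball (f := (T * star T : H →L[ℂ] H).toLinearMap)
      1).totallyBounded.subset subset_closure
  rw [Metric.totallyBounded_iff] at htb ⊢
  intro ε hε
  obtain ⟨t, ht, hfin, hsub⟩ := Metric.finite_approx_of_totallyBounded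
    (Metric.totallyBounded_iff.2 htb) (ε ^ 2 / 2) (by positivity)
  have ht' : ∀ z, ∃ w : H, z ∈ t → w ∈ Metric.ball (0 : H) 1 ∧ (T * star T) w = z := fun z => by
    by_cases hz : z ∈ t
    · obtain ⟨w, hw, hw'⟩ := ht hz
      exact ⟨w, fun _ => ⟨hw, hw'⟩⟩
    · exact ⟨0, fun h => absurd h hz⟩
  choose c hc using ht'
  refine ⟨(fun z => star T (c z)) '' t, hfin.image _, ?_⟩
  rintro _ ⟨x, hx, rfl⟩
  obtain ⟨z, hz, hxz⟩ := mem_iUnion₂.1 (hsub ⟨x, hx, rfl⟩)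
  refine mem_iUnion₂.2 ⟨_, ⟨z, hz, rfl⟩, ?_⟩
  rw [Metric.mem_ball, dist_eq_norm, ← (hc z hz).2, ← map_sub] at hxz
  have hb : ‖x - c z‖ ≤ 2 := by
    have h1 := mem_ball_zero_iff.1 hx
    have h2 := mem_ball_zero_iff.1 (hc z hz).1
    linarith [norm_sub_le x (c z)]
  have key : ‖star T (x - c z)‖ ^ 2 < ε ^ 2 := by
    calc ‖star T (x - c z)‖ ^ 2 = ‖⟪(T * star T) (x - c z), x - c z⟫_ℂ‖ := by
          rw [ContinuousLinearMap.star_eq_adjoint, mul_apply_eq_comp,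
            ← ContinuousLinearMap.adjoint_inner_right, inner_self_eq_norm_sq_to_K]
          simp
      _ ≤ ‖(T * star T) (x - c z)‖ * ‖x - c z‖ := norm_inner_le_norm _ _
      _ ≤ ‖(T * star T) (x - c z)‖ * 2 := by gcongr
      _ < ε ^ 2 := by linarith
  rw [Metric.mem_ball, dist_eq_norm]
  have := lt_of_pow_lt_pow_left₀ 2 hε.le key
  simpa using this

/-- The C*-algebra of compact operators on a Hilbert space. -/
def compactOperators : NonUnitalStarSubalgebra ℂ (H →L[ℂ] H) where
  carrier := {T | IsCompactOperator T}
  zero_mem' := isCompactOperator_zero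
  add_mem' := fun hS hT => hS.add hT
  smul_mem' := fun c _ hT => hT.smul c
  mul_mem' := fun {_ T} hS _ => hS.comp_clm T
  star_mem' := fun {T} (hT : IsCompactOperator T) => isCompactOperator_adjoint hT

instance : IsClosed (compactOperators H : Set (H →L[ℂ] H)) :=
  isClosed_setOfPred_isCompactOperator (σ₁₂ := RingHom.id ℂ) (M₁ := H) (M₂ := H)

end Compact

section Limit

variable (A : ℕ → Type*) [∀ n, NonUnitalCStarAlgebra (A n)] (ι : ∀ n, A n →⋆ₙₐ[ℂ] A (n + 1))

/-- The `*`-algebra of sequences `(aₙ)` with `aₙ ∈ Aₙ` and `aₙ₊₁ = ιₙ(aₙ)` for all large `n`. -/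
def threadAlgebra : NonUnitalStarSubalgebra ℂ (∀ n, A n) where
  carrier := {a | ∀ᶠ n in atTop, a (n + 1) = ι n (a n)}
  zero_mem' := Eventually.of_forall fun n => (map_zero (ι n)).symm
  add_mem' := fun ha hb => by
    filter_upwards [ha, hb] with n h1 h2
    simp [h1, h2]
  smul_mem' := fun c a ha => by
    filter_upwards [ha] with n h1
    simp [h1]
  mul_mem' := fun ha hb => by
    filter_upwards [ha, hb] with n h1 h2
    simp [h1, h2]
  star_mem' := fun ha => by
    filter_upwards [ha] with n h1
    simp [h1, map_star]

variable {A ι}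

lemma threadAlgebra.exists_tendsto (a : threadAlgebra A ι) :
    ∃ c, Tendsto (fun n => ‖(a : ∀ n, A n) n‖) atTop (𝓝 c) := by
  obtain ⟨N, hN⟩ := eventually_atTop.1 a.2
  have hanti : Antitone fun n => ‖(a : ∀ n, A n) (n + N)‖ := by
    refine antitone_nat_of_succ_le fun n => ?_
    have h := hN (n + N) (Nat.le_add_left _ _)
    rw [show n + 1 + N = n + N + 1 by omega, h]
    exact NonUnitalStarAlgHom.norm_apply_le (ι (n + N)) _
  refine ⟨_, (tendsto_add_atTop_iff_nat N).1 (tendsto_atTop_ciInf hanti ⟨0, ?_⟩)⟩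
  rintro _ ⟨n, rfl⟩
  exact norm_nonneg _

lemma threadAlgebra.tendsto_lim (a : threadAlgebra A ι) :
    Tendsto (fun n => ‖(a : ∀ n, A n) n‖) atTop
      (𝓝 (limUnder atTop fun n => ‖(a : ∀ n, A n) n‖)) :=
  tendsto_nhds_limUnder (threadAlgebra.exists_tendsto a)

variable (A ι)

/-- The C*-seminorm `lim ‖aₙ‖` of a sequence as in `threadAlgebra`. -/
def limitSeminorm : CStarSeminorm (threadAlgebra A ι) where
  toFun a := limUnder atTop fun n => ‖(a : ∀ n, A n) n‖
  map_zero' := by simpa using tendsto_const_nhds.limUnder_eq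
  add_le' a b := le_of_tendsto_of_tendsto' (threadAlgebra.tendsto_lim (a + b))
    ((threadAlgebra.tendsto_lim a).add (threadAlgebra.tendsto_lim b)) fun _ => norm_add_le _ _
  neg' a := by simp
  smul' c a := by
    refine ((threadAlgebra.tendsto_lim a).const_mul ‖c‖).limUnder_eq ▸ ?_
    simp [norm_smul]
  mul_le' a b := le_of_tendsto_of_tendsto' (threadAlgebra.tendsto_lim (a * b))
    ((threadAlgebra.tendsto_lim a).mul (threadAlgebra.tendsto_lim b)) fun _ => norm_mul_le _ _
  star' a := by simp
  star_mul_self' a := le_of_tendsto_of_tendsto'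
    ((threadAlgebra.tendsto_lim a).mul (threadAlgebra.tendsto_lim a))
    (threadAlgebra.tendsto_lim (star a * a)) fun _ => CStarRing.norm_star_mul_self.ge

/-- The C*-algebra inductive limit of the sequence `A₀ → A₁ → A₂ → ⋯` with connecting maps `ιₙ`. -/
abbrev CStarLimit : Type _ := (limitSeminorm A ι).Completion

end Limit

/-! ## The isometries of `L²([0,1])` -/

section Tower

/-- The Hilbert space `L²([0,1])`. -/
abbrev L2I : Type := Lp ℂ 2 (volume.restrict (Icc (0 : ℝ) 1))

/-- The function `t ↦ √(T/σ) ξ((T t - c)/σ)` for `c/T ≤ t ≤ (σ + c)/T`, extended by zero. -/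
def towerFun (T σ c : ℝ) (ξ : ℝ → ℂ) : ℝ → ℂ :=
  (Icc (c / T) ((σ + c) / T)).indicator fun t => (√(T / σ) : ℂ) * ξ ((T * t - c) / σ)

variable {T σ : ℝ}

lemma towerFun_eq (hT : 0 < T) (hσ : 0 < σ) (c : ℝ) (ξ : ℝ → ℂ) :
    towerFun T σ c ξ = fun t => (√(T / σ) : ℂ) * (Icc (0 : ℝ) 1).indicator ξ ((T * t - c) / σ) := by
  funext t
  have h : t ∈ Icc (c / T) ((σ + c) / T) ↔ (T * t - c) / σ ∈ Icc (0 : ℝ) 1 := by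
    rw [mem_Icc, mem_Icc, div_le_iff₀ hT, le_div_iff₀ hT, le_div_iff₀ hσ, div_le_iff₀ hσ]
    constructor <;> rintro ⟨h1, h2⟩ <;> constructor <;> linarith
  by_cases ht : t ∈ Icc (c / T) ((σ + c) / T)
  · rw [towerFun, indicator_of_mem ht, indicator_of_mem (h.1 ht)]
  · rw [towerFun, indicator_of_notMem ht, indicator_of_notMem (mt h.2 ht), mul_zero]

lemma map_affine (hT : 0 < T) (hσ : 0 < σ) (c : ℝ) :
    Measure.map (fun t => (T * t - c) / σ) volume = ENNReal.ofReal (σ / T) • volume := by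
  have h : (fun t : ℝ => (T * t - c) / σ) = (fun t => t + -(c / σ)) ∘ (fun t => (T / σ) * t) := by
    funext t
    simp only [comp_apply]
    ring
  rw [h, ← Measure.map_map (by fun_prop) (by fun_prop),
    Real.map_volume_mul_left (div_pos hT hσ).ne', Measure.map_smul, map_add_right_eq_self,
    inv_div, abs_of_pos (div_pos hσ hT)]

lemma quasiMeasurePreserving_affine (hT : 0 < T) (hσ : 0 < σ) (c : ℝ) :
    Measure.QuasiMeasurePreserving (fun t => (T * t - c) / σ) volume volume :=
  ⟨by fun_prop, by rw [map_affine hT hσ]; exact Measure.smul_absolutelyContinuous⟩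

lemma towerFun_congr (hT : 0 < T) (hσ : 0 < σ) (c : ℝ) {ξ η : ℝ → ℂ}
    (h : ξ =ᵐ[volume.restrict (Icc (0 : ℝ) 1)] η) : towerFun T σ c ξ =ᵐ[volume] towerFun T σ c η := by
  have h1 : (Icc (0 : ℝ) 1).indicator ξ =ᵐ[volume] (Icc (0 : ℝ) 1).indicator η :=
    (ae_eq_restrict_iff_indicator_ae_eq measurableSet_Icc).1 h
  rw [towerFun_eq hT hσ, towerFun_eq hT hσ]
  filter_upwards [(quasiMeasurePreserving_affine hT hσ c).ae_eq_comp h1] with t ht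
  simp only [comp_apply] at ht
  rw [ht]

lemma eLpNorm_towerFun (hT : 0 < T) (hσ : 0 < σ) (c : ℝ) (ξ : L2I) :
    MemLp (towerFun T σ c ξ) 2 volume ∧ eLpNorm (towerFun T σ c ξ) 2 volume = eLpNorm ξ 2
      (volume.restrict (Icc (0 : ℝ) 1)) := by
  have hg : Measurable fun t : ℝ => (T * t - c) / σ := by fun_prop
  have h1 : MemLp ((Icc (0 : ℝ) 1).indicator ξ) 2 volume :=
    (memLp_indicator_iff_restrict measurableSet_Icc).2 (Lp.memLp ξ)
  have h2 : MemLp ((Icc (0 : ℝ) 1).indicator ξ) 2 (Measure.map (fun t => (T * t - c) / σ) volume) := by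
    rw [map_affine hT hσ]
    exact h1.smul_measure ENNReal.ofReal_ne_top
  have h3 := (memLp_map_measure_iff h2.1 hg.aemeasurable).1 h2
  rw [towerFun_eq hT hσ]
  refine ⟨h3.const_mul _, ?_⟩
  have h4 := eLpNorm_const_smul (√(T / σ) : ℂ)
    ((Icc (0 : ℝ) 1).indicator (ξ : ℝ → ℂ) ∘ fun t => (T * t - c) / σ) 2 volume
  refine h4.trans ?_
  rw [← eLpNorm_map_measure h2.1 hg.aemeasurable, map_affine hT hσ,
    eLpNorm_smul_measure_of_ne_top (by simp), eLpNorm_indicator_eq_eLpNorm_restrict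
      measurableSet_Icc, smul_eq_mul, ← mul_assoc]
  convert one_mul _
  have hpos := div_pos hT hσ
  rw [← ofReal_norm, Complex.norm_real, Real.norm_of_nonneg (Real.sqrt_nonneg _),
    Real.sqrt_eq_rpow, ENNReal.ofReal_rpow_of_pos (div_pos hσ hT), ← ENNReal.ofReal_mul (by positivity)]
  rw [show (1 / (2 : ℝ≥0∞)).toReal = 1 / 2 by norm_num, ← Real.mul_rpow hpos.le (div_pos hσ hT).le,
    show T / σ * (σ / T) = 1 by field_simp, Real.one_rpow, ENNReal.ofReal_one]

/-- The operator `(U ξ)(t) = √(T/σ) ξ((T t - c)/σ)` for `c/T ≤ t ≤ (σ + c)/T`, and `(U ξ)(t) = 0`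
otherwise, on `L²([0,1])`, for `T, σ > 0`. It is an isometry if `0 ≤ c` and `c + σ ≤ T`. -/
def towerOperator (T σ c : ℝ) : L2I →L[ℂ] L2I :=
  open Classical in
  if h : 0 < T ∧ 0 < σ then
    LinearMap.mkContinuous
      { toFun := fun ξ => ((eLpNorm_towerFun h.1 h.2 c ξ).1.restrict (Icc 0 1)).toLp
        map_add' := fun ξ η => by
          refine Lp.ext ?_
          filter_upwards [MemLp.coeFn_toLp ((eLpNorm_towerFun h.1 h.2 c (ξ + η)).1.restrict (Icc 0 1)),
            MemLp.coeFn_toLp ((eLpNorm_towerFun h.1 h.2 c ξ).1.restrict (Icc 0 1)),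
            MemLp.coeFn_toLp ((eLpNorm_towerFun h.1 h.2 c η).1.restrict (Icc 0 1)),
            Lp.coeFn_add ((eLpNorm_towerFun h.1 h.2 c ξ).1.restrict (Icc 0 1)).toLp
              ((eLpNorm_towerFun h.1 h.2 c η).1.restrict (Icc 0 1)).toLp,
            ae_restrict_of_ae (towerFun_congr h.1 h.2 c (Lp.coeFn_add ξ η))] with t h1 h2 h3 h4 h5
          rw [h1, h4, h5, Pi.add_apply, h2, h3]
          by_cases ht : t ∈ Icc (c / T) ((σ + c) / T) <;> simp [towerFun, ht, mul_add]
        map_smul' := fun z ξ => by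
          refine Lp.ext ?_
          filter_upwards [MemLp.coeFn_toLp ((eLpNorm_towerFun h.1 h.2 c (z • ξ)).1.restrict (Icc 0 1)),
            MemLp.coeFn_toLp ((eLpNorm_towerFun h.1 h.2 c ξ).1.restrict (Icc 0 1)),
            Lp.coeFn_smul z ((eLpNorm_towerFun h.1 h.2 c ξ).1.restrict (Icc 0 1)).toLp,
            ae_restrict_of_ae (towerFun_congr h.1 h.2 c (Lp.coeFn_smul z ξ))] with t h1 h2 h3 h4
          rw [h1, h4, RingHom.id_apply, h3, Pi.smul_apply, h2]
          by_cases ht : t ∈ Icc (c / T) ((σ + c) / T) <;> simp [towerFun, ht, mul_left_comm] }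
      1 fun ξ => by
        rw [one_mul, LinearMap.coe_mk, AddHom.coe_mk, Lp.norm_toLp, Lp.norm_def]
        refine ENNReal.toReal_mono (Lp.eLpNorm_ne_top ξ) ?_
        rw [← (eLpNorm_towerFun h.1 h.2 c ξ).2]
        exact eLpNorm_mono_measure _ Measure.restrict_le_self
  else 0

end Tower
/-! ## Flowboxes, return times and Rokhlin towers -/

section Dynamics

variable {X : Type*} [MetricSpace X]

/-- A flow is free if it has no periodic (in particular no fixed) points. -/
def IsFreeFlow (φ : Flow ℝ X) : Prop := ∀ x t, φ t x = x → t = 0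

/-- A flow is minimal if the forward orbit of every point is dense. -/
def IsMinimalFlow (φ : Flow ℝ X) : Prop := ∀ x, Dense ((fun t => φ t x) '' Ici 0)

/-- `[a, b] ∋ 0` is a maximal interval of times at which the orbit of `x` stays in `B`, and the
orbit does not meet `B` immediately before `a` and immediately after `b`. -/
def IsFlowInterval (φ : Flow ℝ X) (B : Set X) (x : X) (a b : ℝ) : Prop :=
  a ≤ 0 ∧ 0 ≤ b ∧ (∀ t ∈ Icc a b, φ t x ∈ B) ∧
    ∃ ε > 0, ∀ t ∈ Ioo (a - ε) a ∪ Ioo b (b + ε), φ t x ∉ B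

/-- `B` is a flowbox of length `l`. -/
structure IsFlowBox (φ : Flow ℝ X) (B : Set X) (l : ℝ) : Prop where
  isCompact : IsCompact B
  length_pos : 0 < l
  exists_interval : ∀ x ∈ B, ∃ a b, l = b - a ∧ IsFlowInterval φ B x a b

/-- The central slice of a flowbox. -/
def centralSlice (φ : Flow ℝ X) (B : Set X) : Set X :=
  {x ∈ B | ∃ a b, IsFlowInterval φ B x a b ∧ a + b = 0}

/-- The set `φ(S × I)` of all points `φₜ(y)` with `y ∈ S` and `t ∈ I`. -/
def flowImage (φ : Flow ℝ X) (S : Set X) (I : Set ℝ) : Set X := {x | ∃ y ∈ S, ∃ t ∈ I, φ t y = x}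

/-- A flowbox structure around `x`. -/
structure FlowBoxStructure (φ : Flow ℝ X) (x : X) where
  box : ℕ → Set X
  length : ℕ → ℝ
  isFlowBox : ∀ n, IsFlowBox φ (box n) (length n)
  interior_nonempty : ∀ n, (interior (box n)).Nonempty
  slice_succ_subset : ∀ n,
    centralSlice φ (box (n + 1)) ⊆ centralSlice φ (box n) ∩ interior (box n)
  length_large : ∀ L > 0, ∃ N, ∀ n > N, L < length n
  slice_subset_ball : ∀ n > 0, centralSlice φ (box n) ⊆ Metric.ball x (1 / n)
  thin_interior_nonempty : ∀ n, ∀ l, 0 < l → l ≤ length n →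
    (interior (flowImage φ (centralSlice φ (box n)) (Icc (-l / 2) (l / 2)))).Nonempty
  exists_subset_interior : ∀ n, ∀ η, 0 < η → η < length n / 2 → ∃ k > n, ∀ L₁ L₂, L₁ ≤ L₂ →
    -length n / 2 < L₁ - η → L₂ + η < length n / 2 →
    flowImage φ (centralSlice φ (box k)) (Icc L₁ L₂) ⊆
      interior (flowImage φ (centralSlice φ (box n)) (Icc (L₁ - η) (L₂ + η)))

/-- A Cantor flowbox structure around `x`: its central slices are clopen subsets of the central
slice of one flowbox with non-empty interior whose central slice is a Cantor space, and they lie in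
the interior of that flowbox. -/
structure CantorFlowBoxStructure (φ : Flow ℝ X) (x : X) extends FlowBoxStructure φ x where
  ambientBox : Set X
  ambientLength : ℝ
  isFlowBox_ambient : IsFlowBox φ ambientBox ambientLength
  ambient_interior_nonempty : (interior ambientBox).Nonempty
  cantor : Nonempty (centralSlice φ ambientBox ≃ₜ (ℕ → Bool))
  slice_subset_ambient : ∀ n,
    centralSlice φ (box n) ⊆ centralSlice φ ambientBox ∩ interior ambientBox
  isClopen_slice : ∀ n,
    IsClopen ((↑) ⁻¹' centralSlice φ (box n) : Set (centralSlice φ ambientBox))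

/-- The first (strictly positive) time at which the orbit of `x` arrives in `S`. -/
def arrivalTime (φ : Flow ℝ X) (S : Set X) (x : X) : ℝ := sInf {t | 0 < t ∧ φ t x ∈ S}

lemma arrivalTime_mem {φ : Flow ℝ X} {S : Set X} (hS : IsClosed S) {x : X}
    (h : ∃ t, 0 < t ∧ φ t x ∈ S) : φ (arrivalTime φ S x) x ∈ S := by
  have hbdd : BddBelow {t | 0 < t ∧ φ t x ∈ S} := ⟨0, fun t ht => ht.1.le⟩
  have hcl : IsClosed {t : ℝ | φ t x ∈ S} :=
    hS.preimage (φ.cont'.comp (continuous_id.prodMk continuous_const))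
  exact closure_minimal (fun t (ht : 0 < t ∧ φ t x ∈ S) => ht.2) hcl (csInf_mem_closure h hbdd)

namespace CantorFlowBoxStructure

variable {φ : Flow ℝ X} {x : X} (𝔅 : CantorFlowBoxStructure φ x)

/-- The central slice `Sₙ`. -/
def slice (n : ℕ) : Set X := centralSlice φ (𝔅.box n)

lemma isCompact_slice (n : ℕ) : IsCompact (𝔅.slice n) := by
  obtain ⟨e⟩ := 𝔅.cantor
  have : CompactSpace (centralSlice φ 𝔅.ambientBox) := e.symm.compactSpace
  have h := (𝔅.isClopen_slice n).isClosed.isCompact.image continuous_subtype_val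
  rwa [Subtype.image_preimage_coe,
    inter_eq_right.2 fun y hy => (𝔅.slice_subset_ambient n hy).1] at h

instance (n : ℕ) : CompactSpace (𝔅.slice n) := isCompact_iff_compactSpace.1 (𝔅.isCompact_slice n)

lemma exists_arrival (hmin : IsMinimalFlow φ) (n : ℕ) (y : X) :
    ∃ t, 0 < t ∧ φ t y ∈ 𝔅.slice n := by
  have hl := (𝔅.isFlowBox n).length_pos
  obtain ⟨z, hz, t, ht, rfl⟩ := (hmin (φ (𝔅.length n) y)).inter_open_nonempty _ isOpen_interior
    (𝔅.thin_interior_nonempty n _ hl le_rfl)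
  obtain ⟨w, hw, s, hs, hst⟩ := interior_subset hz
  change φ s w = φ t (φ (𝔅.length n) y) at hst
  refine ⟨-s + (t + 𝔅.length n), by linarith [hs.2, mem_Ici.1 ht], ?_⟩
  rw [φ.map_add, φ.map_add, ← hst, ← φ.map_add, neg_add_cancel, φ.map_zero_apply]
  exact hw

/-- The inclusion `Sₙ₊₁ ⊆ Sₙ`. -/
def incl (n : ℕ) : 𝔅.slice (n + 1) → 𝔅.slice n :=
  inclusion fun _ hy => (𝔅.slice_succ_subset n hy).1

/-- The first return time `τₙ : Sₙ → ℝ`. -/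
def returnTime (n : ℕ) (y : 𝔅.slice n) : ℝ := arrivalTime φ (𝔅.slice n) y

variable (hmin : IsMinimalFlow φ)

/-- The first return map `Φₙ : Sₙ → Sₙ`. -/
def returnMap (n : ℕ) (y : 𝔅.slice n) : 𝔅.slice n :=
  ⟨φ (𝔅.returnTime n y) y,
    arrivalTime_mem (𝔅.isCompact_slice n).isClosed (𝔅.exists_arrival hmin n y)⟩

/-- The height `j` of the Rokhlin tower over the floor `F⁽⁰⁾ⱼ ∋ y` of `Sₙ₊₁`: the first return of
`y ∈ Sₙ₊₁` to `Sₙ₊₁` under `Φₙ` takes `j + 1` steps. The tower has the floors `Φₙᵏ(F⁽⁰⁾ⱼ)`,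
`0 ≤ k ≤ j`. -/
def towerHeight (n : ℕ) (y : 𝔅.slice (n + 1)) : ℕ :=
  sInf {j | (((𝔅.returnMap hmin n)^[j + 1] (𝔅.incl n y) : 𝔅.slice n) : X) ∈ 𝔅.slice (n + 1)}

/-- The time at which `y ∈ Sₙ₊₁` arrives in the `k`-th floor of its Rokhlin tower, at `Φₙᵏ(y)`. -/
def floorTime (n k : ℕ) (y : 𝔅.slice (n + 1)) : ℝ :=
  ∑ i ∈ Finset.range k, 𝔅.returnTime n ((𝔅.returnMap hmin n)^[i] (𝔅.incl n y))

/-- The isometry of `L²([0,1])` attached to `y ∈ Sₙ₊₁` and to the `k`-th floor of its tower. -/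
def floorIsometry (n k : ℕ) (y : 𝔅.slice (n + 1)) : L2I →L[ℂ] L2I :=
  towerOperator (𝔅.returnTime (n + 1) y)
    (𝔅.returnTime n ((𝔅.returnMap hmin n)^[k] (𝔅.incl n y))) (𝔅.floorTime hmin n k y)

/-- The C*-algebra `C(Sₙ, 𝕂)`, where `𝕂` is the algebra of compact operators on `L²([0,1])`. -/
abbrev SliceAlgebra (n : ℕ) : Type _ := C(𝔅.slice n, compactOperators L2I)

/-- The `*`-homomorphism `ι : C(Sₙ, 𝕂) → C(Sₙ₊₁, 𝕂)` is the one given by the Rokhlin towers: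
`ι(f)(y) = ∑ₖ Uₖ(y) f(Φₙᵏ(y)) Uₖ(y)*`, where `k` runs over the floors of the tower over `y`. -/
def IsConnectingMap (n : ℕ) (ι : 𝔅.SliceAlgebra n →⋆ₙₐ[ℂ] 𝔅.SliceAlgebra (n + 1)) : Prop :=
  ∀ (f : 𝔅.SliceAlgebra n) (y : 𝔅.slice (n + 1)),
    (ι f y : L2I →L[ℂ] L2I) = ∑ k ∈ Finset.range (𝔅.towerHeight hmin n y + 1),
      𝔅.floorIsometry hmin n k y *
        (f ((𝔅.returnMap hmin n)^[k] (𝔅.incl n y)) : L2I →L[ℂ] L2I) *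
          ContinuousLinearMap.adjoint (𝔅.floorIsometry hmin n k y)

end CantorFlowBoxStructure

end Dynamics

end

/-!
The crossed product contains the increasing sequence of the `*`-algebras `Dₙ` (`breakingAlgebra`) of
all `a ∈ C_c(ℝ, C(X))` that break every orbit at every point of the slice `Sₙ`: the integral kernel
`(t, u) ↦ a(t - u)(φₜ(y))` of `a` on an orbit vanishes if a visit of the orbit to `Sₙ` separates the
times `t` and `u`. Hence the operator given by `a` on the `L²`-space of an orbit is block diagonal, with
one block for each segment between two consecutive visits. As every point of `X` lies on such a segment,
`a` is determined by the blocks, and rescaling the segment over `y ∈ Sₙ` to the unit interval gives a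
`*`-homomorphism `sliceRep : Dₙ → C(Sₙ, 𝕂)`.

Three facts about it carry the proof.

* It is isometric for the universal norm (`norm_sliceRep`). One inequality holds as the blocks are
  compressions of the regular representations. For the other, let `ρ` be a representation that is
  bounded by the `L¹`-norm and let `c ∈ Dₙ` be self-adjoint. The kernel of `c b c` is bounded, up to a
  constant that depends on `c` only, by the operator norm of `b`, and so is then the `L¹`-norm of
  `c b c`. With `b` a high power of `c`, taking roots yields `‖ρ(c)‖ ≤ ‖sliceRep c‖`
  (`norm_le_of_norm_mul_mul_le`). No amenability argument is needed.
* It has dense range (`denseRange_sliceRep`). For functions `ξ`, `η` that vanish outside the open unit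
  interval and for `f ∈ C(Sₙ)`, the function `y ↦ f(y) |ξ⟩⟨η|` is attained: its kernels glue to a
  continuous function on `ℝ × X`, as this is a quotient of `ℝ × Sₙ × [0,1]`.
* Over `y ∈ Sₙ₊₁` the tower formula turns `sliceRep` on `Dₙ` into `sliceRep` on `Dₙ₊₁`
  (`coe_sliceRep_succ_apply`), since the visits to `Sₙ` cut the orbit segment over `y` into the segments
  of the floors.

By the first two facts the inclusion `Dₙ ⊆ Dₙ₊₁` extends to a `*`-homomorphism
`C(Sₙ, 𝕂) → C(Sₙ₊₁, 𝕂)`, and by the third it is given by the tower formula. The slices shrink to `x`, so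
the union of the `Dₙ` is dense in the orbit-breaking algebra
(`exists_breakingAlgebra_norm_sub_lt`). This algebra and the inductive limit are therefore completions
of the same `*`-algebra in the same norm (`nonempty_starAlgEquiv_CStarLimit`).
-/

set_option linter.unusedSectionVars false

noncomputable section

/-! ### Extension of `*`-homomorphisms from dense images -/

section Extension

variable {D A B : Type*} [NonUnitalRing D] [Module ℂ D] [StarRing D]
  [NonUnitalCStarAlgebra A] [NonUnitalCStarAlgebra B]

theorem NonUnitalStarAlgHom.continuous_of_cstar (h : A →⋆ₙₐ[ℂ] B) : Continuous h :=
  AddMonoidHomClass.continuous_of_bound h 1 fun a => by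
    simpa using NonUnitalStarAlgHom.norm_apply_le h a

/-- A `*`-homomorphism `g` that is dominated in norm by a `*`-homomorphism `f` with dense range factors
through `f`. -/
theorem exists_starAlgHom_extension (f : D →⋆ₙₐ[ℂ] A) (g : D →⋆ₙₐ[ℂ] B) (hf : DenseRange f)
    (hfg : ∀ d, ‖g d‖ ≤ ‖f d‖) : ∃ h : A →⋆ₙₐ[ℂ] B, ∀ d, h (f d) = g d := by
  let f' : D →ₗ[ℂ] A := { toFun := f, map_add' := map_add f, map_smul' := map_smul f }
  let g' : D →ₗ[ℂ] B := { toFun := g, map_add' := map_add g, map_smul' := map_smul g }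
  have hb : ∃ C, ∀ d, ‖g' d‖ ≤ C * ‖f' d‖ := ⟨1, fun d => by rw [one_mul]; exact hfg d⟩
  let h : A →L[ℂ] B := g'.extendOfNorm f'
  have key : ∀ d, h (f d) = g d := fun d => LinearMap.extendOfNorm_eq (f := g') (e := f') hf hb d
  refine ⟨{ toFun := h, map_smul' := map_smul h, map_zero' := map_zero h, map_add' := map_add h,
            map_mul' := ?_, map_star' := ?_ }, key⟩
  · intro a b
    refine hf.induction_on₂ (p := fun a b => h (a * b) = h a * h b)
      (isClosed_eq (by fun_prop) (by fun_prop)) (fun d e => ?_) a b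
    rw [← map_mul, key, key, key, map_mul]
  · intro a
    refine hf.induction_on (p := fun a => h (star a) = star (h a)) a
      (isClosed_eq (by fun_prop) (by fun_prop)) fun d => ?_
    rw [← map_star, key, key, map_star]

/-- Two completions of the same `*`-algebra in the same C*-seminorm are isomorphic. -/
theorem nonempty_starAlgEquiv_of_denseRange (f : D →⋆ₙₐ[ℂ] A) (g : D →⋆ₙₐ[ℂ] B)
    (hf : DenseRange f) (hg : DenseRange g) (hfg : ∀ d, ‖g d‖ = ‖f d‖) :
    Nonempty (A ≃⋆ₐ[ℂ] B) := by
  obtain ⟨h, hh⟩ := exists_starAlgHom_extension f g hf fun d => (hfg d).le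
  obtain ⟨k, hk⟩ := exists_starAlgHom_extension g f hg fun d => (hfg d).ge
  have hc := h.continuous_of_cstar
  have kc := k.continuous_of_cstar
  refine ⟨{ toFun := h, invFun := k, map_mul' := map_mul h, map_add' := map_add h,
            map_star' := map_star h, map_smul' := map_smul h, left_inv := fun a => ?_,
            right_inv := fun a => ?_ }⟩
  · refine hf.induction_on (p := fun a => k (h a) = a) a
      (isClosed_eq (kc.comp hc) continuous_id) fun d => ?_
    rw [hh, hk]
  · refine hg.induction_on (p := fun a => h (k a) = a) a
      (isClosed_eq (hc.comp kc) continuous_id) fun d => ?_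
    rw [hk, hh]

end Extension

/-! ### Flowboxes and return times -/

section Dynamics

variable {X : Type*} [MetricSpace X] {φ : Flow ℝ X}

theorem IsFlowInterval.left_le {B : Set X} {x : X} {a b a' b' : ℝ} (h : IsFlowInterval φ B x a b)
    (h' : IsFlowInterval φ B x a' b') : a' ≤ a := by
  obtain ⟨ha, hb, hab, -⟩ := h
  obtain ⟨ha', hb', -, ε, hε, hout⟩ := h'
  by_contra! hlt
  have h1 : max a (a' - ε / 2) < a' := max_lt hlt (by linarith)
  have h2 := le_max_left a (a' - ε / 2)
  have h3 := le_max_right a (a' - ε / 2)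
  exact hout (max a (a' - ε / 2)) (Or.inl ⟨by linarith, h1⟩) (hab _ ⟨h2, by linarith⟩)

theorem IsFlowInterval.le_right {B : Set X} {x : X} {a b a' b' : ℝ} (h : IsFlowInterval φ B x a b)
    (h' : IsFlowInterval φ B x a' b') : b ≤ b' := by
  obtain ⟨ha, hb, hab, -⟩ := h
  obtain ⟨ha', hb', -, ε, hε, hout⟩ := h'
  by_contra! hlt
  have h1 : b' < min b (b' + ε / 2) := lt_min hlt (by linarith)
  have h2 := min_le_left b (b' + ε / 2)
  have h3 := min_le_right b (b' + ε / 2)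
  exact hout (min b (b' + ε / 2)) (Or.inr ⟨h1, by linarith⟩) (hab _ ⟨by linarith, h2⟩)

theorem IsFlowInterval.shift {B : Set X} {x : X} {a b t : ℝ} (h : IsFlowInterval φ B x a b)
    (ht : t ∈ Icc a b) : IsFlowInterval φ B (φ t x) (a - t) (b - t) := by
  obtain ⟨ha, hb, hab, ε, hε, hout⟩ := h
  refine ⟨by linarith [ht.1], by linarith [ht.2], fun s hs => ?_, ε, hε, fun s hs => ?_⟩
  · rw [← φ.map_add]
    exact hab _ ⟨by linarith [hs.1], by linarith [hs.2]⟩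
  · rw [← φ.map_add]
    refine hout _ ?_
    rcases hs with hs | hs
    · exact Or.inl ⟨by linarith [hs.1], by linarith [hs.2]⟩
    · exact Or.inr ⟨by linarith [hs.1], by linarith [hs.2]⟩

namespace IsFlowBox

variable {B : Set X} {l : ℝ} (hB : IsFlowBox φ B l)
include hB

theorem isFlowInterval_of_mem_centralSlice {y : X} (hy : y ∈ centralSlice φ B) :
    IsFlowInterval φ B y (-(l / 2)) (l / 2) := by
  obtain ⟨hyB, a, b, hab, h0⟩ := hy
  obtain ⟨a', b', hl, hab'⟩ := hB.exists_interval y hyB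
  have h1 := le_antisymm (hab.left_le hab') (hab'.left_le hab)
  have h2 := le_antisymm (hab.le_right hab') (hab'.le_right hab)
  have h3 : a = -(l / 2) := by linarith
  have h4 : b = l / 2 := by linarith
  rwa [← h3, ← h4]

/-- An orbit that leaves the central slice of a flowbox does not come back to it within a time
which is at most the length of the flowbox. -/
theorem eq_zero_of_abs_le {y : X} (hy : y ∈ centralSlice φ B) {t : ℝ} (ht : |t| ≤ l)
    (hty : φ t y ∈ centralSlice φ B) : t = 0 := by
  have hl := hB.length_pos
  obtain ⟨h1, h2⟩ := abs_le.1 ht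
  have hi := hB.isFlowInterval_of_mem_centralSlice hy
  have hj := hB.isFlowInterval_of_mem_centralSlice hty
  -- The intervals around the times `0` and `t` both contain the time `t / 2`.
  have hi' := hi.shift (t := t / 2) ⟨by linarith, by linarith⟩
  have hj' := hj.shift (t := -(t / 2)) ⟨by linarith, by linarith⟩
  rw [← φ.map_add, show -(t / 2) + t = t / 2 by ring] at hj'
  have h3 := le_antisymm (hi'.left_le hj') (hj'.left_le hi')
  linarith

theorem exists_centralSlice {x : X} (hx : x ∈ B) :
    ∃ y ∈ centralSlice φ B, ∃ t ∈ Icc (-(l / 2)) (l / 2), φ t y = x := by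
  have hl := hB.length_pos
  obtain ⟨a, b, hab, hi⟩ := hB.exists_interval x hx
  have hi' := hi.shift (t := (a + b) / 2) ⟨by linarith, by linarith⟩
  refine ⟨φ ((a + b) / 2) x, ⟨?_, _, _, hi', by ring⟩, -((a + b) / 2), ?_, ?_⟩
  · exact hi.2.2.1 _ ⟨by linarith, by linarith⟩
  · constructor <;> linarith [hi.1, hi.2.1]
  · rw [← φ.map_add, neg_add_cancel, φ.map_zero_apply]

/-- The flow over a clopen part of a compact central slice which lies in the interior of the flowbox
covers a neighbourhood of that part. -/
theorem flowImage_mem_nhds (hc : IsCompact (centralSlice φ B)) {S : Set X}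
    (hS : IsClopen ((↑) ⁻¹' S : Set (centralSlice φ B))) {y : X} (hyS : y ∈ S)
    (hyB : y ∈ centralSlice φ B ∩ interior B) {ε : ℝ} (hε : 0 < ε) :
    flowImage φ S (Ioo (-ε) ε) ∈ 𝓝 y := by
  have hl := hB.length_pos
  let C : Set (ℝ × centralSlice φ B) :=
    {p | p.1 ∈ Icc (-(l / 2)) (l / 2) ∧ ¬(p.1 ∈ Ioo (-ε) ε ∧ (p.2 : X) ∈ S)}
  have : CompactSpace (centralSlice φ B) := isCompact_iff_compactSpace.1 hc
  have hC : IsCompact C := by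
    have h1 : IsCompact (Icc (-(l / 2)) (l / 2) ×ˢ (univ : Set (centralSlice φ B))) :=
      isCompact_Icc.prod isCompact_univ
    have h2 : IsClosed {p : ℝ × centralSlice φ B | ¬(p.1 ∈ Ioo (-ε) ε ∧ (p.2 : X) ∈ S)} :=
      (isOpen_Ioo.prod hS.isOpen).isClosed_compl
    convert! h1.inter_right h2 using 1
    ext p
    simp [C]
  have hcont : Continuous fun p : ℝ × centralSlice φ B => φ p.1 (p.2 : X) :=
    φ.cont'.comp (continuous_fst.prodMk (continuous_subtype_val.comp continuous_snd))
  have hcl : IsClosed ((fun p : ℝ × centralSlice φ B => φ p.1 (p.2 : X)) '' C) :=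
    (hC.image hcont).isClosed
  have hy : y ∉ (fun p : ℝ × centralSlice φ B => φ p.1 (p.2 : X)) '' C := by
    rintro ⟨⟨t, w⟩, ⟨ht, hn⟩, htw⟩
    simp only at ht hn htw
    have h0 : t = 0 := hB.eq_zero_of_abs_le w.2
      (abs_le.2 ⟨by linarith [ht.1], by linarith [ht.2]⟩) (htw ▸ hyB.1)
    subst h0
    rw [φ.map_zero_apply] at htw
    exact hn ⟨⟨by linarith, hε⟩, htw ▸ hyS⟩
  filter_upwards [hcl.isOpen_compl.mem_nhds hy, isOpen_interior.mem_nhds hyB.2] with z hz hzB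
  obtain ⟨w, hw, t, ht, rfl⟩ := hB.exists_centralSlice (interior_subset hzB)
  by_contra hcon
  exact hz ⟨(t, ⟨w, hw⟩), ⟨ht, fun h => hcon ⟨w, h.2, t, h.1, rfl⟩⟩, rfl⟩

end IsFlowBox

end Dynamics

section Return

variable {X : Type*} [MetricSpace X] {φ : Flow ℝ X}

namespace CantorFlowBoxStructure

variable {x : X} (𝔅 : CantorFlowBoxStructure φ x)

theorem flowImage_slice_mem_nhds {n : ℕ} {y : X} (hy : y ∈ 𝔅.slice n) {ε : ℝ} (hε : 0 < ε) :
    flowImage φ (𝔅.slice n) (Ioo (-ε) ε) ∈ 𝓝 y := by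
  obtain ⟨e⟩ := 𝔅.cantor
  have : CompactSpace (centralSlice φ 𝔅.ambientBox) := e.symm.compactSpace
  exact 𝔅.isFlowBox_ambient.flowImage_mem_nhds (isCompact_iff_compactSpace.2 this)
    (𝔅.isClopen_slice n) hy (𝔅.slice_subset_ambient n hy) hε

theorem ambientLength_lt {n : ℕ} {y : X} (hy : y ∈ 𝔅.slice n) {t : ℝ} (ht : 0 < t)
    (hty : φ t y ∈ 𝔅.slice n) : 𝔅.ambientLength < t := by
  by_contra! h
  exact ht.ne' (𝔅.isFlowBox_ambient.eq_zero_of_abs_le (𝔅.slice_subset_ambient n hy).1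
    (by rwa [abs_of_pos ht]) (𝔅.slice_subset_ambient n hty).1)

theorem returnTime_le {n : ℕ} (y : 𝔅.slice n) {t : ℝ} (ht : 0 < t) (hty : φ t y ∈ 𝔅.slice n) :
    𝔅.returnTime n y ≤ t :=
  csInf_le ⟨0, fun _ hs => hs.1.le⟩ ⟨ht, hty⟩

theorem slice_succ_subset_slice (n : ℕ) : 𝔅.slice (n + 1) ⊆ 𝔅.slice n :=
  fun _ hy => (𝔅.slice_succ_subset n hy).1

theorem antitone_slice : Antitone 𝔅.slice := antitone_nat_of_succ_le 𝔅.slice_succ_subset_slice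

theorem exists_slice_subset {U : Set X} (hU : U ∈ 𝓝 x) : ∃ N, ∀ n ≥ N, 𝔅.slice n ⊆ U := by
  obtain ⟨ε, hε, hεU⟩ := Metric.mem_nhds_iff.1 hU
  obtain ⟨N, hN⟩ := exists_nat_gt (1 / ε)
  refine ⟨N + 1, fun n hn => ?_⟩
  have h0 : (0 : ℝ) < n := by exact_mod_cast (by omega : 0 < n)
  refine (𝔅.slice_subset_ball n (by omega)).trans ((Metric.ball_subset_ball ?_).trans hεU)
  rw [div_le_iff₀ h0, ← div_le_iff₀' hε]
  have : (N : ℝ) ≤ n := by exact_mod_cast (by omega : N ≤ n)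
  linarith

variable (hmin : IsMinimalFlow φ)
include hmin

theorem nonempty_slice (n : ℕ) : (𝔅.slice n).Nonempty :=
  let ⟨_, _, h⟩ := 𝔅.exists_arrival hmin n x
  ⟨_, h⟩

/-- The slices are closed, nested and non-empty, and they shrink to `x`. -/
theorem mem_slice (n : ℕ) : x ∈ 𝔅.slice n := by
  by_contra h
  obtain ⟨N, hN⟩ := 𝔅.exists_slice_subset
    ((𝔅.isCompact_slice n).isClosed.isOpen_compl.mem_nhds h)
  obtain ⟨y, hy⟩ := 𝔅.nonempty_slice hmin (max n N)
  exact hN _ (le_max_right n N) hy (𝔅.antitone_slice (le_max_left n N) hy)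

theorem map_returnTime_mem {n : ℕ} (y : 𝔅.slice n) : φ (𝔅.returnTime n y) y ∈ 𝔅.slice n :=
  arrivalTime_mem (𝔅.isCompact_slice n).isClosed (𝔅.exists_arrival hmin n y)

theorem ambientLength_le_returnTime {n : ℕ} (y : 𝔅.slice n) :
    𝔅.ambientLength ≤ 𝔅.returnTime n y :=
  le_csInf (𝔅.exists_arrival hmin n y) fun _ ht => (𝔅.ambientLength_lt y.2 ht.1 ht.2).le

theorem returnTime_pos {n : ℕ} (y : 𝔅.slice n) : 0 < 𝔅.returnTime n y :=
  𝔅.isFlowBox_ambient.length_pos.trans_le (𝔅.ambientLength_le_returnTime hmin y)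

theorem continuous_returnTime (n : ℕ) : Continuous (𝔅.returnTime n) := by
  have hφ : Continuous fun p : ℝ × 𝔅.slice n => φ p.1 (p.2 : X) :=
    φ.cont'.comp (continuous_fst.prodMk (continuous_subtype_val.comp continuous_snd))
  rw [continuous_iff_continuousAt]
  intro y
  have hτ := 𝔅.returnTime_pos hmin y
  rw [ContinuousAt, tendsto_order]
  constructor
  · intro a ha
    -- Up to the time `a` the orbit of `y`, and hence that of each near point, stays away from `Sₙ`.
    have hev : ∀ᶠ z : 𝔅.slice n in 𝓝 y, ∀ t ∈ Icc 𝔅.ambientLength a, φ t (z : X) ∉ 𝔅.slice n := by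
      refine isCompact_Icc.eventually_forall_of_forall_eventually fun t ht => ?_
      have : φ t (y : X) ∉ 𝔅.slice n := fun h => by
        have := 𝔅.returnTime_le y (𝔅.isFlowBox_ambient.length_pos.trans_le ht.1) h
        linarith [ht.2]
      exact ((hφ.comp continuous_swap).continuousAt (x := (y, t))).eventually
        ((𝔅.isCompact_slice n).isClosed.isOpen_compl.mem_nhds this)
    filter_upwards [hev] with z hz
    by_contra! hlt
    exact hz _ ⟨𝔅.ambientLength_le_returnTime hmin z, hlt⟩ (𝔅.map_returnTime_mem hmin z)
  · intro b hb
    have hε : 0 < min (b - 𝔅.returnTime n y) (𝔅.returnTime n y) := lt_min (by linarith) hτ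
    have hmem := 𝔅.flowImage_slice_mem_nhds (𝔅.map_returnTime_mem hmin y) hε
    have hc : ContinuousAt (fun z : 𝔅.slice n => φ (𝔅.returnTime n y) (z : X)) y :=
      (hφ.comp (continuous_const.prodMk continuous_id)).continuousAt
    filter_upwards [hc.eventually hmem] with z hz
    obtain ⟨w, hw, r, hr, hrw⟩ := hz
    have h1 := min_le_left (b - 𝔅.returnTime n y) (𝔅.returnTime n y)
    have h2 := min_le_right (b - 𝔅.returnTime n y) (𝔅.returnTime n y)
    have h3 : φ (𝔅.returnTime n y - r) (z : X) = w := by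
      rw [sub_eq_neg_add, φ.map_add, ← hrw, ← φ.map_add, neg_add_cancel, φ.map_zero_apply]
    have := 𝔅.returnTime_le z (by linarith [hr.2] : 0 < 𝔅.returnTime n y - r) (h3 ▸ hw)
    linarith [hr.1]

/-- Every point of `X` lies on an orbit segment between two consecutive visits to `Sₙ`: these segments
fill a compact set, which contains a dense forward orbit. -/
theorem exists_flow_eq [CompactSpace X] (n : ℕ) (z : X) :
    ∃ y : 𝔅.slice n, ∃ t ∈ Icc 0 (𝔅.returnTime n y), φ t (y : X) = z := by
  let q : 𝔅.slice n × ℝ → X := fun p => φ (p.2 * 𝔅.returnTime n p.1) (p.1 : X)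
  have hq : Continuous q := φ.cont'.comp
    ((continuous_snd.mul ((𝔅.continuous_returnTime hmin n).comp continuous_fst)).prodMk
      (continuous_subtype_val.comp continuous_fst))
  have hcl : IsClosed (q '' (univ ×ˢ Icc 0 1)) :=
    ((isCompact_univ.prod isCompact_Icc).image hq).isClosed
  suffices h : z ∈ q '' (univ ×ˢ Icc 0 1) by
    obtain ⟨⟨y, t⟩, ⟨-, ht⟩, rfl⟩ := h
    have hτ := 𝔅.returnTime_pos hmin y
    exact ⟨y, t * 𝔅.returnTime n y, ⟨mul_nonneg ht.1 hτ.le, by nlinarith [ht.2]⟩, rfl⟩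
  obtain ⟨y₀, hy₀⟩ := 𝔅.nonempty_slice hmin n
  refine closure_minimal ?_ hcl (hmin y₀ z)
  rintro _ ⟨t, ht, rfl⟩
  -- The last visit of the orbit of `y₀` to `Sₙ` up to the time `t`.
  have hK : IsCompact {r ∈ Icc 0 t | φ r y₀ ∈ 𝔅.slice n} :=
    isCompact_Icc.inter_right ((𝔅.isCompact_slice n).isClosed.preimage
      (φ.cont'.comp (continuous_id.prodMk continuous_const)))
  obtain ⟨r, ⟨hr, hry⟩, hmax⟩ := hK.exists_isGreatest ⟨0, ⟨le_rfl, ht⟩, by simpa using hy₀⟩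
  let y : 𝔅.slice n := ⟨φ r y₀, hry⟩
  have hτ := 𝔅.returnTime_pos hmin y
  have hle : t - r ≤ 𝔅.returnTime n y := by
    by_contra! hlt
    have h1 : φ (𝔅.returnTime n y + r) y₀ ∈ 𝔅.slice n := by
      rw [φ.map_add]
      exact 𝔅.map_returnTime_mem hmin y
    have := hmax ⟨⟨by linarith [hr.1], by linarith⟩, h1⟩
    linarith
  refine ⟨(y, (t - r) / 𝔅.returnTime n y), ⟨mem_univ _, div_nonneg (by linarith [hr.2]) hτ.le,
    (div_le_one hτ).2 hle⟩, ?_⟩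
  change φ ((t - r) / 𝔅.returnTime n y * 𝔅.returnTime n y) (φ r y₀) = φ t y₀
  rw [div_mul_cancel₀ _ hτ.ne', ← φ.map_add, sub_add_cancel]

omit hmin in
/-- The orbit segments between consecutive visits to `Sₙ` meet in end points only. -/
theorem eq_of_flow_eq {n : ℕ} {y z : 𝔅.slice n} {s t : ℝ} (hs : s ∈ Ioo 0 (𝔅.returnTime n y))
    (ht : t ∈ Icc 0 (𝔅.returnTime n z)) (h : φ s (y : X) = φ t (z : X)) : y = z ∧ s = t := by
  have hy : φ (t - s) (z : X) = y := by
    rw [sub_eq_neg_add, φ.map_add, ← h, ← φ.map_add, neg_add_cancel, φ.map_zero_apply]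
  have hz : φ (s - t) (y : X) = z := by
    rw [sub_eq_neg_add, φ.map_add, h, ← φ.map_add, neg_add_cancel, φ.map_zero_apply]
  have hst : s = t := by
    rcases lt_trichotomy s t with hlt | heq | hlt
    · have := 𝔅.returnTime_le z (sub_pos.2 hlt) (hy ▸ y.2)
      linarith [hs.1, ht.2]
    · exact heq
    · have := 𝔅.returnTime_le y (sub_pos.2 hlt) (hz ▸ z.2)
      linarith [hs.2, ht.1]
  refine ⟨Subtype.ext ?_, hst⟩
  rw [← hz, hst, sub_self, φ.map_zero_apply]

theorem exists_returnTime_le (n : ℕ) : ∃ T > 0, ∀ y, 𝔅.returnTime n y ≤ T := by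
  obtain ⟨T, hT⟩ := (isCompact_range (𝔅.continuous_returnTime hmin n)).bddAbove
  exact ⟨max T 1, lt_max_of_lt_right one_pos, fun y => (hT ⟨y, rfl⟩).trans (le_max_left _ _)⟩

/-! ### Rokhlin towers -/

theorem floorTime_succ (n k : ℕ) (y : 𝔅.slice (n + 1)) :
    𝔅.floorTime hmin n (k + 1) y = 𝔅.floorTime hmin n k y +
      𝔅.returnTime n ((𝔅.returnMap hmin n)^[k] (𝔅.incl n y)) :=
  Finset.sum_range_succ _ _

theorem map_floorTime (n k : ℕ) (y : 𝔅.slice (n + 1)) :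
    φ (𝔅.floorTime hmin n k y) y = (𝔅.returnMap hmin n)^[k] (𝔅.incl n y) := by
  induction k with
  | zero => simp [floorTime, incl]
  | succ k ih =>
    rw [floorTime_succ, add_comm, φ.map_add, ih, iterate_succ_apply']
    rfl

theorem floorTime_strictMono (n : ℕ) (y : 𝔅.slice (n + 1)) :
    StrictMono fun k => 𝔅.floorTime hmin n k y :=
  strictMono_nat_of_lt_succ fun k => by
    rw [floorTime_succ]
    linarith [𝔅.returnTime_pos hmin ((𝔅.returnMap hmin n)^[k] (𝔅.incl n y))]

theorem floorTime_zero (n : ℕ) (y : 𝔅.slice (n + 1)) : 𝔅.floorTime hmin n 0 y = 0 := by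
  simp [floorTime]

theorem exists_floorTime_le_lt (n : ℕ) (y : 𝔅.slice (n + 1)) {t : ℝ} (ht : 0 ≤ t) :
    ∃ k, 𝔅.floorTime hmin n k y ≤ t ∧ t < 𝔅.floorTime hmin n (k + 1) y := by
  have hge : ∀ k : ℕ, k * 𝔅.ambientLength ≤ 𝔅.floorTime hmin n k y := fun k => by
    induction k with
    | zero => simp [floorTime]
    | succ k ih =>
      rw [floorTime_succ]
      have := 𝔅.ambientLength_le_returnTime hmin ((𝔅.returnMap hmin n)^[k] (𝔅.incl n y))
      push_cast
      linarith
  have hex : ∃ k, t < 𝔅.floorTime hmin n k y := by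
    obtain ⟨k, hk⟩ := exists_nat_gt (t / 𝔅.ambientLength)
    exact ⟨k, ((div_lt_iff₀ 𝔅.isFlowBox_ambient.length_pos).1 hk).trans_le (hge k)⟩
  classical
  have hpos : Nat.find hex ≠ 0 := fun h => by
    have := Nat.find_spec hex
    rw [h, floorTime_zero] at this
    linarith
  obtain ⟨k, hk⟩ := Nat.exists_eq_succ_of_ne_zero hpos
  refine ⟨k, not_lt.1 (Nat.find_min hex (by omega)), ?_⟩
  have := Nat.find_spec hex
  rwa [hk] at this

/-- The orbit of a point of `Sₙ₊₁` visits `Sₙ` exactly at its floor times. -/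
theorem exists_eq_floorTime (n : ℕ) (y : 𝔅.slice (n + 1)) {t : ℝ} (ht : 0 ≤ t)
    (hty : φ t (y : X) ∈ 𝔅.slice n) : ∃ k, t = 𝔅.floorTime hmin n k y := by
  obtain ⟨k, h1, h2⟩ := 𝔅.exists_floorTime_le_lt hmin n y ht
  refine ⟨k, le_antisymm ?_ h1⟩
  by_contra! hlt
  have h3 : φ (t - 𝔅.floorTime hmin n k y)
      ((𝔅.returnMap hmin n)^[k] (𝔅.incl n y) : 𝔅.slice n) ∈ 𝔅.slice n := by
    rwa [← map_floorTime, ← φ.map_add, sub_add_cancel]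
  have := 𝔅.returnTime_le _ (sub_pos.2 hlt) h3
  rw [floorTime_succ] at h2
  linarith

/-- The return times of the floors of the tower over `y ∈ Sₙ₊₁` add up to the return time of `y` to
`Sₙ₊₁`. -/
theorem floorTime_towerHeight (n : ℕ) (y : 𝔅.slice (n + 1)) :
    𝔅.floorTime hmin n (𝔅.towerHeight hmin n y + 1) y = 𝔅.returnTime (n + 1) y := by
  have hτ := 𝔅.returnTime_pos hmin y
  have hret := 𝔅.map_returnTime_mem hmin y
  obtain ⟨k, hk⟩ := 𝔅.exists_eq_floorTime hmin n y hτ.le (𝔅.slice_succ_subset_slice n hret)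
  have hk0 : k ≠ 0 := by
    rintro rfl
    rw [floorTime_zero] at hk
    linarith
  obtain ⟨j, rfl⟩ := Nat.exists_eq_succ_of_ne_zero hk0
  have hj : (((𝔅.returnMap hmin n)^[j + 1] (𝔅.incl n y) : 𝔅.slice n) : X) ∈ 𝔅.slice (n + 1) := by
    rw [← map_floorTime]
    exact hk ▸ hret
  have hle : 𝔅.towerHeight hmin n y ≤ j := Nat.sInf_le hj
  have hmem : (((𝔅.returnMap hmin n)^[𝔅.towerHeight hmin n y + 1] (𝔅.incl n y) : 𝔅.slice n) : X)
      ∈ 𝔅.slice (n + 1) := Nat.sInf_mem (s := {j | (((𝔅.returnMap hmin n)^[j + 1]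
        (𝔅.incl n y) : 𝔅.slice n) : X) ∈ 𝔅.slice (n + 1)}) ⟨j, hj⟩
  refine le_antisymm ?_ ?_
  · rw [hk]
    exact (𝔅.floorTime_strictMono hmin n y).monotone (Nat.succ_le_succ hle)
  · refine 𝔅.returnTime_le y ?_ ?_
    · rw [← 𝔅.floorTime_zero hmin n y]
      exact 𝔅.floorTime_strictMono hmin n y (Nat.succ_pos _)
    · rwa [map_floorTime]

end CantorFlowBoxStructure

end Return

/-! ### Integral operators on `L²([0,1])` with continuous kernels -/

section Kernel

theorem memLp_two_restrict_Icc (f : C(ℝ, ℂ)) : MemLp f 2 (volume.restrict (Icc (0 : ℝ) 1)) := by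
  obtain ⟨C, hC⟩ := (isCompact_Icc (a := (0 : ℝ)) (b := 1)).exists_bound_of_continuousOn
    f.continuous.continuousOn
  exact MemLp.of_bound f.continuous.aestronglyMeasurable C
    ((ae_restrict_iff' measurableSet_Icc).2 (Eventually.of_forall hC))

/-- The class in `L²([0,1])` of a continuous function on `ℝ`. -/
def contL2 : C(ℝ, ℂ) →ₗ[ℂ] L2I where
  toFun f := (memLp_two_restrict_Icc f).toLp
  map_add' f g := MemLp.toLp_add (memLp_two_restrict_Icc f) (memLp_two_restrict_Icc g)
  map_smul' c f := MemLp.toLp_const_smul c (memLp_two_restrict_Icc f)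

theorem coeFn_contL2 (f : C(ℝ, ℂ)) : contL2 f =ᵐ[volume.restrict (Icc (0 : ℝ) 1)] f :=
  MemLp.coeFn_toLp (memLp_two_restrict_Icc f)

theorem norm_contL2_le {f : C(ℝ, ℂ)} {C : ℝ} (hC : 0 ≤ C) (h : ∀ t ∈ Icc (0 : ℝ) 1, ‖f t‖ ≤ C) :
    ‖contL2 f‖ ≤ C := by
  have h1 : ∀ᵐ t ∂volume.restrict (Icc (0 : ℝ) 1), ‖contL2 f t‖ ≤ C := by
    filter_upwards [coeFn_contL2 f, ae_restrict_mem measurableSet_Icc] with t ht htI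
    rw [ht]
    exact h t htI
  have h2 := Lp.norm_le_of_ae_bound hC h1
  simpa [measureUnivNNReal] using h2

theorem continuous_contL2 : Continuous contL2 := by
  rw [continuous_iff_continuousAt]
  intro f
  rw [ContinuousAt, tendsto_iff_norm_sub_tendsto_zero, Metric.tendsto_nhds]
  intro ε hε
  have h := ContinuousMap.tendsto_iff_forall_isCompact_tendstoUniformlyOn.1
    (tendsto_id (x := 𝓝 f)) _ (isCompact_Icc (a := (0 : ℝ)) (b := 1))
  filter_upwards [Metric.tendstoUniformlyOn_iff.1 h (ε / 2) (by linarith)] with g hg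
  rw [Real.dist_0_eq_abs, abs_of_nonneg (norm_nonneg _), ← map_sub]
  refine (norm_contL2_le (by linarith) fun t ht => ?_).trans_lt (half_lt_self hε)
  have := (hg t ht).le
  rwa [dist_eq_norm'] at this

theorem inner_contL2_left (f : C(ℝ, ℂ)) (ξ : L2I) :
    ⟪contL2 f, ξ⟫_ℂ = ∫ t in Icc (0 : ℝ) 1, ξ t * star (f t) := by
  rw [L2.inner_def]
  refine integral_congr_ae ?_
  filter_upwards [coeFn_contL2 f] with t ht
  rw [ht, RCLike.inner_apply]
  rfl

theorem inner_contL2 (f g : C(ℝ, ℂ)) :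
    ⟪contL2 f, contL2 g⟫_ℂ = ∫ t in Icc (0 : ℝ) 1, g t * star (f t) := by
  rw [inner_contL2_left]
  refine integral_congr_ae ?_
  filter_upwards [coeFn_contL2 g] with t ht
  rw [ht]

/-- The continuous functions on `ℝ` that vanish outside the open unit interval. -/
def unitBumps : Submodule ℂ C(ℝ, ℂ) where
  carrier := {f | ∀ t ∉ Ioo (0 : ℝ) 1, f t = 0}
  zero_mem' := fun _ _ => rfl
  add_mem' := fun hf hg t ht => by simp [hf t ht, hg t ht]
  smul_mem' := fun c f hf t ht => by simp [hf t ht]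

theorem topologicalClosure_map_unitBumps :
    (unitBumps.map contL2).topologicalClosure = ⊤ := by
  rw [Submodule.topologicalClosure_eq_top_iff, Submodule.eq_bot_iff]
  intro ξ hξ
  have hint : LocallyIntegrableOn ξ (Ioo (0 : ℝ) 1) (volume.restrict (Icc (0 : ℝ) 1)) :=
    ((Lp.memLp ξ).integrable (by norm_num)).locallyIntegrable.locallyIntegrableOn _
  have h := isOpen_Ioo.ae_eq_zero_of_integral_contDiff_smul_eq_zero hint fun g hg hgc hgs => by
    let f : C(ℝ, ℂ) := ⟨fun t => (g t : ℂ), Complex.continuous_ofReal.comp hg.continuous⟩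
    have hf : f ∈ unitBumps := fun t ht => by
      simp [f, image_eq_zero_of_notMem_tsupport fun h => ht (hgs h)]
    have := hξ (contL2 f) (Submodule.mem_map_of_mem hf)
    rw [inner_contL2_left] at this
    rw [← this]
    refine integral_congr_ae (Eventually.of_forall fun t => ?_)
    simp [f, mul_comm]
  refine Lp.ext ?_
  have hae : ∀ᵐ t ∂volume.restrict (Icc (0 : ℝ) 1), t ∈ Ioo (0 : ℝ) 1 := by
    rw [← restrict_Ioo_eq_restrict_Icc]
    exact ae_restrict_mem measurableSet_Ioo
  filter_upwards [h, hae, Lp.coeFn_zero ℂ 2 (volume.restrict (Icc (0 : ℝ) 1))] with t h1 h2 h3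
  rw [h1 h2, h3]
  rfl

theorem dense_contL2_unitBumps : Dense (contL2 '' (unitBumps : Set C(ℝ, ℂ))) := by
  have h := topologicalClosure_map_unitBumps
  intro ξ
  have : ξ ∈ (unitBumps.map contL2).topologicalClosure := h ▸ Submodule.mem_top
  exact this

theorem denseRange_contL2 : DenseRange contL2 :=
  dense_contL2_unitBumps.mono (image_subset_range _ _)

/-- The function `u ↦ k(t,u)‾`, pairing with which evaluates at `t` the integral operator with
kernel `k`. -/
def kernelRow (k : C(ℝ × ℝ, ℂ)) : C(ℝ, C(ℝ, ℂ)) := (star k).curry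

@[simp] theorem kernelRow_apply (k : C(ℝ × ℝ, ℂ)) (t u : ℝ) : kernelRow k t u = star (k (t, u)) := rfl

theorem norm_contL2_kernelRow_le {k : C(ℝ × ℝ, ℂ)} {C : ℝ} (hC : 0 ≤ C)
    (h : ∀ t ∈ Icc (0 : ℝ) 1, ∀ u ∈ Icc (0 : ℝ) 1, ‖k (t, u)‖ ≤ C) {t : ℝ} (ht : t ∈ Icc (0 : ℝ) 1) :
    ‖contL2 (kernelRow k t)‖ ≤ C :=
  norm_contL2_le hC fun u hu => by simpa using h t ht u hu

/-- The function `t ↦ ∫₀¹ k(t,u) ξ(u) du`, as a continuous function. -/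
def kernelFun (k : C(ℝ × ℝ, ℂ)) (ξ : L2I) : C(ℝ, ℂ) where
  toFun t := ⟪contL2 (kernelRow k t), ξ⟫_ℂ
  continuous_toFun := (continuous_contL2.comp (kernelRow k).continuous).inner continuous_const

theorem kernelFun_apply (k : C(ℝ × ℝ, ℂ)) (ξ : L2I) (t : ℝ) :
    kernelFun k ξ t = ∫ u in Icc (0 : ℝ) 1, k (t, u) * ξ u := by
  refine (inner_contL2_left _ _).trans (integral_congr_ae (Eventually.of_forall fun u => ?_))
  simp [mul_comm]

theorem norm_kernelFun_le {k : C(ℝ × ℝ, ℂ)} {C : ℝ} (hC : 0 ≤ C)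
    (h : ∀ t ∈ Icc (0 : ℝ) 1, ∀ u ∈ Icc (0 : ℝ) 1, ‖k (t, u)‖ ≤ C) (ξ : L2I) {t : ℝ}
    (ht : t ∈ Icc (0 : ℝ) 1) : ‖kernelFun k ξ t‖ ≤ C * ‖ξ‖ :=
  (norm_inner_le_norm _ _).trans
    (mul_le_mul_of_nonneg_right (norm_contL2_kernelRow_le hC h ht) (norm_nonneg _))

theorem exists_kernel_bound (k : C(ℝ × ℝ, ℂ)) :
    ∃ C, 0 ≤ C ∧ ∀ t ∈ Icc (0 : ℝ) 1, ∀ u ∈ Icc (0 : ℝ) 1, ‖k (t, u)‖ ≤ C := by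
  obtain ⟨C, hC⟩ := ((isCompact_Icc (a := (0 : ℝ)) (b := 1)).prod
    (isCompact_Icc (a := (0 : ℝ)) (b := 1))).exists_bound_of_continuousOn k.continuous.continuousOn
  exact ⟨max C 0, le_max_right _ _, fun t ht u hu => (hC (t, u) ⟨ht, hu⟩).trans (le_max_left _ _)⟩

/-- The integral operator on `L²([0,1])` with a continuous kernel `k`. -/
def kernelOp (k : C(ℝ × ℝ, ℂ)) : L2I →L[ℂ] L2I :=
  LinearMap.mkContinuousOfExistsBound
    { toFun := fun ξ => contL2 (kernelFun k ξ)
      map_add' := fun ξ η => by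
        rw [← map_add]
        congr 1
        ext t
        exact inner_add_right (contL2 (kernelRow k t)) ξ η
      map_smul' := fun c ξ => by
        rw [← map_smul]
        congr 1
        ext t
        exact inner_smul_right (contL2 (kernelRow k t)) ξ c } <| by
    obtain ⟨C, hC, h⟩ := exists_kernel_bound k
    exact ⟨C, fun ξ => norm_contL2_le (by positivity) fun t ht => norm_kernelFun_le hC h ξ ht⟩

theorem kernelOp_apply (k : C(ℝ × ℝ, ℂ)) (ξ : L2I) : kernelOp k ξ = contL2 (kernelFun k ξ) := rfl

theorem norm_kernelOp_le {k : C(ℝ × ℝ, ℂ)} {C : ℝ} (hC : 0 ≤ C)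
    (h : ∀ t ∈ Icc (0 : ℝ) 1, ∀ u ∈ Icc (0 : ℝ) 1, ‖k (t, u)‖ ≤ C) : ‖kernelOp k‖ ≤ C :=
  ContinuousLinearMap.opNorm_le_bound _ hC fun ξ =>
    norm_contL2_le (by positivity) fun _ ht => norm_kernelFun_le hC h ξ ht

theorem kernelOp_add (k l : C(ℝ × ℝ, ℂ)) : kernelOp (k + l) = kernelOp k + kernelOp l := by
  ext1 ξ
  rw [add_apply, kernelOp_apply, kernelOp_apply, kernelOp_apply, ← map_add]
  congr 1
  ext t
  change ⟪contL2 (kernelRow (k + l) t), ξ⟫_ℂ = _ + _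
  rw [show kernelRow (k + l) t = kernelRow k t + kernelRow l t by ext u; simp, map_add,
    inner_add_left]
  rfl

theorem kernelOp_smul (c : ℂ) (k : C(ℝ × ℝ, ℂ)) : kernelOp (c • k) = c • kernelOp k := by
  ext1 ξ
  rw [smul_apply, kernelOp_apply, kernelOp_apply, ← map_smul]
  congr 1
  ext t
  change ⟪contL2 (kernelRow (c • k) t), ξ⟫_ℂ = c * _
  rw [show kernelRow (c • k) t = star c • kernelRow k t by ext u; simp, map_smul,
    inner_smul_left]
  simp only [starRingEnd_apply, star_star]
  rfl

/-- The operator norm of an integral operator depends continuously on its kernel. -/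
theorem continuous_kernelOp : Continuous kernelOp := by
  rw [continuous_iff_continuousAt]
  intro k
  rw [ContinuousAt, tendsto_iff_norm_sub_tendsto_zero, Metric.tendsto_nhds]
  intro ε hε
  have h := ContinuousMap.tendsto_iff_forall_isCompact_tendstoUniformlyOn.1
    (tendsto_id (x := 𝓝 k)) _ ((isCompact_Icc (a := (0 : ℝ)) (b := 1)).prod
      (isCompact_Icc (a := (0 : ℝ)) (b := 1)))
  filter_upwards [Metric.tendstoUniformlyOn_iff.1 h (ε / 2) (by linarith)] with l hl
  have hsub : kernelOp l - kernelOp k = kernelOp (l + (-1 : ℂ) • k) := by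
    rw [kernelOp_add, kernelOp_smul]
    module
  rw [Real.dist_0_eq_abs, abs_of_nonneg (norm_nonneg _), hsub]
  refine (norm_kernelOp_le (by linarith) fun t ht u hu => ?_).trans_lt (half_lt_self hε)
  have := (hl (t, u) ⟨ht, hu⟩).le
  rw [dist_eq_norm'] at this
  simpa [← sub_eq_add_neg] using this

theorem kernelFun_contL2 (k : C(ℝ × ℝ, ℂ)) (f : C(ℝ, ℂ)) (t : ℝ) :
    kernelFun k (contL2 f) t = ∫ u in Icc (0 : ℝ) 1, k (t, u) * f u := by
  refine (inner_contL2 _ _).trans (integral_congr_ae (Eventually.of_forall fun u => ?_))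
  simp [mul_comm]

/-- The kernel `(t,u) ↦ k(u,t)‾` of the adjoint operator. -/
def adjointKernel (k : C(ℝ × ℝ, ℂ)) : C(ℝ × ℝ, ℂ) := star (k.comp .prodSwap)

@[simp] theorem adjointKernel_apply (k : C(ℝ × ℝ, ℂ)) (t u : ℝ) :
    adjointKernel k (t, u) = star (k (u, t)) := rfl

theorem inner_kernelOp_contL2 (k : C(ℝ × ℝ, ℂ)) (f g : C(ℝ, ℂ)) :
    ⟪contL2 f, kernelOp k (contL2 g)⟫_ℂ =
      ∫ t in Icc (0 : ℝ) 1, ∫ u in Icc (0 : ℝ) 1, k (t, u) * g u * star (f t) := by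
  rw [kernelOp_apply, inner_contL2]
  refine integral_congr_ae (Eventually.of_forall fun t => ?_)
  simp only
  rw [kernelFun_contL2, ← integral_mul_const]

theorem integral_integral_swap_Icc {F : ℝ → ℝ → ℂ} (hF : Continuous (uncurry F)) :
    ∫ t in Icc (0 : ℝ) 1, ∫ u in Icc (0 : ℝ) 1, F t u =
      ∫ u in Icc (0 : ℝ) 1, ∫ t in Icc (0 : ℝ) 1, F t u := by
  refine integral_integral_swap ?_
  rw [Measure.prod_restrict]
  exact hF.continuousOn.integrableOn_compact (isCompact_Icc.prod isCompact_Icc)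

theorem kernelOp_adjointKernel (k : C(ℝ × ℝ, ℂ)) : kernelOp (adjointKernel k) = star (kernelOp k) := by
  rw [ContinuousLinearMap.star_eq_adjoint, ContinuousLinearMap.eq_adjoint_iff]
  intro ξ η
  refine denseRange_contL2.induction_on₂
    (p := fun ξ η => ⟪kernelOp (adjointKernel k) ξ, η⟫_ℂ = ⟪ξ, kernelOp k η⟫_ℂ)
    (isClosed_eq (by fun_prop) (by fun_prop)) (fun f g => ?_) ξ η
  rw [← inner_conj_symm, inner_kernelOp_contL2, inner_kernelOp_contL2, ← integral_conj,
    integral_integral_swap_Icc (by fun_prop)]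
  refine integral_congr_ae (Eventually.of_forall fun t => ?_)
  simp only [← integral_conj]
  refine integral_congr_ae (Eventually.of_forall fun u => ?_)
  simp only [adjointKernel_apply, map_mul, starRingEnd_apply, star_star]
  ring

/-- Operators are composed by convolution of their kernels. -/
theorem kernelOp_mul {k l m : C(ℝ × ℝ, ℂ)} (h : ∀ t ∈ Icc (0 : ℝ) 1, ∀ u ∈ Icc (0 : ℝ) 1,
    m (t, u) = ∫ v in Icc (0 : ℝ) 1, k (t, v) * l (v, u)) :
    kernelOp m = kernelOp k * kernelOp l := by
  ext1 ξ
  refine Lp.ext ?_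
  rw [mul_apply_eq_comp, kernelOp_apply, kernelOp_apply k]
  filter_upwards [coeFn_contL2 (kernelFun m ξ), coeFn_contL2 (kernelFun k (kernelOp l ξ)),
    ae_restrict_mem measurableSet_Icc] with t h1 h2 ht
  rw [h1, h2]
  change ⟪contL2 (kernelRow m t), ξ⟫_ℂ = ⟪contL2 (kernelRow k t), kernelOp l ξ⟫_ℂ
  rw [← ContinuousLinearMap.adjoint_inner_left, ← ContinuousLinearMap.star_eq_adjoint,
    ← kernelOp_adjointKernel, kernelOp_apply]
  congr 1
  refine Lp.ext ?_
  filter_upwards [coeFn_contL2 (kernelRow m t),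
    coeFn_contL2 (kernelFun (adjointKernel l) (contL2 (kernelRow k t))),
    ae_restrict_mem measurableSet_Icc] with u h1 h2 hu
  rw [h1, h2, kernelFun_contL2, kernelRow_apply, h t ht u hu, ← starRingEnd_apply, ← integral_conj]
  refine integral_congr_ae (Eventually.of_forall fun v => ?_)
  simp [mul_comm]

theorem isCompactOperator_rankOne {H : Type*} [NormedAddCommGroup H] [InnerProductSpace ℂ H]
    (ξ η : H) : IsCompactOperator (InnerProductSpace.rankOne ℂ ξ η) := by
  have h : IsCompactOperator (ContinuousLinearMap.toSpanSingleton ℂ ξ) :=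
    (isCompactOperator_id_iff_locallyCompactSpace.2 inferInstance : IsCompactOperator (id : ℂ → ℂ)).clm_comp
      (ContinuousLinearMap.toSpanSingleton ℂ ξ)
  exact h.comp_clm (innerSL ℂ η)

/-- The integral operator is approximated in norm by the finite rank operators that arise from the
Bernstein approximations of the rows of its kernel, which are vectors of `L²([0,1])`. -/
theorem isCompactOperator_kernelOp (k : C(ℝ × ℝ, ℂ)) : IsCompactOperator (kernelOp k) := by
  let e : C(unitInterval, L2I) := ⟨fun t => contL2 (kernelRow k t),
    continuous_contL2.comp ((kernelRow k).continuous.comp continuous_subtype_val)⟩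
  let b (N : ℕ) (i : Fin (N + 1)) : C(ℝ, ℂ) :=
    ⟨fun t => ((bernstein N i (projIcc 0 1 zero_le_one t) : ℝ) : ℂ),
      Complex.continuous_ofReal.comp ((bernstein N i).continuous.comp continuous_projIcc)⟩
  let F (N : ℕ) : L2I →L[ℂ] L2I :=
    ∑ i : Fin (N + 1), InnerProductSpace.rankOne ℂ (contL2 (b N i)) (e (bernstein.z i))
  have hF (N : ℕ) : F N ∈ compactOperators L2I :=
    sum_mem fun i _ => isCompactOperator_rankOne _ _
  have hlim : Tendsto F atTop (𝓝 (kernelOp k)) := by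
    rw [tendsto_iff_norm_sub_tendsto_zero]
    have h := tendsto_iff_norm_sub_tendsto_zero.1 (bernsteinApproximation_uniform e)
    refine squeeze_zero (fun _ => norm_nonneg _) (fun N => ?_) h
    refine ContinuousLinearMap.opNorm_le_bound _ (norm_nonneg _) fun ξ => ?_
    let g : C(ℝ, ℂ) := ∑ i : Fin (N + 1), ⟪e (bernstein.z i), ξ⟫_ℂ • b N i
    have hg : F N ξ - kernelOp k ξ = contL2 (g - kernelFun k ξ) := by
      simp [F, g, map_sub, map_sum, kernelOp_apply]
    rw [sub_apply, hg]
    refine norm_contL2_le (by positivity) fun t ht => ?_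
    have hgt : (g - kernelFun k ξ) t = ⟪(bernsteinApproximation N e - e) ⟨t, ht⟩, ξ⟫_ℂ := by
      simp [g, b, e, kernelFun, bernsteinApproximation.apply, inner_sub_left, sum_inner,
        projIcc_of_mem _ ht, inner_smul_left_eq_smul, mul_comm]
    rw [hgt]
    exact (norm_inner_le_norm _ _).trans
      (mul_le_mul_of_nonneg_right (ContinuousMap.norm_coe_le_norm _ _) (norm_nonneg _))
  exact (inferInstance : IsClosed (compactOperators L2I : Set (L2I →L[ℂ] L2I))).mem_of_tendsto hlim
    (Eventually.of_forall hF)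

/-- The kernel of a rank one operator. -/
theorem kernelOp_eq_rankOne {k : C(ℝ × ℝ, ℂ)} {f g : C(ℝ, ℂ)}
    (h : ∀ t ∈ Icc (0 : ℝ) 1, ∀ u ∈ Icc (0 : ℝ) 1, k (t, u) = f t * star (g u)) :
    kernelOp k = InnerProductSpace.rankOne ℂ (contL2 f) (contL2 g) := by
  ext1 ξ
  refine Lp.ext ?_
  rw [InnerProductSpace.rankOne_apply, kernelOp_apply, inner_contL2_left]
  filter_upwards [coeFn_contL2 (kernelFun k ξ), coeFn_contL2 f,
    Lp.coeFn_smul (∫ t in Icc (0 : ℝ) 1, ξ t * star (g t)) (contL2 f),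
    ae_restrict_mem measurableSet_Icc] with t h1 h2 h3 ht
  rw [h1, h3, Pi.smul_apply, h2, kernelFun_apply, smul_eq_mul, ← integral_mul_const]
  refine setIntegral_congr_fun measurableSet_Icc fun u hu => ?_
  simp only [h t ht u hu]
  ring

end Kernel

/-! ### Integrated forms of covariant representations -/

section Covariant

variable {X : Type*} [TopologicalSpace X] [CompactSpace X] [T2Space X]
  {H : Type*} [NormedAddCommGroup H] [InnerProductSpace ℂ H] [CompleteSpace H]

/-- A covariant representation of the flow `φ`: the operators `U s` form a strongly continuous
unitary representation of `ℝ` that implements the action of `φ` on `C(X)`. -/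
structure IsCovariant (φ : Flow ℝ X) (M : C(X, ℂ) →⋆ₙₐ[ℂ] (H →L[ℂ] H)) (U : ℝ → H →L[ℂ] H) :
    Prop where
  continuous : ∀ ξ, Continuous fun s => U s ξ
  map_add : ∀ s t, U (s + t) = U s * U t
  star_eq : ∀ s, star (U s) = U (-s)
  norm_le : ∀ s ξ, ‖U s ξ‖ ≤ ‖ξ‖
  covariant : ∀ s f, U s * M f = M (φ.act s f) * U s

namespace IsCovariant

variable {φ : Flow ℝ X} {M : C(X, ℂ) →⋆ₙₐ[ℂ] (H →L[ℂ] H)} {U : ℝ → H →L[ℂ] H}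
  (h : IsCovariant φ M U)
include h

theorem continuous_integrand {Y : Type*} [TopologicalSpace Y] {f : Y → C(X, ℂ)} {s : Y → ℝ}
    (hf : Continuous f) (hs : Continuous s) (ξ : H) : Continuous fun y => M (f y) (U (s y) ξ) := by
  have hM : Continuous M := AddMonoidHomClass.continuous_of_bound M 1 fun a => by
    simpa using NonUnitalStarAlgHom.norm_apply_le M a
  exact (hM.comp hf).clm_apply ((h.continuous ξ).comp hs)

theorem integrable (a : ConvAlg φ) (ξ : H) : Integrable fun s => M (a s) (U s ξ) := by
  refine (h.continuous_integrand a.continuous continuous_id ξ).integrable_of_hasCompactSupport ?_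
  refine a.hasCompactSupport.mono fun s hs => ?_
  contrapose! hs
  simp only [mem_support, not_not] at hs ⊢
  simp [hs]

theorem norm_integrand_le (a : ConvAlg φ) (s : ℝ) (ξ : H) :
    ‖M (a s) (U s ξ)‖ ≤ ‖a s‖ * ‖ξ‖ :=
  ((M (a s)).le_opNorm _).trans (mul_le_mul (NonUnitalStarAlgHom.norm_apply_le M _)
    (h.norm_le s ξ) (norm_nonneg _) (norm_nonneg _))

theorem norm_integral_le (a : ConvAlg φ) (ξ : H) :
    ‖∫ s, M (a s) (U s ξ)‖ ≤ a.l1Norm * ‖ξ‖ := by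
  refine (norm_integral_le_of_norm_le (a.integrable_norm.mul_const ‖ξ‖)
    (Eventually.of_forall fun s => h.norm_integrand_le a s ξ)).trans_eq ?_
  rw [integral_mul_const]
  rfl

/-- The operator `∫ M(a(s)) U(s) ds`. -/
def integratedOp (a : ConvAlg φ) : H →L[ℂ] H :=
  LinearMap.mkContinuous
    { toFun := fun ξ => ∫ s, M (a s) (U s ξ)
      map_add' := fun ξ η => by
        rw [← integral_add (h.integrable a ξ) (h.integrable a η)]
        simp
      map_smul' := fun c ξ => by
        rw [RingHom.id_apply, ← integral_smul]
        simp } a.l1Norm (h.norm_integral_le a)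

theorem integratedOp_apply (a : ConvAlg φ) (ξ : H) :
    h.integratedOp a ξ = ∫ s, M (a s) (U s ξ) := rfl

theorem integratedOp_mul (a b : ConvAlg φ) :
    h.integratedOp (a * b) = h.integratedOp a * h.integratedOp b := by
  have hcov (s : ℝ) (f : C(X, ℂ)) (ξ : H) : U s (M f ξ) = M (φ.act s f) (U s ξ) :=
    DFunLike.congr_fun (h.covariant s f) ξ
  ext1 ξ
  have h1 (s : ℝ) : M ((a * b) s) (U s ξ) = ∫ r, M (a r) (M (φ.act r (b (s - r))) (U s ξ)) := by
    let L : C(X, ℂ) →L[ℂ] H := LinearMap.mkContinuous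
      { toFun := fun f => M f (U s ξ), map_add' := by simp, map_smul' := by simp } ‖U s ξ‖
      fun f => ((M f).le_opNorm _).trans (by
        rw [mul_comm]
        exact mul_le_mul_of_nonneg_left (NonUnitalStarAlgHom.norm_apply_le M f) (norm_nonneg _))
    have := (L.integral_comp_comm (ConvAlg.integrable_integrand a b s)).symm
    refine (Eq.trans ?_ this).trans ?_
    · rfl
    · simp [L]
  rw [mul_apply_eq_comp, integratedOp_apply, integratedOp_apply]
  simp only [h1]
  rw [integral_integral_swap_of_hasCompactSupport
    (f := fun s r => M (a r) (M (φ.act r (b (s - r))) (U s ξ)))]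
  · refine integral_congr_ae (Eventually.of_forall fun r => ?_)
    have h2 : M (a r) (U r (h.integratedOp b ξ)) = ∫ s, M (a r) (U r (M (b s) (U s ξ))) :=
      ((M (a r) * U r).integral_comp_comm (h.integrable b ξ)).symm
    simp only
    rw [h2, ← integral_sub_right_eq_self (fun s => M (a r) (U r (M (b s) (U s ξ)))) r]
    refine integral_congr_ae (Eventually.of_forall fun s => ?_)
    simp only
    rw [hcov, ← mul_apply_eq_comp (U r), ← h.map_add, add_sub_cancel]
  · have hcont := h.continuous_integrand (Y := ℝ × ℝ)
      (f := fun p => a p.2 * φ.act p.2 (b (p.1 - p.2))) (ConvAlg.continuous_integrand a b)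
      continuous_fst ξ
    convert! hcont using 2 with p
    rw [map_mul]
    rfl
  · refine HasCompactSupport.intro ((a.hasCompactSupport.isCompact.add
      b.hasCompactSupport.isCompact).prod a.hasCompactSupport.isCompact) fun p hp => ?_
    obtain ⟨s, r⟩ := p
    simp only [uncurry_apply_pair]
    by_cases hr : r ∈ tsupport a
    · have hs : s - r ∉ tsupport b := fun hb => hp ⟨⟨r, hr, s - r, hb, by simp⟩, hr⟩
      have h0 : b (s - r) = 0 := image_eq_zero_of_notMem_tsupport hs
      have h1 : φ.act r (b (s - r)) = 0 := by
        rw [h0]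
        rfl
      simp [h1]
    · simp [image_eq_zero_of_notMem_tsupport hr]

theorem integratedOp_star (a : ConvAlg φ) : h.integratedOp (star a) = star (h.integratedOp a) := by
  rw [ContinuousLinearMap.star_eq_adjoint, ContinuousLinearMap.eq_adjoint_iff]
  intro ξ η
  rw [integratedOp_apply, integratedOp_apply, ← integral_inner (h.integrable a η),
    ← inner_conj_symm, ← integral_inner (h.integrable (star a) ξ), ← integral_conj,
    ← integral_neg_eq_self]
  refine integral_congr_ae (Eventually.of_forall fun s => ?_)
  have h1 : star a (-s) = φ.act (-s) (star (a s)) := by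
    change φ.act (-s) (star (a (- -s))) = _
    rw [neg_neg]
  simp only [inner_conj_symm]
  rw [h1, ← mul_apply_eq_comp, ← h.covariant, map_star, ← h.star_eq, ← star_mul,
    ContinuousLinearMap.star_eq_adjoint, ContinuousLinearMap.adjoint_inner_left]
  rfl

/-- The integrated form of a covariant representation. -/
def integratedForm : ConvAlg φ →⋆ₙₐ[ℂ] (H →L[ℂ] H) where
  toFun := h.integratedOp
  map_smul' c a := by
    ext1 ξ
    simp only [smul_apply, integratedOp_apply, MonoidHom.id_apply]
    rw [← integral_smul]
    simp
  map_zero' := by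
    ext1 ξ
    simp [integratedOp_apply]
  map_add' a b := by
    ext1 ξ
    rw [add_apply, integratedOp_apply, integratedOp_apply, integratedOp_apply,
      ← integral_add (h.integrable a ξ) (h.integrable b ξ)]
    simp
  map_mul' := h.integratedOp_mul
  map_star' := h.integratedOp_star

theorem norm_integratedForm_le (a : ConvAlg φ) : ‖h.integratedForm a‖ ≤ a.l1Norm :=
  LinearMap.mkContinuous_norm_le _ a.l1Norm_nonneg (h.norm_integral_le a)

end IsCovariant

end Covariant

/-! ### The regular representations -/

section Regular

variable {X : Type*} [TopologicalSpace X] [CompactSpace X] [T2Space X]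

/-- The Hilbert space `L²(ℝ)`. -/
abbrev L2R : Type := Lp ℂ 2 (volume : Measure ℝ)

/-- Translation by `s` on `L²(ℝ)`. -/
def translationOp (s : ℝ) : L2R →L[ℂ] L2R :=
  (Lp.compMeasurePreservingₗᵢ ℂ (fun t => t - s)
    (measurePreserving_sub_right volume s)).toContinuousLinearMap

theorem coeFn_translationOp (s : ℝ) (ξ : L2R) : translationOp s ξ =ᵐ[volume] fun t => ξ (t - s) :=
  Lp.coeFn_compMeasurePreserving ξ (measurePreserving_sub_right volume s)

theorem memLp_orbit_mul (φ : Flow ℝ X) (y : X) (f : C(X, ℂ)) (ξ : L2R) :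
    MemLp (fun t => f (φ t y) * ξ t) 2 volume := by
  have hc : Continuous fun t => f (φ t y) :=
    f.continuous.comp (φ.cont'.comp (continuous_id.prodMk continuous_const))
  refine MemLp.of_le_mul (c := ‖f‖) (Lp.memLp ξ)
    (hc.aestronglyMeasurable.mul (Lp.aestronglyMeasurable ξ)) (Eventually.of_forall fun t => ?_)
  rw [norm_mul]
  exact mul_le_mul_of_nonneg_right (f.norm_coe_le_norm _) (norm_nonneg _)

theorem norm_orbit_mul_le (φ : Flow ℝ X) (y : X) (f : C(X, ℂ)) (ξ : L2R) :
    ‖(memLp_orbit_mul φ y f ξ).toLp‖ ≤ ‖f‖ * ‖ξ‖ := by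
  refine Lp.norm_le_mul_norm_of_ae_le_mul ?_
  filter_upwards [(memLp_orbit_mul φ y f ξ).coeFn_toLp] with t ht
  rw [ht, norm_mul]
  exact mul_le_mul_of_nonneg_right (f.norm_coe_le_norm _) (norm_nonneg _)

/-- Multiplication on `L²(ℝ)` by the values of `f` along the orbit of `y`. -/
def orbitMulOp (φ : Flow ℝ X) (y : X) (f : C(X, ℂ)) : L2R →L[ℂ] L2R :=
  LinearMap.mkContinuous
    { toFun := fun ξ => (memLp_orbit_mul φ y f ξ).toLp
      map_add' := fun ξ η => by
        rw [← MemLp.toLp_add]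
        refine MemLp.toLp_congr _ _ ?_
        filter_upwards [Lp.coeFn_add ξ η] with t ht
        rw [ht]
        exact mul_add _ _ _
      map_smul' := fun c ξ => by
        rw [RingHom.id_apply, ← MemLp.toLp_const_smul]
        refine MemLp.toLp_congr _ _ ?_
        filter_upwards [Lp.coeFn_smul c ξ] with t ht
        rw [ht]
        exact mul_left_comm _ _ _ } ‖f‖ (norm_orbit_mul_le φ y f)

theorem coeFn_orbitMulOp (φ : Flow ℝ X) (y : X) (f : C(X, ℂ)) (ξ : L2R) :
    orbitMulOp φ y f ξ =ᵐ[volume] fun t => f (φ t y) * ξ t :=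
  (memLp_orbit_mul φ y f ξ).coeFn_toLp

/-- The representation of `C(X)` on `L²(ℝ)` by multiplication along the orbit of `y`. -/
def orbitMul (φ : Flow ℝ X) (y : X) : C(X, ℂ) →⋆ₙₐ[ℂ] (L2R →L[ℂ] L2R) where
  toFun := orbitMulOp φ y
  map_smul' c f := by
    ext1 ξ
    refine Lp.ext ?_
    filter_upwards [coeFn_orbitMulOp φ y (c • f) ξ, coeFn_orbitMulOp φ y f ξ,
      Lp.coeFn_smul c (orbitMulOp φ y f ξ)] with t h1 h2 h3
    rw [h1]
    refine Eq.trans ?_ h3.symm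
    rw [Pi.smul_apply, h2]
    exact mul_assoc _ _ _
  map_zero' := by
    ext1 ξ
    refine Lp.ext ?_
    filter_upwards [coeFn_orbitMulOp φ y 0 ξ, Lp.coeFn_zero ℂ 2 (volume : Measure ℝ)] with t h1 h2
    rw [h1]
    refine Eq.trans ?_ h2.symm
    exact zero_mul _
  map_add' f g := by
    ext1 ξ
    refine Lp.ext ?_
    filter_upwards [coeFn_orbitMulOp φ y (f + g) ξ, coeFn_orbitMulOp φ y f ξ,
      coeFn_orbitMulOp φ y g ξ, Lp.coeFn_add (orbitMulOp φ y f ξ) (orbitMulOp φ y g ξ)]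
      with t h1 h2 h3 h4
    rw [h1]
    refine Eq.trans ?_ h4.symm
    rw [Pi.add_apply, h2, h3]
    exact add_mul _ _ _
  map_mul' f g := by
    ext1 ξ
    refine Lp.ext ?_
    filter_upwards [coeFn_orbitMulOp φ y (f * g) ξ, coeFn_orbitMulOp φ y g ξ,
      coeFn_orbitMulOp φ y f (orbitMulOp φ y g ξ)] with t h1 h2 h3
    rw [h1, mul_apply_eq_comp, h3, h2]
    exact mul_assoc _ _ _
  map_star' f := by
    rw [ContinuousLinearMap.star_eq_adjoint, ContinuousLinearMap.eq_adjoint_iff]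
    intro ξ η
    rw [L2.inner_def, L2.inner_def]
    refine integral_congr_ae ?_
    filter_upwards [coeFn_orbitMulOp φ y (star f) ξ, coeFn_orbitMulOp φ y f η] with t h1 h2
    rw [h1, h2]
    simp
    ring

theorem isCovariant_orbitMul (φ : Flow ℝ X) (y : X) :
    IsCovariant φ (orbitMul φ y) translationOp where
  continuous ξ := by
    have h : Continuous fun s : ℝ => (⟨fun t => t - s, by fun_prop⟩ : C(ℝ, ℝ)) :=
      ContinuousMap.continuous_of_continuous_uncurry _ (continuous_snd.sub continuous_fst)
    exact continuous_const.compMeasurePreservingLp h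
      (fun s => measurePreserving_sub_right volume s) (by simp)
  map_add s t := by
    ext1 ξ
    refine Lp.ext ?_
    filter_upwards [coeFn_translationOp (s + t) ξ, coeFn_translationOp s (translationOp t ξ),
      (measurePreserving_sub_right volume s).quasiMeasurePreserving.ae_eq_comp
        (coeFn_translationOp t ξ)] with r h1 h2 h3
    rw [h1, mul_apply_eq_comp, h2]
    simp only [comp_apply] at h3
    rw [h3, sub_sub]
  star_eq s := by
    symm
    rw [ContinuousLinearMap.star_eq_adjoint, ContinuousLinearMap.eq_adjoint_iff]
    intro ξ η
    rw [L2.inner_def, L2.inner_def, ← integral_sub_right_eq_self _ s]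
    refine integral_congr_ae ?_
    filter_upwards [coeFn_translationOp s η,
      (measurePreserving_sub_right volume s).quasiMeasurePreserving.ae_eq_comp
        (coeFn_translationOp (-s) ξ)] with r h1 h2
    simp only [comp_apply] at h2
    rw [h1, h2, sub_neg_eq_add, sub_add_cancel]
  norm_le s ξ := ((Lp.compMeasurePreservingₗᵢ ℂ (fun t => t - s)
    (measurePreserving_sub_right volume s)).norm_map ξ).le
  covariant s f := by
    ext1 ξ
    refine Lp.ext ?_
    rw [mul_apply_eq_comp, mul_apply_eq_comp]
    filter_upwards [coeFn_translationOp s (orbitMul φ y f ξ),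
      (measurePreserving_sub_right volume s).quasiMeasurePreserving.ae_eq_comp
        (coeFn_orbitMulOp φ y f ξ), coeFn_translationOp s ξ,
      coeFn_orbitMulOp φ y (φ.act s f) (translationOp s ξ)] with t h1 h2 h3 h4
    rw [h1]
    refine Eq.trans ?_ h4.symm
    rw [h3]
    refine h2.trans ?_
    simp only [Flow.act, ContinuousMap.comp_apply, ContinuousMap.coe_mk, comp_apply]
    rw [← φ.map_add, neg_add_eq_sub]

/-- The regular representation of `C_c(ℝ, C(X))` on `L²(ℝ)` at the orbit of `y`. -/
def regularRep (φ : Flow ℝ X) (y : X) : ConvAlg φ →⋆ₙₐ[ℂ] (L2R →L[ℂ] L2R) :=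
  (isCovariant_orbitMul φ y).integratedForm

theorem CrossedProduct.norm_of {φ : Flow ℝ X} (a : ConvAlg φ) :
    ‖CrossedProduct.of φ a‖ = sSup (ConvAlg.repNorms a) :=
  CStarSeminorm.Completion.norm_of (p := ConvAlg.universalNorm φ) a

theorem CrossedProduct.norm_of_le_l1Norm {φ : Flow ℝ X} (a : ConvAlg φ) :
    ‖CrossedProduct.of φ a‖ ≤ a.l1Norm := by
  rw [norm_of]
  refine csSup_le (ConvAlg.repNorms_nonempty a) ?_
  rintro _ ⟨H, _, _, _, ρ, hρ, rfl⟩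
  exact hρ a

theorem norm_regularRep_le (φ : Flow ℝ X) (y : X) (a : ConvAlg φ) :
    ‖regularRep φ y a‖ ≤ ‖CrossedProduct.of φ a‖ := by
  rw [CrossedProduct.norm_of]
  exact le_csSup (ConvAlg.repNorms_bddAbove a) ⟨L2R, inferInstance, inferInstance, inferInstance,
    regularRep φ y, (isCovariant_orbitMul φ y).norm_integratedForm_le, rfl⟩

theorem inner_regularRep (φ : Flow ℝ X) (y : X) (a : ConvAlg φ) (ξ η : L2R) :
    ⟪η, regularRep φ y a ξ⟫_ℂ = ∫ s, ∫ t, a s (φ t y) * ξ (t - s) * star (η t) := by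
  have h : regularRep φ y a ξ = ∫ s, orbitMul φ y (a s) (translationOp s ξ) := rfl
  rw [h, ← integral_inner ((isCovariant_orbitMul φ y).integrable a ξ)]
  refine integral_congr_ae (Eventually.of_forall fun s => ?_)
  simp only
  rw [L2.inner_def]
  refine integral_congr_ae ?_
  filter_upwards [coeFn_translationOp s ξ,
    coeFn_orbitMulOp φ y (a s) (translationOp s ξ)] with t h1 h2
  have h2' : (orbitMul φ y (a s) (translationOp s ξ)) t = a s (φ t y) * translationOp s ξ t := h2
  rw [h2', h1, RCLike.inner_apply]
  rfl

end Regular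

/-! ### Orbit breaking along a set, and kernels along orbit segments -/

section Segment

variable {X : Type*} [TopologicalSpace X] [CompactSpace X] [T2Space X] {φ : Flow ℝ X}

/-- The `*`-algebra of all `a ∈ C_c(ℝ, C(X))` that break the orbits at all points of `S`: for `y ∈ S`
it vanishes at every arrow `φᵤ(y) → φₜ(y)` with `u ≤ 0 ≤ t` or `t ≤ 0 ≤ u`. -/
def breakingAlgebra (φ : Flow ℝ X) (S : Set X) : NonUnitalStarSubalgebra ℂ (ConvAlg φ) :=
  ⨅ y : S, pointAlgebra φ y

theorem mem_breakingAlgebra {S : Set X} {a : ConvAlg φ} :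
    a ∈ breakingAlgebra φ S ↔ ∀ y ∈ S, a ∈ pointAlgebra φ y := by
  simp [breakingAlgebra, NonUnitalStarAlgebra.mem_iInf]

theorem breakingAlgebra_antitone {S S' : Set X} (h : S ⊆ S') :
    breakingAlgebra φ S' ≤ breakingAlgebra φ S := fun _ ha =>
  mem_breakingAlgebra.2 fun y hy => mem_breakingAlgebra.1 ha y (h hy)

theorem apply_eq_zero_of_mem_breakingAlgebra {S : Set X} {a : ConvAlg φ}
    (ha : a ∈ breakingAlgebra φ S) {y : X} {c t u : ℝ} (hc : φ c y ∈ S)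
    (h : (u ≤ c ∧ c ≤ t) ∨ (t ≤ c ∧ c ≤ u)) : a (t - u) (φ t y) = 0 := by
  have := mem_breakingAlgebra.1 ha _ hc (t - u) (t - c)
    (h.imp (fun h => ⟨by linarith, by linarith⟩) fun h => ⟨by linarith, by linarith⟩)
  rwa [← φ.map_add, sub_add_cancel] at this

/-- The kernel on `[0,1]²` that `a` induces along the orbit segment of length `T` starting at `y`,
whose time parameter is rescaled to `[0,1]`. -/
def segmentKernel (a : ConvAlg φ) (y : X) (T : ℝ) : C(ℝ × ℝ, ℂ) where
  toFun p := T * a (T * (p.1 - p.2)) (φ (T * p.1) y)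
  continuous_toFun := continuous_const.mul (a.continuous_uncurry.comp (Continuous.prodMk
    (by fun_prop) (φ.cont'.comp (Continuous.prodMk (by fun_prop) continuous_const))))

theorem segmentKernel_apply (a : ConvAlg φ) (y : X) (T t u : ℝ) :
    segmentKernel a y T (t, u) = T * a (T * (t - u)) (φ (T * t) y) := rfl

theorem continuous_segmentKernel (a : ConvAlg φ) {Y : Type*} [TopologicalSpace Y] {y : Y → X}
    {T : Y → ℝ} (hy : Continuous y) (hT : Continuous T) :
    Continuous fun z => segmentKernel a (y z) (T z) := by
  refine ContinuousMap.continuous_of_continuous_uncurry _ ?_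
  have hT' : Continuous fun p : Y × ℝ × ℝ => T p.1 := hT.comp continuous_fst
  have hy' : Continuous fun p : Y × ℝ × ℝ => y p.1 := hy.comp continuous_fst
  exact (Complex.continuous_ofReal.comp hT').mul (a.continuous_uncurry.comp (Continuous.prodMk
    (by fun_prop) (φ.cont'.comp (Continuous.prodMk (by fun_prop) hy'))))

theorem segmentKernel_add (a b : ConvAlg φ) (y : X) (T : ℝ) :
    segmentKernel (a + b) y T = segmentKernel a y T + segmentKernel b y T := by
  ext p
  exact mul_add _ _ _

theorem segmentKernel_smul (c : ℂ) (a : ConvAlg φ) (y : X) (T : ℝ) :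
    segmentKernel (c • a) y T = c • segmentKernel a y T := by
  ext p
  exact mul_left_comm _ _ _

theorem segmentKernel_star (a : ConvAlg φ) (y : X) (T : ℝ) :
    segmentKernel (star a) y T = adjointKernel (segmentKernel a y T) := by
  ext ⟨t, u⟩
  rw [adjointKernel_apply, segmentKernel_apply, segmentKernel_apply, ConvAlg.star_apply,
    ← φ.map_add, star_mul']
  congr 1
  · simp
  · congr 3 <;> ring

/-- If `a` breaks the orbits at both ends of the segment, then only the arrows inside the segment
contribute to the convolution product. -/
theorem segmentKernel_mul {S : Set X} {a : ConvAlg φ} (ha : a ∈ breakingAlgebra φ S) (b : ConvAlg φ)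
    {y : X} {T : ℝ} (hT : 0 < T) (hy : y ∈ S) (hTy : φ T y ∈ S) {t : ℝ} (ht : t ∈ Icc (0 : ℝ) 1)
    (u : ℝ) : segmentKernel (a * b) y T (t, u) =
      ∫ v in Icc (0 : ℝ) 1, segmentKernel a y T (t, v) * segmentKernel b y T (v, u) := by
  rw [setIntegral_eq_integral_of_forall_compl_eq_zero]
  · let F : ℝ → ℂ := fun r => a r (φ (T * t) y) * b (T * (t - u) - r) (φ (-r) (φ (T * t) y))
    have h1 : segmentKernel (a * b) y T (t, u) = T * ∫ r, F r := by
      rw [segmentKernel_apply, ConvAlg.mul_apply]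
    have h2 : ∫ v, F (T * (t - v)) = (T⁻¹ : ℝ) • ∫ r, F r := by
      rw [integral_sub_left_eq_self (fun w => F (T * w)), Measure.integral_comp_mul_left,
        abs_of_pos (inv_pos.2 hT)]
    have hT0 : (T : ℂ) ≠ 0 := by exact_mod_cast hT.ne'
    have h3 : ∀ v, segmentKernel a y T (t, v) * segmentKernel b y T (v, u) =
        (T * T : ℂ) * F (T * (t - v)) := fun v => by
      simp only [F, segmentKernel_apply]
      rw [← φ.map_add, show -(T * (t - v)) + T * t = T * v by ring,
        show T * (t - u) - T * (t - v) = T * (v - u) by ring]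
      ring
    simp only [h3]
    rw [integral_const_mul, h2, h1, Complex.real_smul]
    push_cast
    field_simp
  · intro v hv
    have h0 : a (T * t - T * v) (φ (T * t) y) = 0 := by
      rw [mem_Icc, not_and_or, not_le, not_le] at hv
      rcases hv with hv | hv
      · refine apply_eq_zero_of_mem_breakingAlgebra ha (c := 0) (by simpa using hy) (Or.inl ?_)
        exact ⟨by nlinarith, by nlinarith [ht.1]⟩
      · refine apply_eq_zero_of_mem_breakingAlgebra ha hTy (Or.inr ?_)
        exact ⟨by nlinarith [ht.2], by nlinarith⟩
    rw [segmentKernel_apply, mul_sub, h0]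
    simp

/-! ### The regular representation bounds the segment operators -/

/-- The isometry that embeds `L²([0,1])` into `L²(ℝ)` as `L²([0,T])`. -/
def segmentEmbedding {T : ℝ} (hT : 0 < T) (ξ : L2I) : L2R := (eLpNorm_towerFun one_pos hT 0 ξ).1.toLp

theorem norm_segmentEmbedding {T : ℝ} (hT : 0 < T) (ξ : L2I) : ‖segmentEmbedding hT ξ‖ = ‖ξ‖ := by
  rw [segmentEmbedding, Lp.norm_toLp, (eLpNorm_towerFun one_pos hT 0 ξ).2, Lp.norm_def]

theorem coeFn_segmentEmbedding {T : ℝ} (hT : 0 < T) {f : C(ℝ, ℂ)} (hf : f ∈ unitBumps) :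
    segmentEmbedding hT (contL2 f) =ᵐ[volume] fun t => (√(1 / T) : ℂ) * f (t / T) := by
  filter_upwards [(eLpNorm_towerFun one_pos hT 0 (contL2 f)).1.coeFn_toLp,
    towerFun_congr one_pos hT 0 (coeFn_contL2 f)] with t h1 h2
  refine (h1.trans h2).trans ?_
  rw [towerFun_eq one_pos hT]
  simp only [one_mul, sub_zero]
  congr 1
  by_cases h : t / T ∈ Icc (0 : ℝ) 1
  · rw [indicator_of_mem h]
  · rw [indicator_of_notMem h, hf _ fun h' => h (Ioo_subset_Icc_self h')]

theorem inner_regularRep_segmentEmbedding (a : ConvAlg φ) (y : X) {T : ℝ} (hT : 0 < T)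
    {f g : C(ℝ, ℂ)} (hf : f ∈ unitBumps) (hg : g ∈ unitBumps) :
    ⟪segmentEmbedding hT (contL2 f), regularRep φ y a (segmentEmbedding hT (contL2 g))⟫_ℂ =
      ⟪contL2 f, kernelOp (segmentKernel a y T) (contL2 g)⟫_ℂ := by
  have hT0 : (T : ℂ) ≠ 0 := by exact_mod_cast hT.ne'
  have hsq : (√(1 / T) : ℂ) * √(1 / T) = (T : ℂ)⁻¹ := by
    rw [← Complex.ofReal_mul, Real.mul_self_sqrt (by positivity)]
    simp
  have hfc : HasCompactSupport f := HasCompactSupport.intro isCompact_Icc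
    fun t ht => hf t fun h => ht (Ioo_subset_Icc_self h)
  let G : ℝ → ℝ → ℂ := fun t u =>
    a (t - u) (φ t y) * ((√(1 / T) : ℂ) * g (u / T)) * star ((√(1 / T) : ℂ) * f (t / T))
  have h1 : ⟪segmentEmbedding hT (contL2 f),
      regularRep φ y a (segmentEmbedding hT (contL2 g))⟫_ℂ = ∫ s, ∫ t, G t (t - s) := by
    rw [inner_regularRep]
    refine integral_congr_ae (Eventually.of_forall fun s => integral_congr_ae ?_)
    filter_upwards [coeFn_segmentEmbedding hT hf,
      (measurePreserving_sub_right volume s).quasiMeasurePreserving.ae_eq_comp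
        (coeFn_segmentEmbedding hT hg)] with t h1 h2
    simp only [comp_apply] at h2
    rw [h1, h2]
    simp only [G, sub_sub_cancel]
  have h2 : ∫ s, ∫ t, G t (t - s) = ∫ t, ∫ s, G t (t - s) := by
    refine integral_integral_swap_of_hasCompactSupport (f := fun s t => G t (t - s)) ?_ ?_
    · have hφ : Continuous fun p : ℝ × ℝ => φ p.2 y :=
        φ.cont'.comp (continuous_snd.prodMk continuous_const)
      have ha : Continuous fun p : ℝ × ℝ => a (p.2 - (p.2 - p.1)) (φ p.2 y) :=
        a.continuous_uncurry.comp (Continuous.prodMk (by fun_prop) hφ)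
      simp only [G, uncurry_def]
      exact (ha.mul (by fun_prop)).mul (by fun_prop)
    · refine HasCompactSupport.intro (a.hasCompactSupport.isCompact.prod
        (isCompact_Icc (a := (0 : ℝ)) (b := T))) fun p hp => ?_
      obtain ⟨s, t⟩ := p
      simp only [uncurry_apply_pair, G]
      rw [sub_sub_cancel]
      by_cases hs : s ∈ tsupport a
      · have ht : t ∉ Icc 0 T := fun ht => hp ⟨hs, ht⟩
        have h0 : f (t / T) = 0 := hf _ fun h =>
          ht ⟨((div_pos_iff_of_pos_right hT).1 h.1).le, ((div_lt_one hT).1 h.2).le⟩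
        simp [h0]
      · have h0 : a s = 0 := image_eq_zero_of_notMem_tsupport hs
        simp [h0]
  have h3 : ∫ t, ∫ s, G t (t - s) = (T * T : ℂ) * ∫ t, ∫ u, G (T * t) (T * u) := by
    simp only [integral_sub_left_eq_self]
    have h4 (t : ℝ) : ∫ u, G t (T * u) = (T⁻¹ : ℝ) • ∫ u, G t u := by
      rw [Measure.integral_comp_mul_left, abs_of_pos (inv_pos.2 hT)]
    simp only [h4, integral_smul]
    rw [Measure.integral_comp_mul_left (fun t => ∫ u, G t u), abs_of_pos (inv_pos.2 hT),
      Complex.real_smul, Complex.real_smul]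
    push_cast
    field_simp
  have hG (t u : ℝ) : (T * T : ℂ) * G (T * t) (T * u) =
      segmentKernel a y T (t, u) * g u * star (f t) := by
    simp only [G, segmentKernel_apply]
    rw [← mul_sub, mul_div_cancel_left₀ _ hT.ne', mul_div_cancel_left₀ _ hT.ne', star_mul',
      show star (√(1 / T) : ℂ) = √(1 / T) from Complex.conj_ofReal _]
    calc _ = ((√(1 / T) : ℂ) * √(1 / T)) * T * (T * a (T * (t - u)) (φ (T * t) y) * g u * star (f t))
          := by ring
      _ = _ := by rw [hsq, inv_mul_cancel₀ hT0, one_mul]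
  rw [h1, h2, h3, inner_kernelOp_contL2, ← integral_const_mul]
  simp only [← integral_const_mul, hG]
  rw [setIntegral_eq_integral_of_forall_compl_eq_zero]
  · refine integral_congr_ae (Eventually.of_forall fun t => ?_)
    simp only
    rw [setIntegral_eq_integral_of_forall_compl_eq_zero]
    intro u hu
    rw [hg _ fun h => hu (Ioo_subset_Icc_self h)]
    simp
  · intro t ht
    rw [hf _ fun h => ht (Ioo_subset_Icc_self h)]
    simp

theorem opNorm_le_of_forall_unitBumps {K : L2I →L[ℂ] L2I} {C : ℝ} (hC : 0 ≤ C)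
    (h : ∀ f ∈ unitBumps, ∀ g ∈ unitBumps,
      ‖⟪contL2 f, K (contL2 g)⟫_ℂ‖ ≤ C * ‖contL2 f‖ * ‖contL2 g‖) : ‖K‖ ≤ C := by
  have hd : DenseRange fun f : unitBumps => contL2 f := by
    have := dense_contL2_unitBumps
    rwa [image_eq_range] at this
  have key (ξ η : L2I) : ‖⟪ξ, K η⟫_ℂ‖ ≤ C * ‖ξ‖ * ‖η‖ :=
    hd.induction_on₂ (p := fun ξ η => ‖⟪ξ, K η⟫_ℂ‖ ≤ C * ‖ξ‖ * ‖η‖)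
      (isClosed_le (by fun_prop) (by fun_prop)) (fun f g => h f f.2 g g.2) ξ η
  refine ContinuousLinearMap.opNorm_le_bound _ hC fun η => ?_
  have h1 := key (K η) η
  rw [inner_self_eq_norm_sq_to_K] at h1
  have h2 : ‖K η‖ ^ 2 ≤ C * ‖K η‖ * ‖η‖ := by simpa using h1
  rcases (norm_nonneg (K η)).eq_or_lt with h0 | h0
  · rw [← h0]
    positivity
  · nlinarith

theorem norm_kernelOp_segmentKernel_le (a : ConvAlg φ) (y : X) {T : ℝ} (hT : 0 < T) :
    ‖kernelOp (segmentKernel a y T)‖ ≤ ‖CrossedProduct.of φ a‖ := by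
  refine (opNorm_le_of_forall_unitBumps (norm_nonneg (regularRep φ y a))
    fun f hf g hg => ?_).trans (norm_regularRep_le φ y a)
  rw [← inner_regularRep_segmentEmbedding a y hT hf hg]
  refine (norm_inner_le_norm _ _).trans ?_
  have := (regularRep φ y a).le_opNorm (segmentEmbedding hT (contL2 g))
  rw [norm_segmentEmbedding] at this ⊢
  calc _ ≤ ‖contL2 f‖ * (‖regularRep φ y a‖ * ‖contL2 g‖) :=
        mul_le_mul_of_nonneg_left this (norm_nonneg _)
    _ = _ := by ring

end Segment

/-! ### The slice representations -/

section SliceRep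

/-- The integral operator with kernel `k`, as a compact operator. -/
def compactKernelOp (k : C(ℝ × ℝ, ℂ)) : compactOperators L2I :=
  ⟨kernelOp k, isCompactOperator_kernelOp k⟩

theorem continuous_compactKernelOp : Continuous compactKernelOp :=
  continuous_kernelOp.subtype_mk _

theorem compactKernelOp_add (k l : C(ℝ × ℝ, ℂ)) :
    compactKernelOp (k + l) = compactKernelOp k + compactKernelOp l :=
  Subtype.ext (kernelOp_add k l)

theorem compactKernelOp_smul (c : ℂ) (k : C(ℝ × ℝ, ℂ)) :
    compactKernelOp (c • k) = c • compactKernelOp k :=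
  Subtype.ext (kernelOp_smul c k)

theorem compactKernelOp_adjointKernel (k : C(ℝ × ℝ, ℂ)) :
    compactKernelOp (adjointKernel k) = star (compactKernelOp k) :=
  Subtype.ext (kernelOp_adjointKernel k)

theorem compactKernelOp_mul {k l m : C(ℝ × ℝ, ℂ)} (h : ∀ t ∈ Icc (0 : ℝ) 1, ∀ u ∈ Icc (0 : ℝ) 1,
    m (t, u) = ∫ v in Icc (0 : ℝ) 1, k (t, v) * l (v, u)) :
    compactKernelOp m = compactKernelOp k * compactKernelOp l :=
  Subtype.ext (kernelOp_mul h)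

variable {X : Type*} [MetricSpace X] [CompactSpace X] {φ : Flow ℝ X}

/-- The comparison of `2ᵏ`-th roots that removes the constant `C`. -/
theorem le_of_pow_two_pow_le {p q C : ℝ} (hq : 0 ≤ q)
    (h : ∀ k ≥ 2, p ^ 2 ^ k ≤ C * q ^ (2 ^ k - 2)) : p ≤ q := by
  by_contra! hlt
  have hp : 0 < p := hq.trans_lt hlt
  rcases hq.eq_or_lt with rfl | hq
  · have := h 2 le_rfl
    norm_num at this
    linarith [pow_pos hp 4]
  · obtain ⟨m, hm⟩ := pow_unbounded_of_one_lt (C / q ^ 2) ((one_lt_div hq).2 hlt)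
    have h1 := h (max m 2) (le_max_right _ _)
    have h4 : 2 ^ 2 ≤ 2 ^ max m 2 := Nat.pow_le_pow_right (by norm_num) (le_max_right _ _)
    have h2 : (p / q) ^ m ≤ (p / q) ^ 2 ^ max m 2 :=
      pow_le_pow_right₀ ((one_lt_div hq).2 hlt).le
        ((le_max_left m 2).trans Nat.lt_two_pow_self.le)
    have h3 : (p / q) ^ 2 ^ max m 2 ≤ C / q ^ 2 := by
      rw [div_pow, div_le_div_iff₀ (by positivity) (by positivity)]
      calc p ^ 2 ^ max m 2 * q ^ 2 ≤ C * q ^ (2 ^ max m 2 - 2) * q ^ 2 := by gcongr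
        _ = C * q ^ 2 ^ max m 2 := by
          rw [mul_assoc, ← pow_add, Nat.sub_add_cancel (by omega)]
    linarith

/-- A spectral radius argument: the norm of a selfadjoint `ρ(c)` is found from the powers of `c`, so
that a bound for `ρ(c b c)` by a submultiplicative quantity `q(b)`, up to a constant, yields the
bound `‖ρ(c)‖ ≤ q(c)` without any constant. -/
theorem norm_le_of_norm_mul_mul_le {A B : Type*} [NonUnitalRing A] [NormedRing B] [StarRing B]
    [CStarRing B] {q : A → ℝ} (hq : ∀ a, 0 ≤ q a) (hqmul : ∀ a b, q (a * b) ≤ q a * q b) {ρ : A → B}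
    (hρ : ∀ a b, ρ (a * b) = ρ a * ρ b) {c : A} (hc : IsSelfAdjoint (ρ c)) {K : ℝ} (hK : 0 ≤ K)
    (h : ∀ b, ‖ρ (c * (b * c))‖ ≤ K * q b) : ‖ρ c‖ ≤ q c := by
  let p : ℕ → A := fun m => (fun b => c * b)^[m] c
  have hp (m : ℕ) : p (m + 1) = c * p m := iterate_succ_apply' _ _ _
  have hp' (m : ℕ) : p (m + 1) = p m * c := by
    induction m with
    | zero => rfl
    | succ m ih => rw [hp (m + 1), hp m, mul_assoc, ← ih, hp m]
  have hρp (m : ℕ) : ρ (p m) = ρ c ^ (m + 1) := by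
    induction m with
    | zero => exact (pow_one (ρ c)).symm
    | succ m ih => rw [hp, pow_succ', ← ih, hρ]
  have hqp (m : ℕ) : q (p m) ≤ q c ^ (m + 1) := by
    induction m with
    | zero => exact (pow_one (q c)).ge
    | succ m ih =>
      rw [hp, pow_succ']
      exact (hqmul _ _).trans (mul_le_mul_of_nonneg_left ih (hq c))
  refine le_of_pow_two_pow_le (C := K) (hq c) fun k hk => ?_
  have h4 : 2 ^ 2 ≤ 2 ^ k := Nat.pow_le_pow_right (by norm_num) hk
  obtain ⟨m, hm⟩ : ∃ m, 2 ^ k = m + 3 := ⟨2 ^ k - 3, by omega⟩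
  have h1 : ‖ρ c‖ ^ 2 ^ k = ‖ρ c ^ 2 ^ k‖ := by
    have := hc.nnnorm_pow_two_pow k
    rw [← coe_nnnorm, ← coe_nnnorm, this]
    simp
  have h2 : p (m + 2) = c * (p m * c) := by rw [hp, hp']
  rw [h1, hm, show m + 3 - 2 = m + 1 by omega, show m + 3 = m + 2 + 1 by omega, ← hρp, h2]
  exact (h _).trans (mul_le_mul_of_nonneg_left (hqp m) hK)

namespace CantorFlowBoxStructure

variable {x : X} (𝔅 : CantorFlowBoxStructure φ x) (hmin : IsMinimalFlow φ)
include hmin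

theorem segmentKernel_mul_slice {n : ℕ} {a : ConvAlg φ} (ha : a ∈ breakingAlgebra φ (𝔅.slice n))
    (b : ConvAlg φ) (y : 𝔅.slice n) {t : ℝ} (ht : t ∈ Icc (0 : ℝ) 1)
    (u : ℝ) : segmentKernel (a * b) y (𝔅.returnTime n y) (t, u) =
      ∫ v in Icc (0 : ℝ) 1, segmentKernel a y (𝔅.returnTime n y) (t, v) *
        segmentKernel b y (𝔅.returnTime n y) (v, u) :=
  segmentKernel_mul ha b (𝔅.returnTime_pos hmin y) y.2 (𝔅.map_returnTime_mem hmin y) ht u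

/-- The integral operators on the orbit segments between consecutive visits to `Sₙ`. -/
def sliceOp (n : ℕ) (a : ConvAlg φ) : 𝔅.SliceAlgebra n where
  toFun y := compactKernelOp (segmentKernel a y (𝔅.returnTime n y))
  continuous_toFun := continuous_compactKernelOp.comp (continuous_segmentKernel a
    continuous_subtype_val (𝔅.continuous_returnTime hmin n))

theorem sliceOp_apply (n : ℕ) (a : ConvAlg φ) (y : 𝔅.slice n) :
    𝔅.sliceOp hmin n a y = compactKernelOp (segmentKernel a y (𝔅.returnTime n y)) := rfl

theorem sliceOp_smul (n : ℕ) (c : ℂ) (a : ConvAlg φ) :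
    𝔅.sliceOp hmin n (c • a) = c • 𝔅.sliceOp hmin n a := by
  ext1 y
  rw [ContinuousMap.smul_apply, sliceOp_apply, sliceOp_apply, segmentKernel_smul,
    compactKernelOp_smul]

/-- The representation of the `*`-algebra that breaks the orbits along `Sₙ` by integral operators
along the orbit segments between consecutive visits to `Sₙ`. -/
def sliceRep (n : ℕ) : breakingAlgebra φ (𝔅.slice n) →⋆ₙₐ[ℂ] 𝔅.SliceAlgebra n where
  toFun a := 𝔅.sliceOp hmin n a
  map_smul' c a := 𝔅.sliceOp_smul hmin n c a
  map_zero' := by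
    have := 𝔅.sliceOp_smul hmin n 0 0
    rw [zero_smul] at this
    exact this.trans (zero_smul ℂ (𝔅.sliceOp hmin n 0))
  map_add' a b := by
    ext1 y
    rw [ContinuousMap.add_apply, sliceOp_apply, sliceOp_apply, sliceOp_apply,
      ← compactKernelOp_add, ← segmentKernel_add]
    rfl
  map_mul' a b := by
    ext1 y
    rw [ContinuousMap.mul_apply, sliceOp_apply, sliceOp_apply, sliceOp_apply]
    exact compactKernelOp_mul fun t ht u _ => 𝔅.segmentKernel_mul_slice hmin a.2 b y ht u
  map_star' a := by
    ext1 y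
    rw [ContinuousMap.star_apply, sliceOp_apply, sliceOp_apply, ← compactKernelOp_adjointKernel,
      ← segmentKernel_star]
    rfl

theorem coe_sliceRep_apply (n : ℕ) (a : breakingAlgebra φ (𝔅.slice n)) (y : 𝔅.slice n) :
    (𝔅.sliceRep hmin n a y : L2I →L[ℂ] L2I) =
      kernelOp (segmentKernel (a : ConvAlg φ) y (𝔅.returnTime n y)) := rfl

theorem norm_sliceRep_le (n : ℕ) (a : breakingAlgebra φ (𝔅.slice n)) :
    ‖𝔅.sliceRep hmin n a‖ ≤ ‖CrossedProduct.of φ a‖ :=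
  (ContinuousMap.norm_le _ (norm_nonneg _)).2 fun y =>
    norm_kernelOp_segmentKernel_le (a : ConvAlg φ) (y : X) (𝔅.returnTime_pos hmin y)

/-! ### The universal norm on the algebra that breaks the orbits along a slice -/

theorem exists_segmentKernel_bound (n : ℕ) (a : ConvAlg φ) : ∃ R, 0 ≤ R ∧ ∀ (y : 𝔅.slice n)
    (p : ℝ × ℝ), ‖segmentKernel a y (𝔅.returnTime n y) p‖ ≤ R := by
  obtain ⟨C, hC⟩ := a.hasCompactSupport.exists_bound_of_continuous a.continuous
  obtain ⟨T, hT, hTle⟩ := 𝔅.exists_returnTime_le hmin n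
  have hC0 : 0 ≤ C := (norm_nonneg _).trans (hC 0)
  refine ⟨T * C, by positivity, fun y p => ?_⟩
  change ‖((𝔅.returnTime n y : ℝ) : ℂ) * _‖ ≤ _
  rw [norm_mul, Complex.norm_real, Real.norm_of_nonneg (𝔅.returnTime_pos hmin y).le]
  exact mul_le_mul (hTle y) ((ContinuousMap.norm_coe_le_norm _ _).trans (hC _)) (norm_nonneg _) hT.le

/-- The kernels of `a * (b * a)` are bounded in terms of the norms of the operators that represent `b`,
since their values are matrix coefficients of these operators. -/
theorem exists_norm_segmentKernel_mul_mul_le (n : ℕ) (a : breakingAlgebra φ (𝔅.slice n)) :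
    ∃ R, 0 ≤ R ∧ ∀ (b : breakingAlgebra φ (𝔅.slice n)) (y : 𝔅.slice n),
      ∀ t ∈ Icc (0 : ℝ) 1, ∀ u ∈ Icc (0 : ℝ) 1,
        ‖segmentKernel (a * (b * a) : ConvAlg φ) y (𝔅.returnTime n y) (t, u)‖ ≤
          R * ‖𝔅.sliceRep hmin n b‖ := by
  obtain ⟨R, hR, hle⟩ := 𝔅.exists_segmentKernel_bound hmin n a
  refine ⟨R * R, by positivity, fun b y t ht u hu => ?_⟩
  let k := segmentKernel (a : ConvAlg φ) y (𝔅.returnTime n y)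
  let col : C(ℝ, ℂ) := k.comp ⟨fun v => (v, u), by fun_prop⟩
  have h1 : segmentKernel (a * (b * a) : ConvAlg φ) y (𝔅.returnTime n y) (t, u) =
      ⟪contL2 (kernelRow k t), (𝔅.sliceRep hmin n b y : L2I →L[ℂ] L2I) (contL2 col)⟫_ℂ := by
    rw [𝔅.segmentKernel_mul_slice hmin a.2 _ y ht u, coe_sliceRep_apply, kernelOp_apply, inner_contL2]
    refine setIntegral_congr_fun measurableSet_Icc fun v hv => ?_
    rw [kernelFun_contL2, 𝔅.segmentKernel_mul_slice hmin b.2 _ y hv u, kernelRow_apply, star_star,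
      mul_comm]
    rfl
  rw [h1]
  have hrow : ‖contL2 (kernelRow k t)‖ ≤ R :=
    norm_contL2_kernelRow_le hR (fun t _ u _ => hle y (t, u)) ht
  have hcol : ‖contL2 col‖ ≤ R := norm_contL2_le hR fun v _ => hle y (v, u)
  have hb : ‖(𝔅.sliceRep hmin n b y : L2I →L[ℂ] L2I)‖ ≤ ‖𝔅.sliceRep hmin n b‖ :=
    ContinuousMap.norm_coe_le_norm (𝔅.sliceRep hmin n b) y
  calc _ ≤ ‖contL2 (kernelRow k t)‖ * ‖(𝔅.sliceRep hmin n b y : L2I →L[ℂ] L2I) (contL2 col)‖ :=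
        norm_inner_le_norm _ _
    _ ≤ R * (‖𝔅.sliceRep hmin n b‖ * R) := by
        refine mul_le_mul hrow ((ContinuousLinearMap.le_opNorm _ _).trans ?_) (norm_nonneg _) hR
        exact mul_le_mul hb hcol (norm_nonneg _) (norm_nonneg (𝔅.sliceRep hmin n b))
    _ = _ := by ring

/-- For elements that break the orbits along `Sₙ` the norm of `L¹(ℝ, C(X))` is bounded by the supremum
of the kernels on the orbit segments, because these elements are supported in a bounded set of
times. -/
theorem exists_l1Norm_le (n : ℕ) : ∃ L, 0 ≤ L ∧ ∀ (a : breakingAlgebra φ (𝔅.slice n)) (C : ℝ),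
    0 ≤ C → (∀ (y : 𝔅.slice n), ∀ t ∈ Icc (0 : ℝ) 1, ∀ u ∈ Icc (0 : ℝ) 1,
      ‖segmentKernel (a : ConvAlg φ) y (𝔅.returnTime n y) (t, u)‖ ≤ C) →
    (a : ConvAlg φ).l1Norm ≤ L * C := by
  obtain ⟨T, hT, hTle⟩ := 𝔅.exists_returnTime_le hmin n
  have hl := 𝔅.isFlowBox_ambient.length_pos
  refine ⟨2 * T / 𝔅.ambientLength, by positivity, fun a C hC h => ?_⟩
  have hpt (s : ℝ) : ‖(a : ConvAlg φ) s‖ ≤ (Icc (-T) T).indicator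
      (fun _ => C / 𝔅.ambientLength) s := by
    refine (ContinuousMap.norm_le _ (indicator_nonneg (fun _ _ => by positivity) _)).2 fun z => ?_
    obtain ⟨y, t, ht, rfl⟩ := 𝔅.exists_flow_eq hmin n z
    have hτ := 𝔅.returnTime_pos hmin y
    by_cases hu : t - s ∈ Icc 0 (𝔅.returnTime n y)
    · have hs : s ∈ Icc (-T) T := by
        have := hTle y
        exact ⟨by linarith [ht.1, hu.2], by linarith [ht.2, hu.1]⟩
      rw [indicator_of_mem hs, le_div_iff₀ hl]
      have h1 := h y (t / 𝔅.returnTime n y) ⟨div_nonneg ht.1 hτ.le, (div_le_one hτ).2 ht.2⟩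
        ((t - s) / 𝔅.returnTime n y) ⟨div_nonneg hu.1 hτ.le, (div_le_one hτ).2 hu.2⟩
      rw [segmentKernel_apply, norm_mul, Complex.norm_real, Real.norm_of_nonneg hτ.le, ← sub_div,
        mul_div_cancel₀ _ hτ.ne', mul_div_cancel₀ _ hτ.ne', sub_sub_cancel] at h1
      have h2 := 𝔅.ambientLength_le_returnTime hmin y
      nlinarith [norm_nonneg ((a : ConvAlg φ) s (φ t y))]
    · have h0 : (a : ConvAlg φ) (t - (t - s)) (φ t y) = 0 := by
        rw [mem_Icc, not_and_or, not_le, not_le] at hu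
        rcases hu with hu | hu
        · refine apply_eq_zero_of_mem_breakingAlgebra a.2 (c := 0) (by simp) (Or.inl ?_)
          exact ⟨hu.le, ht.1⟩
        · refine apply_eq_zero_of_mem_breakingAlgebra a.2 (𝔅.map_returnTime_mem hmin y) (Or.inr ?_)
          exact ⟨ht.2, hu.le⟩
      rw [sub_sub_cancel] at h0
      rw [h0, norm_zero]
      exact indicator_nonneg (fun _ _ => by positivity) _
  calc (a : ConvAlg φ).l1Norm ≤ ∫ s, (Icc (-T) T).indicator (fun _ => C / 𝔅.ambientLength) s := by
        refine integral_mono (a : ConvAlg φ).integrable_norm ?_ hpt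
        exact (integrable_indicator_iff measurableSet_Icc).2 (integrableOn_const (by simp))
    _ = 2 * T / 𝔅.ambientLength * C := by
        rw [integral_indicator measurableSet_Icc, setIntegral_const]
        simp only [measureReal_def, Real.volume_Icc, smul_eq_mul]
        rw [ENNReal.toReal_ofReal (by linarith)]
        ring

theorem norm_le_norm_sliceRep_of_isSelfAdjoint {n : ℕ} {H : Type*} [NormedAddCommGroup H]
    [InnerProductSpace ℂ H] [CompleteSpace H] (ρ : ConvAlg φ →⋆ₙₐ[ℂ] (H →L[ℂ] H))
    (hρ : ∀ a, ‖ρ a‖ ≤ a.l1Norm) (c : breakingAlgebra φ (𝔅.slice n)) (hc : IsSelfAdjoint c) :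
    ‖ρ c‖ ≤ ‖𝔅.sliceRep hmin n c‖ := by
  obtain ⟨R, hR, hRle⟩ := 𝔅.exists_norm_segmentKernel_mul_mul_le hmin n c
  obtain ⟨L, hL, hLle⟩ := 𝔅.exists_l1Norm_le hmin n
  have hsa : IsSelfAdjoint (ρ c) := by
    have h1 : star (c : ConvAlg φ) = c := congrArg Subtype.val hc.star_eq
    rw [isSelfAdjoint_iff, ← map_star, h1]
  refine norm_le_of_norm_mul_mul_le (A := breakingAlgebra φ (𝔅.slice n))
    (q := fun a => ‖𝔅.sliceRep hmin n a‖) (ρ := fun a => ρ a) (K := L * R)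
    (fun a => norm_nonneg (𝔅.sliceRep hmin n a)) (fun a b => ?_) (fun a b => ?_) hsa
    (by positivity) fun b => ?_
  · rw [map_mul]
    exact norm_mul_le (𝔅.sliceRep hmin n a) _
  · exact map_mul ρ (a : ConvAlg φ) b
  · rw [mul_assoc]
    exact (hρ _).trans (hLle (c * (b * c)) _ (mul_nonneg hR (norm_nonneg (𝔅.sliceRep hmin n b)))
      fun y t ht u hu => hRle b y t ht u hu)

/-- The slice representation is isometric for the norm of the crossed product. -/
theorem norm_sliceRep (n : ℕ) (a : breakingAlgebra φ (𝔅.slice n)) :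
    ‖𝔅.sliceRep hmin n a‖ = ‖CrossedProduct.of φ a‖ := by
  refine le_antisymm (𝔅.norm_sliceRep_le hmin n a) ?_
  rw [CrossedProduct.norm_of]
  refine csSup_le (ConvAlg.repNorms_nonempty _) ?_
  rintro _ ⟨H, _, _, _, ρ, hρ, rfl⟩
  have h := 𝔅.norm_le_norm_sliceRep_of_isSelfAdjoint hmin ρ hρ (star a * a)
    (IsSelfAdjoint.star_mul_self a)
  rw [map_mul, map_star, CStarRing.norm_star_mul_self (x := 𝔅.sliceRep hmin n a)] at h
  have h1 : ρ ((star a * a : breakingAlgebra φ (𝔅.slice n)) : ConvAlg φ) = star (ρ a) * ρ a := by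
    rw [← map_star, ← map_mul]
    rfl
  rw [h1, CStarRing.norm_star_mul_self] at h
  exact (mul_self_le_mul_self_iff (norm_nonneg _) (norm_nonneg (𝔅.sliceRep hmin n a))).2 h

end CantorFlowBoxStructure

end SliceRep

/-! ### Density of the range of the slice representations -/

section Density

/-- The rank one operator `ζ ↦ ⟪η, ζ⟫ ξ`, as a compact operator. -/
def compactRankOne {H : Type*} [NormedAddCommGroup H] [InnerProductSpace ℂ H] [CompleteSpace H]
    (ξ η : H) : compactOperators H :=
  ⟨InnerProductSpace.rankOne ℂ ξ η, isCompactOperator_rankOne ξ η⟩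

theorem continuous_compactRankOne {H : Type*} [NormedAddCommGroup H] [InnerProductSpace ℂ H]
    [CompleteSpace H] : Continuous fun p : H × H => compactRankOne p.1 p.2 := by
  have h : Continuous fun p : H × H => (InnerProductSpace.rankOne ℂ p.1 p.2 : H →L[ℂ] H) := by
    have h1 : Continuous fun p : H × H => ContinuousLinearMap.toSpanSingleton ℂ p.1 :=
      (ContinuousLinearMap.toSpanSingletonCLE (𝕜 := ℂ)).continuous.comp continuous_fst
    exact h1.clm_comp ((innerSL ℂ).continuous.comp continuous_snd)
  exact continuous_induced_rng.2 h

/-- Compact operators on a Hilbert space are approximated by finite rank operators: the operator `T`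
is close to `P T`, where `P` is the projection onto the span of a finite net in the image of the unit
ball. -/
theorem mem_topologicalClosure_span_compactRankOne {H : Type*} [NormedAddCommGroup H]
    [InnerProductSpace ℂ H] [CompleteSpace H] (T : compactOperators H) :
    T ∈ (Submodule.span ℂ (range fun p : H × H => compactRankOne p.1 p.2)).topologicalClosure := by
  change T ∈ closure (Submodule.span ℂ (range fun p : H × H => compactRankOne p.1 p.2) :
    Set (compactOperators H))
  rw [Metric.mem_closure_iff]
  intro ε hε
  have hT : IsCompactOperator (T : H →L[ℂ] H) := T.2
  have htb : TotallyBounded ((T : H →L[ℂ] H) '' Metric.closedBall 0 1) :=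
    (hT.isCompact_closure_image_closedBall (f := (T : H →L[ℂ] H).toLinearMap)
      1).totallyBounded.subset subset_closure
  obtain ⟨t, htfin, ht⟩ := Metric.totallyBounded_iff.1 htb (ε / 2) (by linarith)
  let V : Submodule ℂ H := Submodule.span ℂ t
  have : FiniteDimensional ℂ V := FiniteDimensional.span_of_finite ℂ htfin
  let e := stdOrthonormalBasis ℂ V
  let F : compactOperators H :=
    ∑ i, compactRankOne (e i : H) (ContinuousLinearMap.adjoint (T : H →L[ℂ] H) (e i))
  have hF : (F : H →L[ℂ] H) = V.starProjection * T := by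
    rw [e.starProjection_eq_sum_rankOne, Finset.sum_mul]
    simp only [F, AddSubmonoidClass.coe_finsetSum, compactRankOne]
    refine Finset.sum_congr rfl fun i _ => ?_
    exact (InnerProductSpace.rankOne_comp _ _ _).symm
  refine ⟨F, sum_mem fun i _ => Submodule.subset_span ⟨(_, _), rfl⟩, ?_⟩
  rw [dist_eq_norm]
  change ‖(T : H →L[ℂ] H) - (F : H →L[ℂ] H)‖ < ε
  rw [hF]
  refine (ContinuousLinearMap.opNorm_le_of_unit_norm (C := ε / 2) (by linarith)
    fun z hz => ?_).trans_lt (half_lt_self hε)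
  obtain ⟨w, hw, hzw⟩ := mem_iUnion₂.1 (ht ⟨z, by simp [hz], rfl⟩)
  rw [sub_apply, mul_apply_eq_comp, Submodule.starProjection_minimal]
  refine (ciInf_le ⟨0, ?_⟩ (⟨w, Submodule.subset_span hw⟩ : V)).trans ?_
  · rintro _ ⟨v, rfl⟩
    exact norm_nonneg _
  · rw [Metric.mem_ball, dist_eq_norm] at hzw
    exact hzw.le

/-- The rank one operators given by functions that vanish outside the open unit interval span a
dense subspace of the compact operators on `L²([0,1])`. -/
theorem dense_span_compactRankOne_unitBumps :
    Dense (Submodule.span ℂ ((fun p : C(ℝ, ℂ) × C(ℝ, ℂ) =>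
      compactRankOne (contL2 p.1) (contL2 p.2)) ''
        ((unitBumps : Set C(ℝ, ℂ)) ×ˢ (unitBumps : Set C(ℝ, ℂ)))) : Set (compactOperators L2I)) := by
  set W := Submodule.span ℂ ((fun p : C(ℝ, ℂ) × C(ℝ, ℂ) =>
      compactRankOne (contL2 p.1) (contL2 p.2)) ''
        ((unitBumps : Set C(ℝ, ℂ)) ×ˢ (unitBumps : Set C(ℝ, ℂ))))
  have hle : Submodule.span ℂ (range fun p : L2I × L2I => compactRankOne p.1 p.2) ≤
      W.topologicalClosure := by
    rw [Submodule.span_le]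
    rintro _ ⟨p, rfl⟩
    have hd : Dense ((contL2 '' (unitBumps : Set C(ℝ, ℂ))) ×ˢ
        (contL2 '' (unitBumps : Set C(ℝ, ℂ)))) := dense_contL2_unitBumps.prod dense_contL2_unitBumps
    refine closure_minimal ?_ (W.isClosed_topologicalClosure.preimage continuous_compactRankOne)
      (hd p)
    rintro ⟨_, _⟩ ⟨⟨ξ, hξ, rfl⟩, ⟨η, hη, rfl⟩⟩
    exact W.le_topologicalClosure (Submodule.subset_span ⟨(ξ, η), ⟨hξ, hη⟩, rfl⟩)
  exact fun K => Submodule.topologicalClosure_minimal _ hle W.isClosed_topologicalClosure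
    (mem_topologicalClosure_span_compactRankOne K)

/-- A linear map into `C(Y, V)`, for a totally disconnected space `Y`, has dense range if its range
contains all `f • v` with `f ∈ C(Y)` and with `v` in a set with dense span. -/
theorem denseRange_of_smul_mem_range {Y V D : Type*} [TopologicalSpace Y] [CompactSpace Y]
    [T2Space Y] [TotallyDisconnectedSpace Y] [NormedAddCommGroup V] [NormedSpace ℂ V]
    [AddCommGroup D] [Module ℂ D] (F : D → C(Y, V)) (hadd : ∀ a b, F (a + b) = F a + F b)
    (hsmul : ∀ (c : ℂ) a, F (c • a) = c • F a) {G : Set V}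
    (hG : Dense (Submodule.span ℂ G : Set V))
    (h : ∀ f : C(Y, ℂ), ∀ v ∈ G, ∃ a, ∀ y, F a y = f y • v) : DenseRange F := by
  let L : D →ₗ[ℂ] C(Y, V) := ⟨⟨F, hadd⟩, hsmul⟩
  let W : Submodule ℂ C(Y, V) := (LinearMap.range L).topologicalClosure
  have hW : IsClosed (W : Set C(Y, V)) := Submodule.isClosed_topologicalClosure _
  let E (f : C(Y, ℂ)) : V →ₗ[ℂ] C(Y, V) :=
    { toFun := fun v => ⟨fun y => f y • v, f.continuous.smul continuous_const⟩
      map_add' := fun v w => by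
        ext1 y
        exact smul_add _ _ _
      map_smul' := fun c v => by
        ext1 y
        exact smul_comm _ _ _ }
  have hE (f : C(Y, ℂ)) : Continuous (E f) :=
    ContinuousMap.continuous_of_continuous_uncurry _
      ((f.continuous.comp continuous_snd).smul continuous_fst)
  have h2 (f : C(Y, ℂ)) (v : V) : E f v ∈ W := by
    have hle : Submodule.span ℂ G ≤ W.comap (E f) := by
      rw [Submodule.span_le]
      intro v hv
      obtain ⟨a, ha⟩ := h f v hv
      exact Submodule.le_topologicalClosure _ ⟨a, ContinuousMap.ext ha⟩
    exact closure_minimal hle (hW.preimage (hE f)) (hG v)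
  intro g
  change g ∈ (W : Set C(Y, V))
  rw [← hW.closure_eq, Metric.mem_closure_iff]
  intro ε hε
  obtain ⟨m, f, K, hfK⟩ :=
    ContinuousMap.exists_finite_sum_smul_approximation_of_mem_uniformity (Y := Unit) (R := ℂ)
      (g.comp .fst) (Metric.dist_mem_uniformity (half_pos hε))
  refine ⟨∑ i, E (f i) (K i ()), sum_mem fun i _ => h2 _ _, ?_⟩
  refine ((ContinuousMap.dist_le (half_pos hε).le).2 fun y => ?_).trans_lt (half_lt_self hε)
  have : dist _ _ ≤ _ := le_of_lt (show dist _ _ < _ from hfK y ())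
  simpa [E] using this

variable {X : Type*} [MetricSpace X] [CompactSpace X] {φ : Flow ℝ X}

namespace CantorFlowBoxStructure

variable {x : X} (𝔅 : CantorFlowBoxStructure φ x)

instance totallyDisconnectedSpace_slice (n : ℕ) : TotallyDisconnectedSpace (𝔅.slice n) := by
  obtain ⟨e⟩ := 𝔅.cantor
  let j : 𝔅.slice n → ℕ → Bool :=
    e ∘ inclusion fun _ hy => (𝔅.slice_subset_ambient n hy).1
  have hj : Continuous j := e.continuous.comp (continuous_inclusion _)
  have hinj : Injective j := e.injective.comp (inclusion_injective _)
  exact ⟨isTotallyDisconnected_of_image hj.continuousOn hinj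
    (isTotallyDisconnected_of_totallyDisconnectedSpace _)⟩

variable (hmin : IsMinimalFlow φ)
include hmin

/-- The point that the flow reaches from `y ∈ Sₙ` in the fraction `t` of its return time. -/
def segmentPoint (n : ℕ) (p : 𝔅.slice n × Icc (0 : ℝ) 1) : X :=
  φ (𝔅.returnTime n p.1 * p.2) p.1

theorem continuous_segmentPoint (n : ℕ) : Continuous (𝔅.segmentPoint n) :=
  φ.cont'.comp ((((𝔅.continuous_returnTime hmin n).comp continuous_fst).mul
    (continuous_subtype_val.comp continuous_snd)).prodMk (continuous_subtype_val.comp continuous_fst))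

theorem surjective_segmentPoint (n : ℕ) : Surjective (𝔅.segmentPoint n) := fun z => by
  obtain ⟨y, t, ht, rfl⟩ := 𝔅.exists_flow_eq hmin n z
  have hτ := 𝔅.returnTime_pos hmin y
  refine ⟨(y, ⟨t / 𝔅.returnTime n y, div_nonneg ht.1 hτ.le, (div_le_one hτ).2 ht.2⟩), ?_⟩
  simp only [segmentPoint]
  rw [mul_div_cancel₀ _ hτ.ne']

theorem segmentPoint_eq {n : ℕ} {p q : 𝔅.slice n × Icc (0 : ℝ) 1}
    (h : 𝔅.segmentPoint n p = 𝔅.segmentPoint n q) (hp : (p.2 : ℝ) ∈ Ioo (0 : ℝ) 1) : p = q := by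
  have hτ := 𝔅.returnTime_pos hmin p.1
  have hτ' := 𝔅.returnTime_pos hmin q.1
  obtain ⟨h1, h2⟩ := 𝔅.eq_of_flow_eq (y := p.1) (z := q.1)
    (s := 𝔅.returnTime n p.1 * p.2) (t := 𝔅.returnTime n q.1 * q.2)
    ⟨mul_pos hτ hp.1, mul_lt_of_lt_one_right hτ hp.2⟩
    ⟨mul_nonneg hτ'.le q.2.2.1, mul_le_of_le_one_right hτ'.le q.2.2.2⟩ h
  rw [← h1] at h2
  exact Prod.ext h1 (Subtype.ext (mul_left_cancel₀ hτ.ne' h2))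

theorem isQuotientMap_segmentPoint (n : ℕ) :
    IsQuotientMap (Prod.map id (𝔅.segmentPoint n) :
      ℝ × (𝔅.slice n × Icc (0 : ℝ) 1) → ℝ × X) := by
  have hc := 𝔅.continuous_segmentPoint hmin n
  exact ((isProperMap_id.prodMap hc.isProperMap).isClosedMap).isQuotientMap
    (continuous_id.prodMap hc) (surjective_id.prodMap (𝔅.surjective_segmentPoint hmin n))

/-- For all `f ∈ C(Sₙ)` and all `ξ`, `η` that vanish outside the open unit interval, the function
`y ↦ f(y) |ξ⟩⟨η|` is in the range of the slice representation. -/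
theorem exists_sliceRep_eq_rankOne (n : ℕ) (f : C(𝔅.slice n, ℂ)) {ξ η : C(ℝ, ℂ)}
    (hξ : ξ ∈ unitBumps) (hη : η ∈ unitBumps) : ∃ a : breakingAlgebra φ (𝔅.slice n),
      ∀ y, 𝔅.sliceRep hmin n a y = f y • compactRankOne (contL2 ξ) (contL2 η) := by
  have hτc := 𝔅.continuous_returnTime hmin n
  have hτ0 : ∀ y : 𝔅.slice n, 𝔅.returnTime n y ≠ 0 := fun y => (𝔅.returnTime_pos hmin y).ne'
  obtain ⟨T, hT, hTle⟩ := 𝔅.exists_returnTime_le hmin n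
  let q : C(ℝ × (𝔅.slice n × Icc (0 : ℝ) 1), ℝ × X) :=
    ⟨Prod.map id (𝔅.segmentPoint n), continuous_id.prodMap (𝔅.continuous_segmentPoint hmin n)⟩
  have hq : IsQuotientMap q := 𝔅.isQuotientMap_segmentPoint hmin n
  let F : C(ℝ × (𝔅.slice n × Icc (0 : ℝ) 1), ℂ) :=
    { toFun := fun p => f p.2.1 * ξ p.2.2 * star (η (p.2.2 - p.1 / 𝔅.returnTime n p.2.1)) /
        𝔅.returnTime n p.2.1
      continuous_toFun := by
        have h1 : Continuous fun p : ℝ × (𝔅.slice n × Icc (0 : ℝ) 1) => 𝔅.returnTime n p.2.1 :=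
          hτc.comp (continuous_fst.comp continuous_snd)
        have h2 : Continuous fun p : ℝ × (𝔅.slice n × Icc (0 : ℝ) 1) =>
            p.1 / 𝔅.returnTime n p.2.1 := continuous_fst.div h1 fun p => hτ0 p.2.1
        refine Continuous.div ?_ (Complex.continuous_ofReal.comp h1) fun p =>
          Complex.ofReal_ne_zero.2 (hτ0 p.2.1)
        fun_prop }
  have hfac : FactorsThrough F q := by
    rintro ⟨s, p⟩ ⟨s', p'⟩ h
    obtain rfl : s = s' := congrArg Prod.fst h
    have h : 𝔅.segmentPoint n p = 𝔅.segmentPoint n p' := congrArg Prod.snd h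
    by_cases hp : (p.2 : ℝ) ∈ Ioo (0 : ℝ) 1
    · rw [𝔅.segmentPoint_eq hmin h hp]
    · by_cases hp' : (p'.2 : ℝ) ∈ Ioo (0 : ℝ) 1
      · rw [𝔅.segmentPoint_eq hmin h.symm hp']
      · simp [F, hξ _ hp, hξ _ hp']
  let b : C(ℝ × X, ℂ) := hq.lift F hfac
  have hb (s : ℝ) (y : 𝔅.slice n) (t : Icc (0 : ℝ) 1) :
      b (s, φ (𝔅.returnTime n y * t) y) =
        f y * ξ t * star (η (t - s / 𝔅.returnTime n y)) / 𝔅.returnTime n y :=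
    DFunLike.congr_fun (hq.lift_comp F hfac) (s, (y, t))
  let a : ConvAlg φ :=
    { toFun := b.curry
      continuous_toFun := b.curry.continuous
      hasCompactSupport' := by
        refine HasCompactSupport.intro (isCompact_Icc (a := -T) (b := T)) fun s hs => ?_
        ext z
        obtain ⟨⟨y, t⟩, rfl⟩ := 𝔅.surjective_segmentPoint hmin n z
        refine (hb s y t).trans ?_
        have hτ := 𝔅.returnTime_pos hmin y
        rw [hη (t - s / 𝔅.returnTime n y) fun hmem => hs ?_]
        · simp
        · have hle := hTle y
          obtain ⟨h1, h2⟩ := hmem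
          obtain ⟨h3, h4⟩ := t.2
          have h5 : s / 𝔅.returnTime n y < 1 := by linarith
          have h6 : -1 < s / 𝔅.returnTime n y := by linarith
          rw [div_lt_one hτ] at h5
          rw [lt_div_iff₀ hτ] at h6
          exact ⟨by linarith, by linarith⟩ }
  have ha (s : ℝ) (y : 𝔅.slice n) (t : Icc (0 : ℝ) 1) :
      a s (φ (𝔅.returnTime n y * t) y) =
        f y * ξ t * star (η (t - s / 𝔅.returnTime n y)) / 𝔅.returnTime n y := hb s y t
  have hamem : a ∈ breakingAlgebra φ (𝔅.slice n) := by
    refine mem_breakingAlgebra.2 fun z hz s r hsr => ?_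
    obtain ⟨⟨y, t⟩, hyt⟩ := 𝔅.surjective_segmentPoint hmin n (φ r z)
    simp only [segmentPoint] at hyt
    have hτ := 𝔅.returnTime_pos hmin y
    rw [← hyt, ha]
    by_cases ht : (t : ℝ) ∈ Ioo (0 : ℝ) 1
    · have hzy : φ (𝔅.returnTime n y * t - r) y ∈ 𝔅.slice n := by
        rw [sub_eq_neg_add, φ.map_add, hyt, ← φ.map_add, neg_add_cancel, φ.map_zero_apply]
        exact hz
      have h1 : 𝔅.returnTime n y * t < 𝔅.returnTime n y := mul_lt_of_lt_one_right hτ ht.2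
      have h2 : 0 < 𝔅.returnTime n y * t := mul_pos hτ ht.1
      have hnot : (t : ℝ) - s / 𝔅.returnTime n y ∉ Ioo (0 : ℝ) 1 := by
        rintro ⟨h3, h4⟩
        have h5 : s < 𝔅.returnTime n y * t := by
          rw [sub_pos, div_lt_iff₀ hτ] at h3
          linarith
        have h6 : 𝔅.returnTime n y * t - s < 𝔅.returnTime n y := by
          rw [sub_lt_iff_lt_add, ← sub_lt_iff_lt_add', lt_div_iff₀ hτ] at h4
          linarith
        rcases hsr with ⟨h7, h8⟩ | ⟨h7, h8⟩
        · have := 𝔅.returnTime_le y (by linarith) hzy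
          linarith
        · have := 𝔅.returnTime_le y (by linarith) hzy
          linarith
      rw [hη _ hnot]
      simp
    · rw [hξ _ ht]
      simp
  refine ⟨⟨a, hamem⟩, fun y => Subtype.ext ?_⟩
  have hτC : (𝔅.returnTime n y : ℂ) ≠ 0 := Complex.ofReal_ne_zero.2 (hτ0 y)
  rw [coe_sliceRep_apply, kernelOp_eq_rankOne (f := f y • ξ) (g := η)]
  · rw [map_smul, map_smul]
    rfl
  · intro t ht u _
    rw [segmentKernel_apply]
    refine (congrArg _ (ha _ y ⟨t, ht⟩)).trans ?_
    rw [mul_div_cancel_left₀ _ (hτ0 y), sub_sub_cancel, mul_div_cancel₀ _ hτC]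
    rfl

theorem denseRange_sliceRep (n : ℕ) : DenseRange (𝔅.sliceRep hmin n) := by
  refine denseRange_of_smul_mem_range (𝔅.sliceRep hmin n) (map_add _) (map_smul _)
    dense_span_compactRankOne_unitBumps ?_
  rintro f _ ⟨⟨ξ, η⟩, ⟨hξ, hη⟩, rfl⟩
  exact 𝔅.exists_sliceRep_eq_rankOne hmin n f hξ hη

end CantorFlowBoxStructure

end Density

/-! ### The connecting maps -/

section Connecting

theorem coeFn_towerOperator {T σ : ℝ} (hT : 0 < T) (hσ : 0 < σ) (c : ℝ) (ξ : L2I) :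
    towerOperator T σ c ξ =ᵐ[volume.restrict (Icc (0 : ℝ) 1)] towerFun T σ c ξ := by
  rw [towerOperator, dif_pos ⟨hT, hσ⟩]
  exact ((eLpNorm_towerFun hT hσ c ξ).1.restrict (Icc 0 1)).coeFn_toLp

/-- The function `v ↦ √(σ/T) g((σ v + c)/T)`, which is the rescaled restriction of `g` to the
interval `[c/T, (c + σ)/T]`. -/
def rescale (T σ c : ℝ) (g : C(ℝ, ℂ)) : C(ℝ, ℂ) where
  toFun v := (√(σ / T) : ℂ) * g ((σ * v + c) / T)

/-- The adjoint of the isometry onto `L²([c/T, (c + σ)/T])` restricts to this interval and rescales it to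
`[0,1]`. -/
theorem adjoint_towerOperator_contL2 {T σ c : ℝ} (hT : 0 < T) (hσ : 0 < σ) (hc : 0 ≤ c)
    (hcT : c + σ ≤ T) (g : C(ℝ, ℂ)) :
    ContinuousLinearMap.adjoint (towerOperator T σ c) (contL2 g) = contL2 (rescale T σ c g) := by
  refine ext_inner_right ℂ fun ξ => ?_
  rw [ContinuousLinearMap.adjoint_inner_left, inner_contL2_left, inner_contL2_left]
  let G : ℝ → ℂ := fun s => (√(T / σ) : ℂ) * (Icc (0 : ℝ) 1).indicator ξ s *
    star (g ((σ * s + c) / T))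
  have h1 : ∫ t in Icc (0 : ℝ) 1, towerOperator T σ c ξ t * star (g t) =
      ∫ t in Icc (0 : ℝ) 1, towerFun T σ c ξ t * star (g t) := by
    refine integral_congr_ae ?_
    filter_upwards [coeFn_towerOperator hT hσ c ξ] with t ht
    rw [ht]
  have h2 : ∫ t in Icc (0 : ℝ) 1, towerFun T σ c ξ t * star (g t) =
      ∫ t, G (T / σ * t - c / σ) := by
    rw [setIntegral_eq_integral_of_forall_compl_eq_zero]
    · refine integral_congr_ae (Eventually.of_forall fun t => ?_)
      simp only [G]
      rw [towerFun_eq hT hσ, show T / σ * t - c / σ = (T * t - c) / σ by ring,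
        show (σ * ((T * t - c) / σ) + c) / T = t by field_simp; ring]
    · intro t ht
      rw [towerFun, indicator_of_notMem, zero_mul]
      refine fun h => ht ⟨(div_nonneg hc hT.le).trans h.1, h.2.trans ?_⟩
      rw [div_le_one hT]
      linarith
  have hpos := div_pos hσ hT
  have hsq : (√(σ / T) : ℂ) = (σ / T : ℝ) * (√(T / σ) : ℝ) := by
    rw [← Complex.ofReal_mul, Complex.ofReal_inj, ← inv_div σ T, Real.sqrt_inv,
      ← div_eq_mul_inv, Real.div_sqrt]
  rw [h1, h2, Measure.integral_comp_mul_left (fun s => G (s - c / σ)), integral_sub_right_eq_self,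
    inv_div, abs_of_pos hpos, ← integral_smul, ← integral_indicator measurableSet_Icc]
  refine integral_congr_ae (Eventually.of_forall fun s => ?_)
  simp only [G, rescale, ContinuousMap.coe_mk]
  by_cases hs : s ∈ Icc (0 : ℝ) 1
  · rw [indicator_of_mem hs, indicator_of_mem hs, star_mul', hsq, Complex.real_smul]
    simp only [RCLike.star_def, map_mul, Complex.conj_ofReal]
    ring
  · rw [indicator_of_notMem hs, indicator_of_notMem hs]
    simp

theorem eq_of_forall_inner_contL2 {K L : L2I →L[ℂ] L2I}
    (h : ∀ f g, ⟪contL2 f, K (contL2 g)⟫_ℂ = ⟪contL2 f, L (contL2 g)⟫_ℂ) : K = L :=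
  sub_eq_zero.1 (norm_le_zero_iff.1 (opNorm_le_of_forall_unitBumps le_rfl fun f _ g _ => by
    rw [sub_apply, inner_sub_right, h, sub_self]
    simp))

/-- The double integral over the unit square of a function that vanishes off the diagonal blocks
`[pᵢ, pᵢ₊₁]²` is the sum of the integrals over the blocks. -/
theorem integral_integral_eq_sum_blocks {N : ℕ} {p : ℕ → ℝ} (hp : Monotone p) (h0 : p 0 = 0)
    (hN : p N = 1) {H : ℝ → ℝ → ℂ} (hH : Continuous (uncurry H))
    (hz : ∀ i < N, ∀ t ∈ Icc (p i) (p (i + 1)), ∀ u ∉ Ioo (p i) (p (i + 1)), H t u = 0) :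
    ∫ t in Icc (0 : ℝ) 1, ∫ u in Icc (0 : ℝ) 1, H t u =
      ∑ i ∈ Finset.range N, ∫ t in p i..p (i + 1), ∫ u in p i..p (i + 1), H t u := by
  have hint : Continuous fun t => ∫ u in Icc (0 : ℝ) 1, H t u := 
    continuous_parametric_integral_of_continuous hH isCompact_Icc
  have hsum := intervalIntegral.sum_integral_adjacent_intervals (n := N) (a := p)
    fun k _ => hint.intervalIntegrable (μ := volume) (p k) (p (k + 1))
  rw [h0, hN] at hsum
  rw [integral_Icc_eq_integral_Ioc, ← intervalIntegral.integral_of_le zero_le_one, ← hsum]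
  refine Finset.sum_congr rfl fun i hi => ?_
  have hi := Finset.mem_range.1 hi
  have hle := hp (Nat.le_succ i)
  refine intervalIntegral.integral_congr fun t ht => ?_
  rw [uIcc_of_le hle] at ht
  have hsub : Ioc (p i) (p (i + 1)) ⊆ Icc (0 : ℝ) 1 := fun u hu =>
    ⟨h0 ▸ (hp (Nat.zero_le i)).trans hu.1.le, hN ▸ hu.2.trans (hp hi)⟩
  rw [intervalIntegral.integral_of_le hle]
  refine setIntegral_eq_of_subset_of_forall_sdiff_eq_zero measurableSet_Icc hsub fun u hu => ?_
  exact hz i hi t ht u fun h => hu.2 ⟨h.1, h.2.le⟩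

theorem integral_rescale (T σ c : ℝ) (F : ℝ → ℂ) :
    ∫ t in c / T..(c + σ) / T, F t = (σ / T : ℝ) * ∫ v in Icc (0 : ℝ) 1, F ((σ * v + c) / T) := by
  rw [integral_Icc_eq_integral_Ioc, ← intervalIntegral.integral_of_le zero_le_one]
  have h := intervalIntegral.smul_integral_comp_mul_add (a := 0) (b := 1) F (σ / T) (c / T)
  rw [mul_zero, zero_add, mul_one, ← add_div, add_comm σ c] at h
  rw [← h, Complex.real_smul]
  congr 1
  refine intervalIntegral.integral_congr fun v _ => ?_
  congr 1
  ring

variable {X : Type*} [MetricSpace X] [CompactSpace X] {φ : Flow ℝ X}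

/-- The integral over a diagonal block of the kernel of `a` over an orbit segment, in terms of the
operator given by `a` on the orbit segment that corresponds to the block. -/
theorem inner_towerOperator_kernelOp (a : ConvAlg φ) (y : X) {T σ c : ℝ} (hT : 0 < T) (hσ : 0 < σ)
    (hc : 0 ≤ c) (hcT : c + σ ≤ T) (f g : C(ℝ, ℂ)) :
    ⟪contL2 f, (towerOperator T σ c * kernelOp (segmentKernel a (φ c y) σ) *
      ContinuousLinearMap.adjoint (towerOperator T σ c)) (contL2 g)⟫_ℂ =
      ∫ t in c / T..(c + σ) / T, ∫ u in c / T..(c + σ) / T,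
        segmentKernel a y T (t, u) * g u * star (f t) := by
  have hT0 : (T : ℂ) ≠ 0 := Complex.ofReal_ne_zero.2 hT.ne'
  rw [mul_apply_eq_comp, mul_apply_eq_comp, ← ContinuousLinearMap.adjoint_inner_left,
    adjoint_towerOperator_contL2 hT hσ hc hcT, adjoint_towerOperator_contL2 hT hσ hc hcT,
    inner_kernelOp_contL2, integral_rescale, ← integral_const_mul]
  refine integral_congr_ae (Eventually.of_forall fun t => ?_)
  simp only
  rw [integral_rescale, ← mul_assoc, ← integral_const_mul]
  refine integral_congr_ae (Eventually.of_forall fun u => ?_)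
  simp only [segmentKernel_apply, rescale, ContinuousMap.coe_mk]
  have h1 : T * ((σ * t + c) / T - (σ * u + c) / T) = σ * (t - u) := by
    field_simp
    ring
  have h2 : φ (T * ((σ * t + c) / T)) y = φ (σ * t) (φ c y) := by
    rw [← φ.map_add, mul_div_cancel₀ _ hT.ne']
  have h3 : (√(σ / T) : ℂ) * √(σ / T) = (σ / T : ℝ) := by
    rw [← Complex.ofReal_mul, Real.mul_self_sqrt (div_pos hσ hT).le]
  have h4 (A G F : ℂ) : σ * A * ((√(σ / T) : ℂ) * G) * ((√(σ / T) : ℂ) * F) =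
      (σ / T : ℝ) * (σ / T : ℝ) * (T * A * G * F) := by
    calc _ = σ * A * G * F * ((√(σ / T) : ℂ) * √(σ / T)) := by ring
      _ = _ := by
        rw [h3]
        push_cast
        field_simp
  rw [h1, h2, star_mul', RCLike.star_def, Complex.conj_ofReal, h4]

/-- The kernel of `a` over an orbit segment vanishes at pairs of times that are separated by a visit
to `S`, if `a` breaks the orbits along `S`. -/
theorem segmentKernel_eq_zero {S : Set X} {a : ConvAlg φ} (ha : a ∈ breakingAlgebra φ S) {y : X}
    {T c t u : ℝ} (hT : 0 < T) (hc : φ c y ∈ S)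
    (h : (u ≤ c / T ∧ c / T ≤ t) ∨ (t ≤ c / T ∧ c / T ≤ u)) : segmentKernel a y T (t, u) = 0 := by
  rw [segmentKernel_apply, mul_sub, apply_eq_zero_of_mem_breakingAlgebra ha hc, mul_zero]
  simp only [div_le_iff₀ hT, le_div_iff₀ hT] at h
  simpa only [mul_comm T] using h

namespace CantorFlowBoxStructure

variable {x : X} (𝔅 : CantorFlowBoxStructure φ x)

theorem continuous_coe_eval (n : ℕ) (y : 𝔅.slice n) :
    Continuous fun f : 𝔅.SliceAlgebra n => (f y : L2I →L[ℂ] L2I) :=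
  continuous_subtype_val.comp (continuous_eval_const y)

variable (hmin : IsMinimalFlow φ)
include hmin

/-- The tower formula, on the range of the slice representation. The orbit segment over `y ∈ Sₙ₊₁`
is cut by its visits to `Sₙ` into the segments of the floors; if `a` breaks the orbits along `Sₙ`, then
the kernel of `a` over the whole segment vanishes off the diagonal blocks given by this partition, and
on the blocks it is the rescaled kernel of the floor. -/
theorem coe_sliceRep_succ_apply (n : ℕ) (a : breakingAlgebra φ (𝔅.slice n))
    (y : 𝔅.slice (n + 1)) :
    (𝔅.sliceRep hmin (n + 1) ⟨a, breakingAlgebra_antitone (𝔅.slice_succ_subset_slice n) a.2⟩ y :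
      L2I →L[ℂ] L2I) = ∑ k ∈ Finset.range (𝔅.towerHeight hmin n y + 1),
      𝔅.floorIsometry hmin n k y *
        (𝔅.sliceRep hmin n a ((𝔅.returnMap hmin n)^[k] (𝔅.incl n y)) : L2I →L[ℂ] L2I) *
          ContinuousLinearMap.adjoint (𝔅.floorIsometry hmin n k y) := by
  have hT : 0 < 𝔅.returnTime (n + 1) y := 𝔅.returnTime_pos hmin y
  have hN := 𝔅.floorTime_towerHeight hmin n y
  have hmono := (𝔅.floorTime_strictMono hmin n y).monotone
  have hvisit (k : ℕ) : φ (𝔅.floorTime hmin n k y) y ∈ 𝔅.slice n := by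
    rw [map_floorTime]
    exact Subtype.coe_prop _
  have hsegment (k : ℕ) :
      (𝔅.sliceRep hmin n a ((𝔅.returnMap hmin n)^[k] (𝔅.incl n y)) : L2I →L[ℂ] L2I) =
        kernelOp (segmentKernel (a : ConvAlg φ) (φ (𝔅.floorTime hmin n k y) y)
          (𝔅.returnTime n ((𝔅.returnMap hmin n)^[k] (𝔅.incl n y)))) := by
    rw [map_floorTime, coe_sliceRep_apply]
  rw [coe_sliceRep_apply]
  refine eq_of_forall_inner_contL2 fun f g => ?_
  rw [inner_kernelOp_contL2, sum_apply, inner_sum, integral_integral_eq_sum_blocks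
    (N := 𝔅.towerHeight hmin n y + 1) (p := fun k => 𝔅.floorTime hmin n k y / 𝔅.returnTime (n + 1) y)
    (fun i j h => div_le_div_of_nonneg_right (hmono h) hT.le) (by simp [floorTime_zero])
    (by simp only [hN, div_self hT.ne'])
    (H := fun t u => segmentKernel (a : ConvAlg φ) y (𝔅.returnTime (n + 1) y) (t, u) * g u *
      star (f t)) (by fun_prop)]
  · refine Finset.sum_congr rfl fun k hk => ?_
    have hc : 0 ≤ 𝔅.floorTime hmin n k y := by
      rw [← 𝔅.floorTime_zero hmin n y]
      exact hmono (Nat.zero_le k)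
    have hcT := hmono (Nat.succ_le_of_lt (Finset.mem_range.1 hk))
    change 𝔅.floorTime hmin n (k + 1) y ≤ 𝔅.floorTime hmin n (𝔅.towerHeight hmin n y + 1) y at hcT
    rw [hN, floorTime_succ] at hcT
    simp only [floorTime_succ]
    rw [hsegment, floorIsometry,
      inner_towerOperator_kernelOp _ _ hT (𝔅.returnTime_pos hmin _) hc hcT]
  · intro k _ t ht u hu
    have h0 : segmentKernel (a : ConvAlg φ) y (𝔅.returnTime (n + 1) y) (t, u) = 0 := by
      by_cases h : u ≤ 𝔅.floorTime hmin n k y / 𝔅.returnTime (n + 1) y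
      · exact segmentKernel_eq_zero a.2 hT (hvisit k) (Or.inl ⟨h, ht.1⟩)
      · refine segmentKernel_eq_zero a.2 hT (hvisit (k + 1)) (Or.inr ⟨ht.2, ?_⟩)
        by_contra! hlt
        exact hu ⟨not_le.1 h, hlt⟩
    rw [h0, zero_mul, zero_mul]

/-- As the slice representations are isometric with dense range, the inclusion of the algebra that
breaks the orbits along `Sₙ` into the one for `Sₙ₊₁` induces a `*`-homomorphism. -/
theorem exists_starAlgHom_sliceRep (n : ℕ) :
    ∃ ι : 𝔅.SliceAlgebra n →⋆ₙₐ[ℂ] 𝔅.SliceAlgebra (n + 1), ∀ a : breakingAlgebra φ (𝔅.slice n),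
      ι (𝔅.sliceRep hmin n a) = 𝔅.sliceRep hmin (n + 1)
        ⟨a, breakingAlgebra_antitone (𝔅.slice_succ_subset_slice n) a.2⟩ := by
  let g : breakingAlgebra φ (𝔅.slice n) →⋆ₙₐ[ℂ] 𝔅.SliceAlgebra (n + 1) :=
    (𝔅.sliceRep hmin (n + 1)).comp (NonUnitalStarSubalgebra.inclusion
      (breakingAlgebra_antitone (𝔅.slice_succ_subset_slice n)))
  have hg (a : breakingAlgebra φ (𝔅.slice n)) : g a = 𝔅.sliceRep hmin (n + 1)
      ⟨a, breakingAlgebra_antitone (𝔅.slice_succ_subset_slice n) a.2⟩ := rfl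
  have hnorm (a : breakingAlgebra φ (𝔅.slice n)) : ‖g a‖ ≤ ‖𝔅.sliceRep hmin n a‖ := by
    rw [hg, norm_sliceRep, norm_sliceRep]
  have h1 := exists_starAlgHom_extension (D := breakingAlgebra φ (𝔅.slice n))
    (A := 𝔅.SliceAlgebra n) (B := 𝔅.SliceAlgebra (n + 1))
  have h2 := h1 (𝔅.sliceRep hmin n)
  have h3 := h2 g (𝔅.denseRange_sliceRep hmin n)
  have h4 := h3 fun a => hnorm a
  exact h4

/-- By density of the range of the slice representation, the map induced by the inclusion is given by
the tower formula. -/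
theorem isConnectingMap_of_map_sliceRep {n : ℕ} {ι : 𝔅.SliceAlgebra n →⋆ₙₐ[ℂ] 𝔅.SliceAlgebra (n + 1)}
    (hι : ∀ a : breakingAlgebra φ (𝔅.slice n), ι (𝔅.sliceRep hmin n a) = 𝔅.sliceRep hmin (n + 1)
      ⟨a, breakingAlgebra_antitone (𝔅.slice_succ_subset_slice n) a.2⟩) :
    𝔅.IsConnectingMap hmin n ι := by
  intro f y
  have hcont := NonUnitalStarAlgHom.continuous_of_cstar (A := 𝔅.SliceAlgebra n)
    (B := 𝔅.SliceAlgebra (n + 1)) ι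
  have hmul (U V : L2I →L[ℂ] L2I) : Continuous fun K : L2I →L[ℂ] L2I => U * K * V := by fun_prop
  have hcl : IsClosed {f : 𝔅.SliceAlgebra n | (ι f y : L2I →L[ℂ] L2I) =
      ∑ k ∈ Finset.range (𝔅.towerHeight hmin n y + 1), 𝔅.floorIsometry hmin n k y *
        (f ((𝔅.returnMap hmin n)^[k] (𝔅.incl n y)) : L2I →L[ℂ] L2I) *
          ContinuousLinearMap.adjoint (𝔅.floorIsometry hmin n k y)} :=
    isClosed_eq ((𝔅.continuous_coe_eval (n + 1) y).comp hcont) (continuous_finsetSum _ fun k _ =>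
      (hmul _ _).comp (𝔅.continuous_coe_eval n _))
  refine (𝔅.denseRange_sliceRep hmin n).induction_on f hcl fun a => ?_
  rw [hι]
  exact 𝔅.coe_sliceRep_succ_apply hmin n a y

end CantorFlowBoxStructure

end Connecting

/-! ### Inductive limits -/

section InductiveLimit

variable {A : ℕ → Type*} [∀ n, NonUnitalCStarAlgebra (A n)] {ι : ∀ n, A n →⋆ₙₐ[ℂ] A (n + 1)}

theorem tendsto_norm_ofHom_thread (s : threadAlgebra A ι) :
    Tendsto (fun n => ‖(s : ∀ n, A n) n‖) atTop
      (𝓝 ‖CStarSeminorm.Completion.ofHom (limitSeminorm A ι) s‖) := by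
  have h : ‖CStarSeminorm.Completion.ofHom (limitSeminorm A ι) s‖ =
      limUnder atTop fun n => ‖(s : ∀ n, A n) n‖ :=
    CStarSeminorm.Completion.norm_of (p := limitSeminorm A ι) s
  rw [h]
  exact threadAlgebra.tendsto_lim s

theorem norm_ofHom_thread_le {s : threadAlgebra A ι} {N : ℕ}
    (h : ∀ n ≥ N, (s : ∀ n, A n) (n + 1) = ι n ((s : ∀ n, A n) n)) :
    ‖CStarSeminorm.Completion.ofHom (limitSeminorm A ι) s‖ ≤ ‖(s : ∀ n, A n) N‖ := by
  refine le_of_tendsto (tendsto_norm_ofHom_thread s) ((eventually_ge_atTop N).mono fun n hn => ?_)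
  induction n, hn using Nat.le_induction with
  | base => exact le_rfl
  | succ n hn ih =>
    rw [h n hn]
    exact (NonUnitalStarAlgHom.norm_apply_le (ι n) _).trans ih

variable {E : Type*} [NonUnitalRing E] [Module ℂ E] [StarRing E]
  {D : ℕ → NonUnitalStarSubalgebra ℂ E} (hD : Monotone D) (ρ : ∀ n, D n →⋆ₙₐ[ℂ] A n)

include hD in
theorem exists_thread (hρ : ∀ n (a : D n), ι n (ρ n a) = ρ (n + 1) ⟨a, hD (Nat.le_succ n) a.2⟩) {N : ℕ}
    (a : D N) : ∃ s : threadAlgebra A ι, ∀ n, ∀ h : N ≤ n,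
      (s : ∀ n, A n) n = ρ n ⟨a, hD h a.2⟩ := by
  classical
  let s : ∀ n, A n := fun n => if h : N ≤ n then ρ n ⟨a, hD h a.2⟩ else 0
  have hs (n : ℕ) (h : N ≤ n) : s n = ρ n ⟨a, hD h a.2⟩ := dif_pos h
  refine ⟨⟨s, (eventually_ge_atTop N).mono fun n hn => ?_⟩, hs⟩
  rw [hs n hn, hs (n + 1) (hn.trans (Nat.le_succ n)), hρ]

/-- The pairs of an element `a` of the union of the subalgebras `Dₙ` and of a sequence that is
eventually equal to `ρₙ(a)`. -/
def threadGraph (ρ : ∀ n, D n →⋆ₙₐ[ℂ] A n) : NonUnitalStarSubalgebra ℂ (E × threadAlgebra A ι) where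
  carrier := {p | ∀ᶠ n in atTop, ∃ h : p.1 ∈ D n, (p.2 : ∀ n, A n) n = ρ n ⟨p.1, h⟩}
  zero_mem' := Eventually.of_forall fun n => ⟨zero_mem _, (map_zero (ρ n)).symm⟩
  add_mem' := fun hp hq => by
    filter_upwards [hp, hq] with n ⟨h1, h2⟩ ⟨h3, h4⟩
    refine ⟨add_mem h1 h3, ?_⟩
    refine (congrArg₂ (· + ·) h2 h4).trans (map_add (ρ n) _ _).symm
  smul_mem' := fun c p hp => by
    filter_upwards [hp] with n ⟨h1, h2⟩
    refine ⟨SMulMemClass.smul_mem c h1, ?_⟩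
    exact (congrArg (c • ·) h2).trans (map_smul (ρ n) c _).symm
  mul_mem' := fun hp hq => by
    filter_upwards [hp, hq] with n ⟨h1, h2⟩ ⟨h3, h4⟩
    refine ⟨mul_mem h1 h3, ?_⟩
    refine (congrArg₂ (· * ·) h2 h4).trans (map_mul (ρ n) _ _).symm
  star_mem' := fun hp => by
    filter_upwards [hp] with n ⟨h1, h2⟩
    refine ⟨star_mem h1, ?_⟩
    exact (congrArg star h2).trans (map_star (ρ n) _).symm

/-- A C*-algebra `B` is the inductive limit of `(Aₙ, ιₙ)`, if a dense `*`-subalgebra of it is the union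
of an increasing sequence of `*`-subalgebras with isometric `*`-homomorphisms of dense range into
the `Aₙ`, that are compatible with the `ιₙ`. Both algebras are completions of `threadGraph`, in the same
norm. -/
theorem nonempty_starAlgEquiv_CStarLimit {C : Type*} [NonUnitalCStarAlgebra C] (j : E →⋆ₙₐ[ℂ] C)
    (B : NonUnitalStarSubalgebra ℂ C) (hB : IsClosed (B : Set C))
    (hρ : ∀ n (a : D n), ι n (ρ n a) = ρ (n + 1) ⟨a, hD (Nat.le_succ n) a.2⟩)
    (hdense : ∀ n, DenseRange (ρ n)) (hnorm : ∀ n (a : D n), ‖ρ n a‖ = ‖j a‖)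
    (hjB : ∀ n, ∀ a ∈ D n, j a ∈ B)
    (hBj : ∀ b ∈ B, ∀ ε > 0, ∃ n, ∃ a ∈ D n, ‖b - j a‖ < ε) :
    Nonempty (B ≃⋆ₐ[ℂ] CStarLimit A ι) := by
  have : IsClosed (B : Set C) := hB
  let G := threadGraph (ι := ι) ρ
  have hG (p : G) : j p.1.1 ∈ B := by
    obtain ⟨n, h, _⟩ := p.2.exists
    exact hjB n _ h
  let f : G →⋆ₙₐ[ℂ] B := NonUnitalStarAlgHom.codRestrict ((j.comp (NonUnitalStarAlgHom.fst ℂ _ _)).comp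
    (NonUnitalStarSubalgebraClass.subtype G)) B hG
  let g : G →⋆ₙₐ[ℂ] CStarLimit A ι := ((CStarSeminorm.Completion.ofHom (limitSeminorm A ι)).comp
    (NonUnitalStarAlgHom.snd ℂ _ _)).comp (NonUnitalStarSubalgebraClass.subtype G)
  have hmem {N : ℕ} {a : D N} {s : threadAlgebra A ι}
      (hs : ∀ n, ∀ h : N ≤ n, (s : ∀ n, A n) n = ρ n ⟨a, hD h a.2⟩) : ((a : E), s) ∈ G :=
    (eventually_ge_atTop N).mono fun n hn => ⟨hD hn a.2, hs n hn⟩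
  refine nonempty_starAlgEquiv_of_denseRange f g ?_ ?_ ?_
  · intro b
    rw [Metric.mem_closure_iff]
    intro ε hε
    obtain ⟨n, a, ha, hab⟩ := hBj b b.2 ε hε
    obtain ⟨s, hs⟩ := exists_thread hD ρ hρ ⟨a, ha⟩
    refine ⟨_, ⟨⟨(a, s), hmem hs⟩, rfl⟩, ?_⟩
    rw [dist_eq_norm]
    exact hab
  · intro z
    refine CStarSeminorm.Completion.isDenseInducing_of.dense.induction_on
      (p := fun z => z ∈ closure (range g)) z isClosed_closure fun s => ?_
    rw [Metric.mem_closure_iff]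
    intro ε hε
    let s : threadAlgebra A ι := s
    obtain ⟨N, hN⟩ := eventually_atTop.1 s.2
    obtain ⟨a, ha⟩ := Metric.denseRange_iff.1 (hdense N) ((s : ∀ n, A n) N) ε hε
    obtain ⟨s', hs'⟩ := exists_thread hD ρ hρ a
    refine ⟨_, ⟨⟨(a, s'), hmem hs'⟩, rfl⟩, ?_⟩
    have hsub : ∀ n ≥ N, ((s - s' : threadAlgebra A ι) : ∀ n, A n) (n + 1) =
        ι n (((s - s' : threadAlgebra A ι) : ∀ n, A n) n) := fun n hn => by
      have h1 := hN n hn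
      have h2 : (s' : ∀ n, A n) (n + 1) = ι n ((s' : ∀ n, A n) n) := by
        rw [hs' n hn, hs' (n + 1) (hn.trans (Nat.le_succ n)), hρ]
      exact (congrArg₂ (· - ·) h1 h2).trans (map_sub (ι n) _ _).symm
    have hle := norm_ofHom_thread_le hsub
    rw [map_sub] at hle
    rw [dist_eq_norm] at ha ⊢
    refine hle.trans_lt ?_
    rw [← hs' N le_rfl] at ha
    exact ha
  · intro p
    refine tendsto_nhds_unique (tendsto_norm_ofHom_thread p.1.2) (Tendsto.congr' ?_
      (tendsto_const_nhds (x := ‖j p.1.1‖)))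
    filter_upwards [p.2] with n ⟨h1, h2⟩
    rw [h2, hnorm]

end InductiveLimit

/-! ### Approximation by elements that break the orbits along a slice -/

section Truncation

/-- The continuous map `w ↦ w - δ w / max(|w|, δ)`, which moves points by at most `δ` and contracts
the disc of radius `δ` to `0`. -/
def softThreshold {δ : ℝ} (hδ : 0 < δ) : C(ℂ, ℂ) where
  toFun w := w - ((δ / max ‖w‖ δ : ℝ) : ℂ) * w
  continuous_toFun := continuous_id.sub ((Complex.continuous_ofReal.comp
    (continuous_const.div (continuous_norm.max continuous_const)
      fun _ => (lt_max_of_lt_right hδ).ne')).mul continuous_id)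

theorem softThreshold_eq_zero {δ : ℝ} (hδ : 0 < δ) {w : ℂ} (hw : ‖w‖ ≤ δ) :
    softThreshold hδ w = 0 := by
  have : (δ : ℂ) ≠ 0 := Complex.ofReal_ne_zero.2 hδ.ne'
  simp [softThreshold, max_eq_right hw, this]

theorem softThreshold_zero {δ : ℝ} (hδ : 0 < δ) : softThreshold hδ 0 = 0 :=
  softThreshold_eq_zero hδ (by simpa using hδ.le)

theorem norm_sub_softThreshold_le {δ : ℝ} (hδ : 0 < δ) (w : ℂ) : ‖w - softThreshold hδ w‖ ≤ δ := by
  have hm : 0 < max ‖w‖ δ := lt_max_of_lt_right hδ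
  simp only [softThreshold, ContinuousMap.coe_mk, sub_sub_cancel]
  rw [norm_mul, Complex.norm_real, Real.norm_of_nonneg (by positivity), div_mul_eq_mul_div,
    div_le_iff₀ hm]
  exact mul_le_mul_of_nonneg_left (le_max_left _ _) hδ.le

variable {X : Type*} [MetricSpace X] [CompactSpace X] {φ : Flow ℝ X}

/-- The composition of `a ∈ C_c(ℝ, C(X))` with `softThreshold`. -/
def ConvAlg.truncate {δ : ℝ} (hδ : 0 < δ) (a : ConvAlg φ) : ConvAlg φ where
  toFun s := (softThreshold hδ).comp (a s)
  continuous_toFun := (ContinuousMap.continuous_postcomp _).comp a.continuous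
  hasCompactSupport' := HasCompactSupport.intro a.hasCompactSupport.isCompact fun s hs => by
    ext z
    simp [image_eq_zero_of_notMem_tsupport hs, softThreshold_zero hδ]

theorem ConvAlg.truncate_apply {δ : ℝ} (hδ : 0 < δ) (a : ConvAlg φ) (s : ℝ) (z : X) :
    a.truncate hδ s z = softThreshold hδ (a s z) := rfl

theorem ConvAlg.l1Norm_sub_truncate_le {δ : ℝ} (hδ : 0 < δ) (a : ConvAlg φ) {R : ℝ} (hR : 0 ≤ R)
    (ha : ∀ s ∉ Icc (-R) R, a s = 0) : (a - a.truncate hδ).l1Norm ≤ 2 * R * δ := by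
  have hpt (s : ℝ) : ‖(a - a.truncate hδ) s‖ ≤ (Icc (-R) R).indicator (fun _ => δ) s := by
    refine (ContinuousMap.norm_le _ (indicator_nonneg (fun _ _ => hδ.le) _)).2 fun z => ?_
    change ‖a s z - softThreshold hδ (a s z)‖ ≤ _
    by_cases hs : s ∈ Icc (-R) R
    · rw [indicator_of_mem hs]
      exact norm_sub_softThreshold_le hδ _
    · rw [indicator_of_notMem hs, ha s hs]
      simp [softThreshold_zero hδ]
  calc (a - a.truncate hδ).l1Norm ≤ ∫ s, (Icc (-R) R).indicator (fun _ => δ) s := by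
        refine integral_mono (a - a.truncate hδ).integrable_norm ?_ hpt
        exact (integrable_indicator_iff measurableSet_Icc).2 (integrableOn_const (by simp))
    _ = 2 * R * δ := by
        rw [integral_indicator measurableSet_Icc, setIntegral_const]
        simp only [measureReal_def, Real.volume_Icc, smul_eq_mul]
        rw [ENNReal.toReal_ofReal (by linarith)]
        ring

/-- The truncations of an element that breaks the orbit of `x` at `x` break all orbits that pass
through a neighborhood of `x`, as the times in question run through a compact set. -/
theorem eventually_truncate_mem_pointAlgebra {x : X} {a : ConvAlg φ} (ha : a ∈ pointAlgebra φ x)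
    {δ : ℝ} (hδ : 0 < δ) : ∀ᶠ y in 𝓝 x, a.truncate hδ ∈ pointAlgebra φ y := by
  obtain ⟨R, hR⟩ := a.hasCompactSupport.isCompact.isBounded.subset_closedBall 0
  let K : Set (ℝ × ℝ) := (Icc (-R) R ×ˢ Icc (-R) R) ∩
    ({p | 0 ≤ p.2 ∧ p.2 ≤ p.1} ∪ {p | p.1 ≤ p.2 ∧ p.2 ≤ 0})
  have hK : IsCompact K := (isCompact_Icc.prod isCompact_Icc).inter_right
    (((isClosed_le continuous_const continuous_snd).inter
      (isClosed_le continuous_snd continuous_fst)).union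
        ((isClosed_le continuous_fst continuous_snd).inter
          (isClosed_le continuous_snd continuous_const)))
  have hcont : Continuous fun q : X × ℝ × ℝ => ‖a q.2.1 (φ q.2.2 q.1)‖ :=
    (a.continuous_uncurry.comp ((continuous_fst.comp continuous_snd).prodMk
      (φ.cont'.comp ((continuous_snd.comp continuous_snd).prodMk continuous_fst)))).norm
  have hsmall := hK.eventually_forall_of_forall_eventually (x₀ := x)
    (P := fun y p => ‖a p.1 (φ p.2 y)‖ < δ) fun p hp =>
      hcont.continuousAt.eventually_lt continuousAt_const (by simpa [ha p.1 p.2 hp.2] using hδ)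
  filter_upwards [hsmall] with y hy s t hst
  rw [ConvAlg.truncate_apply]
  by_cases hs : s ∈ tsupport a
  · have h := hR hs
    rw [Real.closedBall_eq_Icc, zero_sub, zero_add] at h
    refine softThreshold_eq_zero hδ (hy (s, t) ⟨⟨h, ?_⟩, hst⟩).le
    rcases hst with ⟨h1, h2⟩ | ⟨h1, h2⟩
    · exact ⟨by linarith [h.1, h.2], h2.trans h.2⟩
    · exact ⟨h.1.trans h1, by linarith [h.1, h.2]⟩
  · rw [image_eq_zero_of_notMem_tsupport hs]
    exact softThreshold_zero hδ

/-- The algebras that break the orbits along the slices exhaust the orbit-breaking algebra of `x` up to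
closure, since the slices shrink to `x`. -/
theorem CantorFlowBoxStructure.exists_breakingAlgebra_norm_sub_lt {x : X}
    (𝔅 : CantorFlowBoxStructure φ x) {b : CrossedProduct φ} (hb : b ∈ orbitBreakingAlgebra φ x)
    {ε : ℝ} (hε : 0 < ε) :
    ∃ n, ∃ a ∈ breakingAlgebra φ (𝔅.slice n), ‖b - CrossedProduct.of φ a‖ < ε := by
  obtain ⟨_, ⟨a, ha, rfl⟩, hab⟩ := Metric.mem_closure_iff.1 hb (ε / 2) (half_pos hε)
  obtain ⟨R, hR0, hR⟩ := a.hasCompactSupport.isCompact.isBounded.subset_closedBall_lt 0 0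
  have hδ : 0 < ε / (8 * R) := by positivity
  obtain ⟨N, hN⟩ := 𝔅.exists_slice_subset (eventually_truncate_mem_pointAlgebra ha hδ)
  refine ⟨N, a.truncate hδ, mem_breakingAlgebra.2 fun y hy => hN N le_rfl hy, ?_⟩
  have h1 : ‖CrossedProduct.of φ a - CrossedProduct.of φ (a.truncate hδ)‖ ≤ 2 * R * (ε / (8 * R)) := by
    rw [← map_sub]
    refine (CrossedProduct.norm_of_le_l1Norm _).trans (a.l1Norm_sub_truncate_le hδ hR0.le fun s hs => ?_)
    refine image_eq_zero_of_notMem_tsupport fun h => hs ?_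
    have := hR h
    rwa [Real.closedBall_eq_Icc, zero_sub, zero_add] at this
  have h2 : 2 * R * (ε / (8 * R)) = ε / 4 := by
    field_simp
    norm_num
  rw [dist_eq_norm] at hab
  calc ‖b - CrossedProduct.of φ (a.truncate hδ)‖
      ≤ ‖b - CrossedProduct.of φ a‖ + ‖CrossedProduct.of φ a - CrossedProduct.of φ (a.truncate hδ)‖ :=
        norm_sub_le_norm_sub_add_norm_sub _ _ _
    _ < ε / 2 + ε / 2 := add_lt_add_of_lt_of_le hab (by linarith)
    _ = ε := add_halves ε

end Truncation

end

theorem mainTheorem3 {X : Type*} [MetricSpace X] [CompactSpace X] (φ : Flow ℝ X)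
    (hfree : IsFreeFlow φ) (hmin : IsMinimalFlow φ) (x : X) (𝔅 : CantorFlowBoxStructure φ x)
    (h𝔅 : ∀ (n : ℕ) (y : 𝔅.slice (n + 1)),
      (𝔅.returnMap hmin n (𝔅.incl n y) : X) ∉ 𝔅.slice (n + 1)) :
    ∃ ι : ∀ n, 𝔅.SliceAlgebra n →⋆ₙₐ[ℂ] 𝔅.SliceAlgebra (n + 1),
      (∀ n, 𝔅.IsConnectingMap hmin n (ι n)) ∧
        Nonempty (orbitBreakingAlgebra φ x ≃⋆ₐ[ℂ] CStarLimit 𝔅.SliceAlgebra ι) := by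
  choose ι hι using 𝔅.exists_starAlgHom_sliceRep hmin
  refine ⟨ι, fun n => 𝔅.isConnectingMap_of_map_sliceRep hmin (hι n), ?_⟩
  have hmono : Monotone fun n => breakingAlgebra φ (𝔅.slice n) := fun _ _ h =>
    breakingAlgebra_antitone (𝔅.antitone_slice h)
  have hle (n : ℕ) (a : ConvAlg φ) (ha : a ∈ breakingAlgebra φ (𝔅.slice n)) :
      CrossedProduct.of φ a ∈ orbitBreakingAlgebra φ x :=
    subset_closure ⟨a, mem_breakingAlgebra.1 ha x (𝔅.mem_slice hmin n), rfl⟩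
  have key := nonempty_starAlgEquiv_CStarLimit (A := 𝔅.SliceAlgebra) (ι := ι)
    (D := fun n => breakingAlgebra φ (𝔅.slice n)) hmono (𝔅.sliceRep hmin)
    (CrossedProduct.of φ) (orbitBreakingAlgebra φ x) isClosed_closure
  have key2 := key hι (𝔅.denseRange_sliceRep hmin)
  have key3 := key2 (𝔅.norm_sliceRep hmin)
  exact key3 hle fun b hb ε hε => 𝔅.exists_breakingAlgebra_norm_sub_lt hb hε
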